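/- Let $n\ge 0$ and let $\lambda_0<\lambda_1<\dots<\lambda_n$ be real numbers. Let $M^{\mathbb R}_{\mathrm{St}_n,\lambda}$ be the space of real symmetric arrow matrices $$A=\begin{pmatrix} a_0&b_1&\cdots&b_n\\ b_1&a_1&&0\\ \vdots&&\ddots&\\ b_n&0&&a_n\end{pmatrix}$$ with eigenvalues $\lambda_0,\dots,\lambda_n$. Let $\mathcal B^n$ be the simple polytope obtained from the cube $[-1,1]^n$ by cutting off all the codimension-two faces $\{x_i=1,\ x_{i+1}=-1\}$, $1\le i\le n-1$; concretely, $\mathcal B^n=\{x\in[-1,1]^n : x_i-x_{i+1}\le 3/2 \text{ for } 1\le i\le n-1\}$. Its facets are the cube facets $\mathcal F_{\delta k}=\{x\in\mathcal B^n: x_k=\delta\}$ ($1\le k\le n$, $\delta=\pm1$) and the cut facets $\mathcal F_{\sigma_i}=\{x\in\mathcal B^n: x_i-x_{i+1}=3/2\}$ ($1\le i\le n-1$). A cut facet is the product of a segment in the coordinates $x_i,x_{i+1}$ and a polytope in the other coordinates; its antipodal map $\alpha_i$ reverses the segment and fixes the other coordinates, i.e. $(x_i,x_{i+1})\mapsto(-x_{i+1},-x_i)$.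 Theorem. The space $M^{\mathbb R}_{\mathrm{St}_n,\lambda}$ is canonically subdivided into $2^n n!$ top-dimensional cells, each combinatorially isomorphic to $\mathcal B^n$. More precisely, there is a homeomorphism $$\Bigl(\bigsqcup_{\sigma\in\Sigma_n,\ \epsilon\in\{\pm1\}^n}\mathcal B^n_{\sigma,\epsilon}\Bigr)\Big/\!\sim\ \;\cong\; M^{\mathbb R}_{\mathrm{St}_n,\lambda},\qquad \mathcal B^n_{\sigma,\epsilon}=\mathcal B^n,$$ where $\sim$ is the equivalence relation generated by the following identifications: (a) a point $x\in\mathcal F_{\sigma_i}\subset\mathcal B^n_{\sigma,\epsilon}$ is identified with $\alpha_i(x)\in\mathcal F_{\sigma_i}\subset\mathcal B^n_{\tau,\epsilon}$ if $\sigma\tau^{-1}=\sigma_i=(i,i+1)$; (b) a point $x\in\mathcal F_{\delta\,\sigma(k)}\subset\mathcal B^n_{\sigma,\epsilon_1}$ is identified with the same point $x\in\mathcal F_{\delta\,\sigma(k)}\subset\mathcal B^n_{\sigma,\epsilon_2}$ if $\epsilon_1\epsilon_2^{-1}$ has the entry $-1$ in position $k$ and $+1$ elsewhere. This homeomorphism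 can be chosen with the following properties. 1. It embeds every $\mathcal B^n_{\sigma,\epsilon}$, with image the set of all $A\in M^{\mathbb R}_{\mathrm{St}_n,\lambda}$ such that $a_k\in[\lambda_{\sigma(k)-1},\lambda_{\sigma(k)}]$ and $\epsilon_k b_k\ge 0$ for $k=1,\dots,n$. In this image the facets $\mathcal F_{+\sigma(k)}$, $\mathcal F_{-\sigma(k)}$ and $\mathcal F_{\sigma_i}$ correspond to the conditions $b_k=0,\ a_k=\lambda_{\sigma(k)}$; $\ b_k=0,\ a_k=\lambda_{\sigma(k)-1}$; and $a_{\sigma^{-1}(i)}=a_{\sigma^{-1}(i+1)}$, respectively. 2. Let the closed and the open cells be the images of the nonempty faces (including $\mathcal B^n$ itself) of the polytopes $\mathcal B^n_{\sigma,\epsilon}$ and of the relative interiors of these faces. Then each point of $M^{\mathbb R}_{\mathrm{St}_n,\lambda}$ lies in the interior of exactly one cell, and there are exactly $2^n n!$ cells of dimension $n$. 3. Each cell of codimension $s$ (that is, of dimension $n-s$) lies in exactly $2^{s}$ top-dimensional cells. -/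

import Mathlib

open Topology
open scoped Nat

namespace ArrowMatrix

noncomputable section

/-- The space of real symmetric arrow matrices of size `n + 1` (all entries outside the first row,
the first column and the main diagonal vanish) whose eigenvalues, counted with multiplicity, are
`lam 0, …, lam n`. As a subset of a space of matrices it carries the subspace topology. -/
def isospectral {n : ℕ} (lam : Fin (n + 1) → ℝ) : Set (Matrix (Fin (n + 1)) (Fin (n + 1)) ℝ) :=
  {A | A.IsSymm ∧ (∀ i j, i ≠ 0 → j ≠ 0 → i ≠ j → A i j = 0) ∧
    A.charpoly = ∏ i, (Polynomial.X - Polynomial.C (lam i))}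

/-- The simple polytope `𝓑ⁿ`: the cube `[-1, 1]ⁿ` with all the codimension two faces
`{x_i = 1, x_{i+1} = -1}` cut off. The hyperplane `x_i - x_{i+1} = 3/2` separates the vertices of
this face (where `x_i - x_{i+1} = 2`) from all the other vertices of the cube (where
`x_i - x_{i+1} ≤ 0`). Consecutive faces `{x_i = 1, x_{i+1} = -1}` and `{x_{i+1} = 1, x_{i+2} = -1}`
are disjoint, and so are their cutting hyperplanes inside the cube. -/
def polytope (n : ℕ) : Set (Fin n → ℝ) :=
  {x | (∀ k, -1 ≤ x k ∧ x k ≤ 1) ∧ ∀ i j : Fin n, (i : ℕ) + 1 = j → x i - x j ≤ 3 / 2}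

/-- The facet of `𝓑ⁿ` that comes from the facet `x_k = δ` of the cube, `δ = ±1`. -/
def cubeFacet {n : ℕ} (k : Fin n) (δ : ℤˣ) : Set (Fin n → ℝ) :=
  {x ∈ polytope n | x k = ((δ : ℤ) : ℝ)}

/-- The cut facet of `𝓑ⁿ`, for `j = i + 1`. It is the product of the segment
`{x_i - x_j = 3/2, 1/2 ≤ x_i ≤ 1}` in the coordinates `x_i, x_j` and of a polytope in the other
coordinates. -/
def cutFacet {n : ℕ} (i j : Fin n) : Set (Fin n → ℝ) :=
  {x ∈ polytope n | x i - x j = 3 / 2}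

/-- The antipodal map of the cut facet, for `j = i + 1`: it reverses the segment
`{x_i - x_j = 3/2, 1/2 ≤ x_i ≤ 1}` and fixes the other coordinates. -/
def antipode {n : ℕ} (i j : Fin n) (x : Fin n → ℝ) : Fin n → ℝ :=
  fun k => if k = i then -x j else if k = j then -x i else x k

/-- The antipodal map sends the cut facet to itself. -/
theorem antipode_mem_cutFacet {n : ℕ} {i j : Fin n} (hij : (i : ℕ) + 1 = j) {x : Fin n → ℝ}
    (hx : x ∈ cutFacet i j) : antipode i j x ∈ cutFacet i j := by
  obtain ⟨⟨hc, hp⟩, hx⟩ := hx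
  have hne : j ≠ i := by rintro rfl; omega
  have hi := hc i
  have hj := hc j
  refine ⟨⟨fun k => ?_, fun k l hkl => ?_⟩, ?_⟩
  · have hk := hc k
    unfold antipode
    split_ifs <;> constructor <;> linarith [hk.1, hk.2]
  · have hk := hc k
    have hl := hc l
    have hkl' := hp k l hkl
    unfold antipode
    split_ifs with h1 h2 h3 h4 h5 h6 h7 <;> subst_vars <;>
      first
        | linarith [hk.1, hk.2, hl.1, hl.2]
        | (exfalso; omega)
  · simp only [antipode, if_true, if_neg hne]
    linarith

/-- The disjoint union of the copies `𝓑ⁿ_{σ,ε}` of the polytope, one for each permutation `σ` and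
each vector of signs `ε`. -/
abbrev Pieces (n : ℕ) : Type :=
  Σ _ : Equiv.Perm (Fin n) × (Fin n → ℤˣ), polytope n

/-- The gluing relations between the copies of the polytope. The copy `𝓑ⁿ_{σ,ε}` lies over the
box with `k`-th side `[λ_{σ(k)-1}, λ_{σ(k)}]`, so the facets of this copy over the two facets of
this box that are orthogonal to the `k`-th coordinate axis are `cubeFacet (σ k) (±1)`. -/
inductive Glue {n : ℕ} : Pieces n → Pieces n → Prop
  /-- antipodal gluing along the cut facet of `i, j = i + 1` -/
  | cut (σ τ : Equiv.Perm (Fin n)) (ε : Fin n → ℤˣ) (i j : Fin n) (hij : (i : ℕ) + 1 = j)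
      (hστ : σ * τ⁻¹ = Equiv.swap i j) (x y : polytope n) (hx : x.1 ∈ cutFacet i j)
      (hy : y.1 = antipode i j x.1) : Glue ⟨(σ, ε), x⟩ ⟨(τ, ε), y⟩
  /-- gluing by the reflection in the `k`-th coordinate along the cube facets -/
  | cube (σ : Equiv.Perm (Fin n)) (ε₁ ε₂ : Fin n → ℤˣ) (k : Fin n) (δ : ℤˣ)
      (hε : ε₁ * ε₂⁻¹ = Pi.mulSingle k (-1)) (x : polytope n) (hx : x.1 ∈ cubeFacet (σ k) δ) :
      Glue ⟨(σ, ε₁), x⟩ ⟨(σ, ε₂), x⟩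

/-- The quotient of the disjoint union of the copies of the polytope by the equivalence relation
generated by the gluing relations, with the quotient topology. -/
abbrev Glued (n : ℕ) : Type := Quot (Glue (n := n))

/-- The map of the copy `𝓑ⁿ_{σ,ε}` to a space that is identified with the glued space. -/
def cellMap {n : ℕ} {X : Type*} [TopologicalSpace X] (Φ : Glued n ≃ₜ X)
    (σ : Equiv.Perm (Fin n)) (ε : Fin n → ℤˣ) (x : polytope n) : X :=
  Φ (Quot.mk _ ⟨(σ, ε), x⟩)

/-- `c` is a closed cell of dimension `d` and `o` is the corresponding open cell: the images of a
`d`-dimensional nonempty face of some copy of the polytope and of the relative interior of this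
face. -/
def IsCellPair {n : ℕ} {X : Type*} [TopologicalSpace X] (Φ : Glued n ≃ₜ X) (d : ℕ)
    (c o : Set X) : Prop :=
  ∃ (σ : Equiv.Perm (Fin n)) (ε : Fin n → ℤˣ) (F : Set (Fin n → ℝ)),
    IsExposed ℝ (polytope n) F ∧ F.Nonempty ∧ Module.finrank ℝ (vectorSpan ℝ F) = d ∧
    c = cellMap Φ σ ε '' {x | x.1 ∈ F} ∧
    o = cellMap Φ σ ε '' {x | x.1 ∈ intrinsicInterior ℝ F}

/-- `c` is a (closed) cell of dimension `d`. -/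
def IsCell {n : ℕ} {X : Type*} [TopologicalSpace X] (Φ : Glued n ≃ₜ X) (d : ℕ)
    (c : Set X) : Prop :=
  ∃ o, IsCellPair Φ d c o

/-- The part of the isospectral space over the box with sides `[λ_{σ(k)-1}, λ_{σ(k)}]` (for the map
that takes the diagonal entries `a_1, …, a_n` of the matrix) where the `k`-th off-diagonal entry
`b_k` has the sign `ε k` or vanishes. The box side of the 0-based index `σ k` is
`[lam (σ k), lam (σ k + 1)]`. -/
def chamber {n : ℕ} (lam : Fin (n + 1) → ℝ) (σ : Equiv.Perm (Fin n)) (ε : Fin n → ℤˣ) :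
    Set (isospectral lam) :=
  {A | ∀ k : Fin n, A.1 k.succ k.succ ∈ Set.Icc (lam (σ k).castSucc) (lam (σ k).succ) ∧
    0 ≤ ((ε k : ℤ) : ℝ) * A.1 0 k.succ}

end

end ArrowMatrix

/-! By Cauchy interlacing the diagonal entries `a_1, …, a_n` occupy the `n` spectral gaps, one entry
per gap. Choosing the gap of each entry and the signs of the `b_k` gives the chambers. As long as
the `a_k` are distinct, the residues of the resolvent determine `b_k ^ 2 = -∏ (a_k - λ_m) / ∏_{j ≠
k} (a_k - a_j)`, so the chamber is a graph over the box. Where two entries of neighbouring gaps meet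
at the common end, only the sum of the two squares is determined (`isospectral_sum_sq_eq`), and this
sum is positive. The fibre is then an arc instead of a point: the codimension-two face of the box is
blown up, and the result has the shape of `𝓑ⁿ`.

The parametrization `cell` makes this explicit. The map `shrinkR` collapses each cut facet along its
segment to a face of the cube, and `alpha` carries the cube to the box, with the same slope `c` at
the ends of all gaps. Near a cut facet, numerator and denominator of the critical quotient in the
residue formula share the factor `dampR`; cancelling it extends the quotient continuously (`ratio`,
`weight`). On the cut facet the quotient is linear along the segment (`ratio_of_mem_cutFacet`), so
the antipodal map exchanges the two squares, which is what exchanging two gaps in `σ` requires.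
Membership in the spectral set is first checked off the cut facets and then passes to the limit.
`cell_injective` and `range_cell` show that each piece is embedded onto its chamber.

If a matrix lies in two chambers, their permutations differ by exchanges of neighbouring gaps whose
entries coincide, and their signs differ only where `b_k = 0`. Each elementary change is a gluing
(`mk_eq_of_cell_eq`), so the glued space maps bijectively onto the isospectral space; compactness
makes this a homeomorphism.

The facet conditions can be stated on the matrix without reference to `σ` and `ε`
(`facetsAt_subset_iff`). Hence the faces of the pieces are strata that do not depend on the chamber
(`isCellPair_iff`, `mem_chamber_of_degenerates`). The polytope is simple, so codimension counts
facets, and every facet through a point doubles the number of chambers containing it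
(`ncard_chambers`). -/

namespace ArrowMatrix

/-! ### Faces of a polyhedron, described by their active inequalities. -/

section Polyhedron

variable {ι E : Type*} [NormedAddCommGroup E] [NormedSpace ℝ E]

/-- The polyhedron of the inequalities `l i x ≤ c i`. -/
def polyhedron (l : ι → StrongDual ℝ E) (c : ι → ℝ) : Set E := {x | ∀ i, l i x ≤ c i}

/-- The inequalities that are equalities at `x`. -/
def active (l : ι → StrongDual ℝ E) (c : ι → ℝ) (x : E) : Set ι := {i | l i x = c i}

/-- The smallest face of the polyhedron that contains `x`. -/
def faceAt (l : ι → StrongDual ℝ E) (c : ι → ℝ) (x : E) : Set E :=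
  {y ∈ polyhedron l c | active l c x ⊆ active l c y}

variable {l : ι → StrongDual ℝ E} {c : ι → ℝ} {x y : E}

theorem convex_polyhedron : Convex ℝ (polyhedron l c) := by
  intro x hx y hy a b ha hb hab i
  have h1 := mul_le_mul_of_nonneg_left (hx i) ha
  have h2 := mul_le_mul_of_nonneg_left (hy i) hb
  simp only [map_add, map_smul, smul_eq_mul]
  calc _ ≤ a * c i + b * c i := add_le_add h1 h2
    _ = c i := by rw [← add_mul, hab, one_mul]

theorem mem_faceAt_self (hx : x ∈ polyhedron l c) : x ∈ faceAt l c x := ⟨hx, subset_rfl⟩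

/-- On the polyhedron the sum of the forms active at `x` is bounded by the sum of their bounds, with
equality exactly where each of them is active. -/
theorem isExposed_faceAt [Finite ι] (hx : x ∈ polyhedron l c) :
    IsExposed ℝ (polyhedron l c) (faceAt l c x) := by
  classical
  have := Fintype.ofFinite ι
  intro _
  refine ⟨∑ i with l i x = c i, l i, ?_⟩
  have hle : ∀ y ∈ polyhedron l c, (∑ i with l i x = c i, l i) y ≤ ∑ i with l i x = c i, c i := by
    intro y hy
    rw [sum_apply]
    exact Finset.sum_le_sum fun i _ => hy i
  have hxe : (∑ i with l i x = c i, l i) x = ∑ i with l i x = c i, c i := by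
    rw [sum_apply]
    exact Finset.sum_congr rfl fun i hi => (Finset.mem_filter.1 hi).2
  ext y
  constructor
  · rintro ⟨hy, hxy⟩
    refine ⟨hy, fun z hz => (hle z hz).trans_eq ?_⟩
    rw [sum_apply]
    exact Finset.sum_congr rfl fun i hi => (hxy (Finset.mem_filter.1 hi).2).symm
  · rintro ⟨hy, hmax⟩
    refine ⟨hy, fun i hi => ?_⟩
    have h1 := (hle y hy).antisymm (hxe ▸ hmax x hx)
    rw [sum_apply, Finset.sum_eq_sum_iff_of_le fun i _ => hy i] at h1
    exact h1 i (Finset.mem_filter.2 ⟨Finset.mem_univ _, hi⟩)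

/-- A point of a polyhedron can be moved a little in any direction along its active face. -/
theorem eventually_add_smul_mem_polyhedron [Finite ι] {v : E} (hx : x ∈ polyhedron l c)
    (hv : ∀ i ∈ active l c x, l i v = 0) : ∀ᶠ t : ℝ in 𝓝 0, x + t • v ∈ polyhedron l c := by
  have h : ∀ i, ∀ᶠ t : ℝ in 𝓝 0, l i (x + t • v) ≤ c i := by
    intro i
    by_cases hi : i ∈ active l c x
    · refine Filter.Eventually.of_forall fun t => ?_
      simp [hv i hi, show l i x = c i from hi]
    · have hlt : l i x < c i := lt_of_le_of_ne (hx i) hi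
      have hc : Continuous fun t : ℝ => l i (x + t • v) := by fun_prop
      have := hc.tendsto 0
      simp only [zero_smul, add_zero] at this
      exact (this.eventually_lt_const hlt).mono fun t ht => ht.le
  exact Filter.eventually_all.2 h

theorem affineSpan_faceAt_apply_eq {i : ι} (hi : i ∈ active l c x)
    (hy : y ∈ affineSpan ℝ (faceAt l c x)) : l i y = c i := by
  have hsub : faceAt l c x ⊆ (AffineSubspace.comap (l i).toLinearMap.toAffineMap
      (AffineSubspace.mk' (c i) ⊥) : Set E) := by
    intro z hz
    have : l i z = c i := hz.2 hi
    simp [this]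
  have := affineSpan_le.2 hsub hy
  simpa [AffineSubspace.mem_comap, AffineSubspace.mem_mk', sub_eq_zero] using this

/-- Strict inequalities survive small moves inside the affine span. Conversely, an inequality tight
at a relatively interior point `y` is tight at `x`: otherwise prolonging the segment from `x`
slightly past `y` would violate it. -/
theorem intrinsicInterior_faceAt [Finite ι] (hx : x ∈ polyhedron l c) :
    intrinsicInterior ℝ (faceAt l c x) = {y ∈ polyhedron l c | active l c y = active l c x} := by
  ext y
  constructor
  · intro hy
    have hyF := intrinsicInterior_subset hy
    refine ⟨hyF.1, subset_antisymm (fun i hi => ?_) hyF.2⟩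
    obtain ⟨y', hy', rfl⟩ := mem_intrinsicInterior.1 hy
    have hxs : x ∈ affineSpan ℝ (faceAt l c x) := subset_affineSpan _ _ (mem_faceAt_self hx)
    have hmem : ∀ t : ℝ, AffineMap.lineMap (y' : E) x t ∈ affineSpan ℝ (faceAt l c x) :=
      fun t => AffineMap.lineMap_mem t y'.2 hxs
    have hcont : Continuous fun t : ℝ =>
        (⟨AffineMap.lineMap (y' : E) x t, hmem t⟩ : affineSpan ℝ (faceAt l c x)) :=
      Continuous.subtype_mk AffineMap.lineMap_continuous _
    have h0 := hcont.tendsto 0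
    have he : (⟨AffineMap.lineMap (y' : E) x (0 : ℝ), hmem 0⟩ : affineSpan ℝ (faceAt l c x)) = y' :=
      Subtype.ext (by simp)
    rw [he] at h0
    have hev := h0.eventually (mem_interior_iff_mem_nhds.1 hy')
    obtain ⟨t, ht, ht0⟩ := ((hev.filter_mono nhdsWithin_le_nhds).and
      (self_mem_nhdsWithin : Set.Iio (0 : ℝ) ∈ 𝓝[<] 0)).exists
    have h1 : l i (AffineMap.lineMap (y' : E) x t) ≤ c i := ht.1 i
    have h2 : l i (y' : E) = c i := hi
    have h3 : l i x ≤ c i := hx i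
    simp only [AffineMap.lineMap_apply, vsub_eq_sub, vadd_eq_add, map_add, map_smul, map_sub,
      smul_eq_mul, h2] at h1
    have ht0' : t < 0 := ht0
    have : l i x = c i := le_antisymm h3 (by nlinarith)
    exact this
  · rintro ⟨hy, hyx⟩
    refine mem_intrinsicInterior.2
      ⟨⟨y, subset_affineSpan _ _ ⟨hy, hyx.ge⟩⟩, mem_interior_iff_mem_nhds.2 ?_, rfl⟩
    have hev : ∀ᶠ z in 𝓝 y, ∀ i, i ∉ active l c x → l i z < c i := by
      refine Filter.eventually_all.2 fun i => ?_
      by_cases hi : i ∈ active l c x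
      · exact Filter.Eventually.of_forall fun z h => absurd hi h
      · have hlt : l i y < c i := lt_of_le_of_ne (hy i) (by rw [← hyx] at hi; exact hi)
        exact ((l i).continuous.tendsto y |>.eventually_lt_const hlt).mono fun z hz _ => hz
    have hev' := (continuous_subtype_val (p := fun z => z ∈ affineSpan ℝ (faceAt l c x))).tendsto
      ⟨y, subset_affineSpan _ _ ⟨hy, hyx.ge⟩⟩ |>.eventually hev
    filter_upwards [hev'] with z hz
    refine ⟨fun i => ?_, fun i hi => affineSpan_faceAt_apply_eq hi z.2⟩
    by_cases hi : i ∈ active l c x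
    · exact (affineSpan_faceAt_apply_eq hi z.2).le
    · exact (hz i hi).le

/-- Take `x` in the relative interior of `F`. A form tight at `x` is tight on all of `F`. Any point
of `faceAt l c x` is the end of a segment of the polyhedron that passes through `x`, so extremality
puts it into `F`. -/
theorem exists_eq_faceAt [Finite ι] [FiniteDimensional ℝ E] {F : Set E}
    (hF : IsExposed ℝ (polyhedron l c) F) (hne : F.Nonempty) :
    ∃ x ∈ polyhedron l c, F = faceAt l c x := by
  obtain ⟨x, hx⟩ := Set.Nonempty.intrinsicInterior (hF.convex convex_polyhedron) hne
  have hxF := intrinsicInterior_subset hx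
  have hxP := hF.subset hxF
  refine ⟨x, hxP, Set.Subset.antisymm ?_ ?_⟩
  · refine fun y hy => ⟨hF.subset hy, fun i hi => ?_⟩
    obtain ⟨x', hx', rfl⟩ := mem_intrinsicInterior.1 hx
    have hys : y ∈ affineSpan ℝ F := subset_affineSpan _ _ hy
    have hmem : ∀ t : ℝ, AffineMap.lineMap (x' : E) y t ∈ affineSpan ℝ F :=
      fun t => AffineMap.lineMap_mem t x'.2 hys
    have hcont : Continuous fun t : ℝ =>
        (⟨AffineMap.lineMap (x' : E) y t, hmem t⟩ : affineSpan ℝ F) :=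
      Continuous.subtype_mk AffineMap.lineMap_continuous _
    have h0 := hcont.tendsto 0
    have he : (⟨AffineMap.lineMap (x' : E) y (0 : ℝ), hmem 0⟩ : affineSpan ℝ F) = x' :=
      Subtype.ext (by simp)
    rw [he] at h0
    have hev := h0.eventually (mem_interior_iff_mem_nhds.1 hx')
    obtain ⟨t, ht, ht0⟩ := ((hev.filter_mono nhdsWithin_le_nhds).and
      (self_mem_nhdsWithin : Set.Iio (0 : ℝ) ∈ 𝓝[<] 0)).exists
    have h1 : l i (AffineMap.lineMap (x' : E) y t) ≤ c i := hF.subset ht i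
    have h2 : l i (x' : E) = c i := hi
    have h3 : l i y ≤ c i := hF.subset hy i
    simp only [AffineMap.lineMap_apply, vsub_eq_sub, vadd_eq_add, map_add, map_smul, map_sub,
      smul_eq_mul, h2] at h1
    have ht0' : t < 0 := ht0
    have : l i y = c i := le_antisymm h3 (by nlinarith)
    exact this
  · intro y hy
    have hv : ∀ i ∈ active l c x, l i (y - x) = 0 := by
      intro i hi
      have h1 : l i x = c i := hi
      have h2 : l i y = c i := hy.2 hi
      rw [map_sub, h1, h2, sub_self]
    obtain ⟨t, ht, ht0⟩ := (((eventually_add_smul_mem_polyhedron hxP hv).filter_mono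
      nhdsWithin_le_nhds).and (self_mem_nhdsWithin : Set.Iio (0 : ℝ) ∈ 𝓝[<] 0)).exists
    have ht0' : t < 0 := ht0
    refine hF.isExtreme.left_mem_of_mem_openSegment hy.1 ht hxF ?_
    have hd : 1 - t ≠ 0 := by linarith
    -- The weights that express `x` through `y` and `x + t • (y - x)`; they are positive because `t
    -- < 0`.
    refine ⟨-t / (1 - t), 1 / (1 - t), div_pos (by linarith) (by linarith),
      div_pos one_pos (by linarith), by field_simp; ring, ?_⟩
    have : x = (-t / (1 - t) + 1 / (1 - t) * t) • y +
        (1 / (1 - t) - 1 / (1 - t) * t) • x := by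
      rw [show -t / (1 - t) + 1 / (1 - t) * t = 0 by ring,
        show 1 / (1 - t) - 1 / (1 - t) * t = 1 by field_simp]
      simp
    conv_rhs => rw [this]
    module

theorem vectorSpan_faceAt [Finite ι] (hx : x ∈ polyhedron l c) :
    vectorSpan ℝ (faceAt l c x) =
      LinearMap.ker (LinearMap.pi fun i : active l c x => (l i).toLinearMap) := by
  apply le_antisymm
  · rw [vectorSpan_def, Submodule.span_le]
    rintro _ ⟨y, hy, z, hz, rfl⟩
    simp only [SetLike.mem_coe, LinearMap.mem_ker]
    ext i
    have h1 : l i y = c i := hy.2 i.2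
    have h2 : l i z = c i := hz.2 i.2
    simp [h1, h2]
  · intro v hv
    have hv' : ∀ i ∈ active l c x, l i v = 0 := fun i hi => congrFun hv ⟨i, hi⟩
    obtain ⟨t, ht, ht0⟩ := (((eventually_add_smul_mem_polyhedron hx hv').filter_mono
      nhdsWithin_le_nhds).and (self_mem_nhdsWithin : Set.Ioi (0 : ℝ) ∈ 𝓝[>] 0)).exists
    have hmem : x + t • v ∈ faceAt l c x := by
      refine ⟨ht, fun i hi => ?_⟩
      have h1 : l i x = c i := hi
      simp [active, h1, hv' i hi]
    have := vsub_mem_vectorSpan ℝ hmem (mem_faceAt_self hx)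
    simp only [vsub_eq_sub, add_sub_cancel_left] at this
    have ht0' : t ≠ 0 := (show 0 < t from ht0).ne'
    simpa [smul_smul, inv_mul_cancel₀ ht0'] using Submodule.smul_mem _ t⁻¹ this

/-- The dimension of a face where the active inequalities are independent. -/
theorem finrank_vectorSpan_faceAt [Finite ι] [FiniteDimensional ℝ E] (hx : x ∈ polyhedron l c)
    (hdual : ∀ i ∈ active l c x, ∃ v, l i v = 1 ∧ ∀ j ∈ active l c x, j ≠ i → l j v = 0) :
    Module.finrank ℝ (vectorSpan ℝ (faceAt l c x)) + (active l c x).ncard =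
      Module.finrank ℝ E := by
  classical
  have := Fintype.ofFinite ι
  rw [vectorSpan_faceAt hx, ← LinearMap.finrank_range_add_finrank_ker
    (LinearMap.pi fun i : active l c x => (l i).toLinearMap), add_comm]
  congr 1
  have hsurj : LinearMap.range (LinearMap.pi fun i : active l c x => (l i).toLinearMap) = ⊤ := by
    rw [LinearMap.range_eq_top]
    intro w
    choose! v hv1 hv0 using hdual
    refine ⟨∑ i : active l c x, w i • v i, ?_⟩
    ext j
    simp only [LinearMap.pi_apply, ContinuousLinearMap.coe_coe, map_sum, map_smul, smul_eq_mul]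
    rw [Finset.sum_eq_single j]
    · rw [hv1 j j.2, mul_one]
    · intro i _ hij
      rw [hv0 i i.2 j j.2 fun h => hij (Subtype.ext h.symm), mul_zero]
    · simp
  rw [hsurj, finrank_top, Module.finrank_fintype_fun_eq_card, ← Nat.card_eq_fintype_card,
    Nat.card_coe_set_eq]

end Polyhedron

end ArrowMatrix

namespace ArrowMatrix

/-! ### Arrow matrices and their characteristic polynomials. -/

section Arrow

open Polynomial

variable {n : ℕ}

/-- The symmetric arrow matrix with head `a₀`, diagonal entries `a` and off-diagonal entries `b`. -/
def arrow (a₀ : ℝ) (a b : Fin n → ℝ) : Matrix (Fin (n + 1)) (Fin (n + 1)) ℝ :=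
  Matrix.of (Fin.cons (Fin.cons a₀ b) fun k => Fin.cons (b k) (Pi.single k (a k)))

variable {a₀ a₀' : ℝ} {a b b' : Fin n → ℝ}

@[simp] theorem arrow_zero_zero : arrow a₀ a b 0 0 = a₀ := rfl

@[simp] theorem arrow_zero_succ (k : Fin n) : arrow a₀ a b 0 k.succ = b k := rfl

@[simp] theorem arrow_succ_zero (k : Fin n) : arrow a₀ a b k.succ 0 = b k := rfl

theorem arrow_succ_succ (k m : Fin n) :
    arrow a₀ a b k.succ m.succ = (Pi.single k (a k) : Fin n → ℝ) m := rfl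

@[simp] theorem arrow_succ_self (k : Fin n) : arrow a₀ a b k.succ k.succ = a k := by
  simp [arrow_succ_succ]

theorem arrow_isSymm : (arrow a₀ a b).IsSymm := by
  ext i j
  refine Fin.cases ?_ (fun i => ?_) i <;> refine Fin.cases ?_ (fun j => ?_) j <;>
    simp only [Matrix.transpose_apply, arrow_succ_zero, arrow_zero_succ, arrow_succ_succ]
  rcases eq_or_ne i j with rfl | h
  · rfl
  · rw [Pi.single_eq_of_ne h, Pi.single_eq_of_ne h.symm]

theorem arrow_apply_eq_zero (i j : Fin (n + 1)) (hi : i ≠ 0) (hj : j ≠ 0) (hij : i ≠ j) :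
    arrow a₀ a b i j = 0 := by
  obtain ⟨i, rfl⟩ := Fin.exists_succ_eq.2 hi
  obtain ⟨j, rfl⟩ := Fin.exists_succ_eq.2 hj
  rw [arrow_succ_succ, Pi.single_eq_of_ne fun h => hij (congrArg _ h.symm)]

theorem eq_arrow {A : Matrix (Fin (n + 1)) (Fin (n + 1)) ℝ} (hs : A.IsSymm)
    (h0 : ∀ i j, i ≠ 0 → j ≠ 0 → i ≠ j → A i j = 0) :
    A = arrow (A 0 0) (fun k => A k.succ k.succ) (fun k => A 0 k.succ) := by
  ext i j
  refine Fin.cases ?_ (fun i => ?_) i <;> refine Fin.cases ?_ (fun j => ?_) j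
  · rfl
  · rfl
  · exact hs.apply _ _
  · rw [arrow_succ_succ]
    rcases eq_or_ne j i with rfl | h
    · simp
    · rw [Pi.single_eq_of_ne h]
      exact h0 _ _ (Fin.succ_ne_zero _) (Fin.succ_ne_zero _) fun e => h (Fin.succ_injective _ e).symm

/-- Schur complement of the diagonal block, which is invertible because `z` avoids its entries. -/
theorem eval_charpoly_arrow {z : ℝ} (hz : ∀ k, z ≠ a k) :
    (arrow a₀ a b).charpoly.eval z =
      (∏ k, (z - a k)) * (z - a₀ - ∑ k, b k ^ 2 / (z - a k)) := by
  let e : Unit ⊕ Fin n ≃ Fin (n + 1) :=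
    { toFun := Sum.elim (fun _ => 0) Fin.succ
      invFun := Fin.cases (Sum.inl ()) Sum.inr
      left_inv := by rintro (_ | _) <;> rfl
      right_inv := fun i => by refine Fin.cases ?_ (fun i => ?_) i <;> rfl }
  have hd : ∀ k, z - a k ≠ 0 := fun k => sub_ne_zero.2 (hz k)
  let : Invertible (Matrix.diagonal fun k => z - a k) :=
    ⟨Matrix.diagonal fun k => (z - a k)⁻¹,
      by rw [Matrix.diagonal_mul_diagonal]; simp [hd],
      by rw [Matrix.diagonal_mul_diagonal]; simp [hd]⟩
  have hM : Matrix.scalar (Fin (n + 1)) z - arrow a₀ a b =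
      Matrix.reindex e e (Matrix.fromBlocks (Matrix.of fun _ _ : Unit => z - a₀)
        (Matrix.of fun _ k => -b k) (Matrix.of fun k _ => -b k)
        (Matrix.diagonal fun k => z - a k)) := by
    ext i j
    refine Fin.cases ?_ (fun i => ?_) i <;> refine Fin.cases ?_ (fun j => ?_) j
    · simp [e]
    · simp [e, (Fin.succ_ne_zero j).symm]
    · simp [e]
    · rcases eq_or_ne i j with rfl | h
      · simp [e]
      · simp [e, h, arrow_succ_succ]
  rw [Matrix.eval_charpoly, hM, Matrix.det_reindex_self, Matrix.det_fromBlocks₂₂,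
    Matrix.det_diagonal, Matrix.det_unique]
  congr 1
  have hinv : ⅟(Matrix.diagonal fun k => z - a k) = Matrix.diagonal fun k => (z - a k)⁻¹ := rfl
  rw [hinv]
  rw [Matrix.sub_apply, Matrix.of_apply, Matrix.mul_apply]
  simp only [Matrix.of_apply, Matrix.mul_diagonal]
  congr 1
  refine Finset.sum_congr rfl fun k _ => ?_
  rw [div_eq_mul_inv]
  ring

theorem charpoly_arrow :
    (arrow a₀ a b).charpoly =
      (X - C a₀) * ∏ k, (X - C (a k)) - ∑ k, C (b k ^ 2) * ∏ j ∈ Finset.univ.erase k, (X - C (a j)) := by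
  apply Polynomial.eq_of_infinite_eval_eq
  refine ((Set.finite_range a).infinite_compl).mono fun z hz => ?_
  have hz' : ∀ k, z ≠ a k := fun k h => hz ⟨k, h.symm⟩
  have hd : ∀ k, z - a k ≠ 0 := fun k => sub_ne_zero.2 (hz' k)
  rw [Set.mem_ofPred_eq, eval_charpoly_arrow hz']
  simp only [eval_sub, eval_mul, eval_X, eval_C, eval_prod, eval_finsetSum]
  rw [mul_sub, Finset.mul_sum, mul_comm]
  congr 1
  refine Finset.sum_congr rfl fun k _ => ?_
  rw [← Finset.mul_prod_erase _ _ (Finset.mem_univ k)]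
  field_simp [hd k]

/-- Only the summand that omits the factor `X - C (a k)` survives. This ties `b k ^ 2` to the
spectrum. -/
theorem eval_charpoly_arrow_apply (k : Fin n) :
    (arrow a₀ a b).charpoly.eval (a k) = -(b k ^ 2 * ∏ j ∈ Finset.univ.erase k, (a k - a j)) := by
  rw [charpoly_arrow]
  simp only [eval_sub, eval_mul, eval_X, eval_C, eval_prod, eval_finsetSum]
  rw [Finset.prod_eq_zero (Finset.mem_univ k) (sub_self _), mul_zero, zero_sub,
    Finset.sum_eq_single k]
  · intro m _ hm
    rw [Finset.prod_eq_zero (Finset.mem_erase.2 ⟨hm.symm, Finset.mem_univ k⟩) (sub_self _), mul_zero]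
  · simp

theorem trace_arrow : (arrow a₀ a b).trace = a₀ + ∑ k, a k := by
  simp [Matrix.trace, Fin.sum_univ_succ]

/-- Both sides are monic of degree `n + 1`, and the trace condition matches the next coefficient.
The difference has degree below `n` and vanishes at the `n` distinct points `a k`. -/
theorem charpoly_arrow_eq_prod {lam : Fin (n + 1) → ℝ} (ha : Function.Injective a)
    (ha₀ : a₀ = ∑ m, lam m - ∑ k, a k)
    (hb : ∀ k, b k ^ 2 * ∏ j ∈ Finset.univ.erase k, (a k - a j) = -∏ m, (a k - lam m)) :
    (arrow a₀ a b).charpoly = ∏ m, (X - C (lam m)) := by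
  refine Polynomial.eq_of_degree_sub_lt_of_eval_index_eq (v := a) Finset.univ ha.injOn ?_ ?_
  · have h1 : (arrow a₀ a b).charpoly.Monic := Matrix.charpoly_monic _
    have h1d : (arrow a₀ a b).charpoly.natDegree = n + 1 := by simp [Matrix.charpoly_natDegree_eq_dim]
    have h2 : (∏ m, (X - C (lam m))).Monic := monic_prod_of_monic _ _ fun m _ => monic_X_sub_C _
    have h2d : (∏ m, (X - C (lam m))).natDegree = n + 1 := by simp [natDegree_prod_of_monic, monic_X_sub_C]
    have h1c : (arrow a₀ a b).charpoly.coeff n = -∑ m, lam m := by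
      have h := Matrix.trace_eq_neg_charpoly_coeff (arrow a₀ a b)
      rw [trace_arrow] at h
      simp only [Fintype.card_fin, Nat.add_sub_cancel] at h
      linarith
    have h2c : (∏ m, (X - C (lam m))).coeff n = -∑ m, lam m := by
      have h := prod_X_sub_C_nextCoeff (s := Finset.univ) lam
      rwa [nextCoeff_of_natDegree_pos (by rw [h2d]; omega), h2d, Nat.add_sub_cancel] at h
    rw [Finset.card_fin, degree_lt_iff_coeff_zero]
    intro m hm
    rw [coeff_sub, sub_eq_zero]
    rcases hm.eq_or_lt with rfl | hm
    · rw [h1c, h2c]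
    rcases (Nat.succ_le_of_lt hm).eq_or_lt with rfl | hm
    · have e1 := h1.coeff_natDegree
      have e2 := h2.coeff_natDegree
      rw [h1d] at e1
      rw [h2d] at e2
      exact e1.trans e2.symm
    · rw [coeff_eq_zero_of_natDegree_lt (h1d.trans_lt hm), coeff_eq_zero_of_natDegree_lt (h2d.trans_lt hm)]
  · intro k _
    rw [eval_charpoly_arrow_apply, hb, neg_neg]
    simp [eval_prod]

/-- The residue of the resolvent at `v` only depends on the spectrum and the diagonal. -/
theorem sum_sq_eq_of_charpoly_eq (h : (arrow a₀ a b).charpoly = (arrow a₀' a b').charpoly) (v : ℝ) :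
    ∑ k with a k = v, b k ^ 2 = ∑ k with a k = v, b' k ^ 2 := by
  -- Multiplying the Schur complement by `z - v` and letting `z` tend to `v` keeps just the terms
  -- with their pole at `v`.
  have key : ∀ (c : ℝ) (d : Fin n → ℝ), Filter.Tendsto
      (fun z => (z - v) * (c - ∑ k, d k ^ 2 / (z - a k))) (𝓝[≠] v)
      (𝓝 (-∑ k with a k = v, d k ^ 2)) := by
    intro c d
    have hzv : Filter.Tendsto (fun z => z - v) (𝓝[≠] v) (𝓝 0) := by
      have : Filter.Tendsto (fun z => z - v) (𝓝 v) (𝓝 (v - v)) := by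
        exact (continuous_id.sub continuous_const).tendsto v
      rw [sub_self] at this
      exact this.mono_left nhdsWithin_le_nhds
    have hk : ∀ k, Filter.Tendsto (fun z => (z - v) * (d k ^ 2 / (z - a k))) (𝓝[≠] v)
        (𝓝 (if a k = v then d k ^ 2 else 0)) := by
      intro k
      split_ifs with hkv
      · refine tendsto_const_nhds.congr' ?_
        filter_upwards [self_mem_nhdsWithin] with z hz
        have : z - v ≠ 0 := sub_ne_zero.2 hz
        rw [hkv]
        field_simp
      · have : Filter.Tendsto (fun z => d k ^ 2 / (z - a k)) (𝓝[≠] v) (𝓝 (d k ^ 2 / (v - a k))) := by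
          have hne : v - a k ≠ 0 := sub_ne_zero.2 (Ne.symm hkv)
          refine Filter.Tendsto.mono_left ?_ nhdsWithin_le_nhds
          exact tendsto_const_nhds.div ((continuous_id.sub continuous_const).tendsto v) hne
        simpa using hzv.mul this
    have := (hzv.mul_const c).sub (tendsto_finsetSum Finset.univ fun k _ => hk k)
    rw [zero_mul, zero_sub, ← Finset.sum_filter] at this
    refine this.congr fun z => ?_
    rw [mul_sub, Finset.mul_sum]
  have hne : ∀ᶠ z in 𝓝[≠] v, ∀ k, z ≠ a k := by
    refine Filter.eventually_all.2 fun k => ?_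
    rcases eq_or_ne (a k) v with hkv | hkv
    · rw [hkv]; exact self_mem_nhdsWithin
    · exact (isOpen_ne.eventually_mem hkv.symm).filter_mono nhdsWithin_le_nhds
  have := tendsto_nhds_unique ((key (-a₀) b).congr' ?_) (key (-a₀') b')
  · exact neg_injective this
  · filter_upwards [hne] with z hz
    have h1 := congrArg (eval z) h
    rw [eval_charpoly_arrow hz, eval_charpoly_arrow hz] at h1
    have h2 := mul_left_cancel₀ (Finset.prod_ne_zero_iff.2 fun k _ => sub_ne_zero.2 (hz k)) h1
    congr 1
    linarith

variable {lam : Fin (n + 1) → ℝ}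

theorem isospectral_eq_arrow (A : isospectral lam) :
    A.1 = arrow (A.1 0 0) (fun k => A.1 k.succ k.succ) (fun k => A.1 0 k.succ) :=
  eq_arrow A.2.1 A.2.2.1

theorem isospectral_apply_zero_zero (A : isospectral lam) :
    A.1 0 0 = ∑ m, lam m - ∑ k : Fin n, A.1 k.succ k.succ := by
  have h := Matrix.trace_eq_neg_charpoly_nextCoeff A.1
  rw [A.2.2.2, prod_X_sub_C_nextCoeff, neg_neg] at h
  rw [← h, Matrix.trace, Fin.sum_univ_succ]
  simp

theorem isospectral_ext {A B : isospectral lam} (ha : ∀ k : Fin n, A.1 k.succ k.succ = B.1 k.succ k.succ)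
    (hb : ∀ k : Fin n, A.1 0 k.succ = B.1 0 k.succ) : A = B := by
  apply Subtype.ext
  rw [isospectral_eq_arrow A, isospectral_eq_arrow B, isospectral_apply_zero_zero,
    isospectral_apply_zero_zero]
  simp only [ha, hb]

theorem isospectral_sum_sq_eq {A B : isospectral lam}
    (ha : ∀ k : Fin n, A.1 k.succ k.succ = B.1 k.succ k.succ) (v : ℝ) :
    ∑ k : Fin n with A.1 k.succ k.succ = v, A.1 0 k.succ ^ 2 =
      ∑ k : Fin n with A.1 k.succ k.succ = v, B.1 0 k.succ ^ 2 := by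
  refine sum_sq_eq_of_charpoly_eq (a := fun k : Fin n => A.1 k.succ k.succ) (b := fun k : Fin n => A.1 0 k.succ)
    (b' := fun k : Fin n => B.1 0 k.succ) (a₀ := A.1 0 0) (a₀' := B.1 0 0) ?_ v
  rw [← isospectral_eq_arrow A]
  simp only [ha]
  rw [← isospectral_eq_arrow B, A.2.2.2, B.2.2.2]

/-- A characteristic polynomial is determined by its values, which are determinants and so depend
continuously on the matrix. -/
theorem isClosed_isospectral : IsClosed (isospectral lam) := by
  have : isospectral lam = {A | A.IsSymm} ∩ ((⋂ i, ⋂ j, ⋂ (_ : i ≠ 0 ∧ j ≠ 0 ∧ i ≠ j), {A | A i j = 0}) ∩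
      ⋂ z : ℝ, {A | (Matrix.scalar _ z - A).det = (∏ i, (X - C (lam i))).eval z}) := by
    ext A
    simp only [isospectral, Set.mem_ofPred_eq, Set.mem_inter_iff, Set.mem_iInter, and_imp]
    refine and_congr_right fun _ => and_congr ⟨fun h i j h1 h2 h3 => h i j h1 h2 h3,
      fun h i j h1 h2 h3 => h i j h1 h2 h3⟩ ⟨fun h z => ?_, fun h => ?_⟩
    · rw [← Matrix.eval_charpoly, h]
    · exact Polynomial.funext fun z => by rw [Matrix.eval_charpoly, h]
  rw [this]
  refine IsClosed.inter ?_ (IsClosed.inter ?_ ?_)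
  · exact isClosed_eq (Continuous.matrix_transpose continuous_id) continuous_id
  · refine isClosed_iInter fun i => isClosed_iInter fun j => isClosed_iInter fun _ => ?_
    exact isClosed_eq (continuous_id.matrix_elem i j) continuous_const
  · refine isClosed_iInter fun z => ?_
    exact isClosed_eq (Continuous.matrix_det (continuous_const.sub continuous_id)) continuous_const

end Arrow

/-! ### Cauchy interlacing by dimension counting. -/

section Interlacing

variable {n : ℕ} {lam : Fin (n + 1) → ℝ}

/-- Coordinates in an orthonormal basis of eigenvectors. -/
theorem exists_eigen_coordinates (hlam : Function.Injective lam) (A : isospectral lam) :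
    ∃ v : Fin (n + 1) → Fin (n + 1) → ℝ, (∀ z, z ⬝ᵥ z = ∑ m, (v m ⬝ᵥ z) ^ 2) ∧
      ∀ z, z ⬝ᵥ A.1.mulVec z = ∑ m, lam m * (v m ⬝ᵥ z) ^ 2 := by
  have hA : A.1.IsHermitian := by
    rw [Matrix.IsHermitian, Matrix.conjTranspose_eq_transpose_of_trivial]
    exact A.2.1
  have hroots := hA.roots_charpoly_eq_eigenvalues
  rw [A.2.2.2] at hroots
  have hex : ∀ m, ∃ i, hA.eigenvalues i = lam m := by
    intro m
    have hm : lam m ∈ (∏ i, (Polynomial.X - Polynomial.C (lam i))).roots := by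
      rw [Polynomial.mem_roots (Polynomial.monic_prod_of_monic _ _
        fun m _ => Polynomial.monic_X_sub_C _).ne_zero, Polynomial.IsRoot, Polynomial.eval_prod]
      exact Finset.prod_eq_zero (Finset.mem_univ m) (by simp)
    rw [hroots] at hm
    obtain ⟨i, -, hi⟩ := Multiset.mem_map.1 hm
    exact ⟨i, hi⟩
  choose f hf using hex
  -- The `n + 1` values `lam m` are distinct, so the chosen eigenvectors exhaust the basis.
  have hinj : Function.Injective f := fun i j h => hlam (by rw [← hf, ← hf, h])
  let e := Equiv.ofBijective f (Finite.injective_iff_bijective.1 hinj)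
  have hinner : ∀ i (z : Fin (n + 1) → ℝ), inner ℝ (hA.eigenvectorBasis i) (WithLp.toLp 2 z) =
      (hA.eigenvectorBasis i).ofLp ⬝ᵥ z := by
    intro i z
    rw [EuclideanSpace.inner_eq_star_dotProduct, dotProduct_comm, star_trivial]
  have hsum : ∀ w z : Fin (n + 1) → ℝ, w ⬝ᵥ z = ∑ m, ((hA.eigenvectorBasis (f m)).ofLp ⬝ᵥ w) *
      ((hA.eigenvectorBasis (f m)).ofLp ⬝ᵥ z) := by
    intro w z
    have h := hA.eigenvectorBasis.sum_inner_mul_inner (WithLp.toLp 2 w) (WithLp.toLp 2 z)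
    rw [EuclideanSpace.inner_eq_star_dotProduct, star_trivial, dotProduct_comm] at h
    refine h.symm.trans ?_
    rw [← e.sum_comp]
    refine Finset.sum_congr rfl fun m _ => ?_
    rw [real_inner_comm, hinner, hinner]
    rfl
  refine ⟨fun m => (hA.eigenvectorBasis (f m)).ofLp, fun z => ?_, fun z => ?_⟩
  · rw [hsum]
    exact Finset.sum_congr rfl fun m _ => (sq _).symm
  · rw [hsum]
    refine Finset.sum_congr rfl fun m _ => ?_
    have : (hA.eigenvectorBasis (f m)).ofLp ⬝ᵥ A.1.mulVec z =
        lam m * ((hA.eigenvectorBasis (f m)).ofLp ⬝ᵥ z) := by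
      rw [Matrix.dotProduct_mulVec, ← Matrix.mulVec_transpose, A.2.1.eq,
        hA.mulVec_eigenvectorBasis, smul_dotProduct, hf, smul_eq_mul]
    rw [this]
    ring

theorem isospectral_dotProduct_mulVec (A : isospectral lam) {z : Fin (n + 1) → ℝ} (hz : z 0 = 0) :
    z ⬝ᵥ A.1.mulVec z = ∑ k : Fin n, A.1 k.succ k.succ * z k.succ ^ 2 := by
  rw [dotProduct, Fin.sum_univ_succ, hz, zero_mul, zero_add]
  refine Finset.sum_congr rfl fun k _ => ?_
  rw [Matrix.mulVec, dotProduct, Finset.sum_eq_single k.succ]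
  · ring
  · intro m _ hm
    rcases eq_or_ne m 0 with rfl | h0
    · rw [hz, mul_zero]
    · rw [A.2.2.1 _ _ (Fin.succ_ne_zero k) h0 hm.symm, zero_mul]
  · simp

theorem exists_ne_zero_of_conditions (w : Fin n → Fin (n + 1) → ℝ) :
    ∃ z : Fin (n + 1) → ℝ, z ≠ 0 ∧ ∀ j, w j ⬝ᵥ z = 0 := by
  obtain ⟨z, hz, hz0⟩ := (Submodule.ne_bot_iff _).1 (LinearMap.ker_ne_bot_of_finrank_lt
    (f := (Matrix.of w).mulVecLin) (by simp))
  exact ⟨z, hz0, fun j => congrFun hz j⟩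

/-- Cauchy interlacing for the diagonal entries of an isospectral arrow matrix. -/
theorem exists_perm_mem_Icc (hlam : StrictMono lam) (A : isospectral lam) :
    ∃ σ : Equiv.Perm (Fin n), ∀ k : Fin n,
      A.1 k.succ k.succ ∈ Set.Icc (lam (σ k).castSucc) (lam (σ k).succ) := by
  obtain ⟨v, hv1, hv2⟩ := exists_eigen_coordinates hlam.injective A
  set a : Fin n → ℝ := fun k => A.1 k.succ k.succ with ha
  set p := Tuple.sort a with hp
  have hmono : Monotone (a ∘ p) := Tuple.monotone_sort a
  have hnorm : ∀ z : Fin (n + 1) → ℝ, z 0 = 0 → z ⬝ᵥ z = ∑ k : Fin n, z k.succ ^ 2 := by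
    intro z hz
    rw [dotProduct, Fin.sum_univ_succ, hz]
    simp [sq]
  have hpos : ∀ z : Fin (n + 1) → ℝ, z ≠ 0 → 0 < z ⬝ᵥ z := by
    intro z hz
    refine lt_of_le_of_ne ?_ (Ne.symm (mt dotProduct_self_eq_zero.1 hz))
    exact Finset.sum_nonneg fun i _ => mul_self_nonneg _
  have key : ∀ i, a (p i) ∈ Set.Icc (lam i.castSucc) (lam i.succ) := by
    intro i
    constructor
    -- Exactly `n` conditions: slots `j < i` remove the eigenvectors of the eigenvalues below `lam
    -- i.castSucc`, slot `i` kills the head coordinate, slots `j > i` kill the coordinates after the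
    -- `i`-th in sorted order. The Rayleigh quotient of `z` is then at least `lam i.castSucc` and at
    -- most `a (p i)`.
    · obtain ⟨z, hz, hw⟩ := exists_ne_zero_of_conditions fun j : Fin n =>
        if j < i then v j.castSucc else if j = i then Pi.single 0 1 else Pi.single (p j).succ 1
      have hz0 : z 0 = 0 := by simpa using hw i
      have h1 : z ⬝ᵥ A.1.mulVec z ≤ a (p i) * z ⬝ᵥ z := by
        rw [isospectral_dotProduct_mulVec A hz0, hnorm z hz0, Finset.mul_sum]
        rw [← Equiv.sum_comp p fun k => a (p i) * z k.succ ^ 2,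
          ← Equiv.sum_comp p fun k : Fin n => A.1 k.succ k.succ * z k.succ ^ 2]
        refine Finset.sum_le_sum fun j _ => ?_
        rcases le_or_gt j i with hj | hj
        · exact mul_le_mul_of_nonneg_right (hmono hj) (sq_nonneg _)
        · have := hw j
          simp only [if_neg hj.not_gt, if_neg hj.ne'] at this
          have h0 : z (p j).succ = 0 := by simpa using this
          simp [h0]
      have h2 : lam i.castSucc * z ⬝ᵥ z ≤ z ⬝ᵥ A.1.mulVec z := by
        rw [hv1, hv2, Finset.mul_sum]
        refine Finset.sum_le_sum fun m _ => ?_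
        rcases le_or_gt i.castSucc m with hm | hm
        · exact mul_le_mul_of_nonneg_right (hlam.monotone hm) (sq_nonneg _)
        · have hmn : (m : ℕ) < i := hm
          have := hw ⟨m, hmn.trans i.2⟩
          rw [if_pos (show (⟨m, hmn.trans i.2⟩ : Fin n) < i from hmn)] at this
          have h0 : v m ⬝ᵥ z = 0 := this
          simp [h0]
      exact le_of_mul_le_mul_right (h2.trans h1) (hpos z hz)
    -- The mirror choice: eigenvectors above `i.succ` and coordinates of lower rank are removed.
    · obtain ⟨z, hz, hw⟩ := exists_ne_zero_of_conditions fun j : Fin n =>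
        if i < j then v j.succ else if j = i then Pi.single 0 1 else Pi.single (p j).succ 1
      have hz0 : z 0 = 0 := by simpa using hw i
      have h1 : a (p i) * z ⬝ᵥ z ≤ z ⬝ᵥ A.1.mulVec z := by
        rw [isospectral_dotProduct_mulVec A hz0, hnorm z hz0, Finset.mul_sum]
        rw [← Equiv.sum_comp p fun k => a (p i) * z k.succ ^ 2,
          ← Equiv.sum_comp p fun k : Fin n => A.1 k.succ k.succ * z k.succ ^ 2]
        refine Finset.sum_le_sum fun j _ => ?_
        rcases le_or_gt i j with hj | hj
        · exact mul_le_mul_of_nonneg_right (hmono hj) (sq_nonneg _)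
        · have := hw j
          simp only [if_neg hj.not_gt, if_neg hj.ne] at this
          have h0 : z (p j).succ = 0 := by simpa using this
          simp [h0]
      have h2 : z ⬝ᵥ A.1.mulVec z ≤ lam i.succ * z ⬝ᵥ z := by
        rw [hv1, hv2, Finset.mul_sum]
        refine Finset.sum_le_sum fun m _ => ?_
        rcases le_or_gt m i.succ with hm | hm
        · exact mul_le_mul_of_nonneg_right (hlam.monotone hm) (sq_nonneg _)
        · obtain ⟨j, rfl⟩ := Fin.exists_succ_eq.2 ((Fin.zero_le _).trans_lt hm).ne'
          have := hw j
          rw [if_pos (Fin.succ_lt_succ_iff.1 hm)] at this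
          simp [this]
      exact le_of_mul_le_mul_right (h1.trans h2) (hpos z hz)
  -- `p` sends a rank to the entry of that rank, and the rank is the number of the gap.
  refine ⟨p⁻¹, fun k => ?_⟩
  have := key (p⁻¹ k)
  rwa [← Equiv.Perm.mul_apply, mul_inv_cancel] at this

end Interlacing

end ArrowMatrix

namespace ArrowMatrix

noncomputable section

/-! ### Neighbouring indices with default values at the ends. -/

section Neighbours

variable {n : ℕ}

/-- The next index, or the index itself if it is the last one. -/
def nxt (i : Fin n) : Fin n := if h : (i : ℕ) + 1 < n then ⟨i + 1, h⟩ else i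

/-- The previous index, or the index itself if it is the first one. -/
def prv (i : Fin n) : Fin n := ⟨i - 1, (Nat.sub_le _ _).trans_lt i.2⟩

theorem nxt_eq {i j : Fin n} (h : (i : ℕ) + 1 = j) : nxt i = j := by
  exact Fin.ext (by simp [nxt, h])

theorem prv_eq {i j : Fin n} (h : (i : ℕ) + 1 = j) : prv j = i :=
  Fin.ext (by simp [prv, ← h])

theorem nxt_eq_self_or (i : Fin n) : nxt i = i ∨ (i : ℕ) + 1 = nxt i := by
  by_cases h : (i : ℕ) + 1 < n
  · right; simp [nxt, h]
  · left; simp [nxt, h]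

theorem prv_eq_self_or (i : Fin n) : prv i = i ∨ (prv i : ℕ) + 1 = i := by
  rcases Nat.eq_zero_or_pos (i : ℕ) with h | h
  · left; exact Fin.ext (by simp [prv, h])
  · right; simp only [prv]; omega

end Neighbours

/-! ### The radial contraction at one corner of the cube and its inverse. -/

section Damp

/-- The factor by which a corner of the cube is contracted, at distance `r`. -/
def damp (r : ℝ) : ℝ := min (2 - (2 * r)⁻¹) 1

variable {r : ℝ}

theorem damp_le_one : damp r ≤ 1 := min_le_right _ _

theorem damp_eq_one (h : 1 / 2 ≤ r) : damp r = 1 := by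
  refine min_eq_right ?_
  have : (2 * r)⁻¹ ≤ 1 := inv_le_one_of_one_le₀ (by linarith)
  linarith

theorem damp_eq_of_le (h0 : 1 / 4 ≤ r) (h : r ≤ 1 / 2) : damp r = 2 - (2 * r)⁻¹ := by
  refine min_eq_left ?_
  have : 1 ≤ (2 * r)⁻¹ := (one_le_inv₀ (by linarith)).2 (by linarith)
  linarith

/-- The purpose of `damp`: distances in `[1/4, 1/2]` are stretched affinely onto `[0, 1/2]`, so the
cut, at distance `1/4`, goes to the corner, and the stretching fits the identity beyond `1/2`. -/
theorem mul_damp (h0 : 1 / 4 ≤ r) (h : r ≤ 1 / 2) : r * damp r = 2 * r - 1 / 2 := by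
  rw [damp_eq_of_le h0 h]
  have : r ≠ 0 := by linarith
  field_simp

theorem damp_nonneg (h0 : 1 / 4 ≤ r) : 0 ≤ damp r := by
  refine le_min ?_ zero_le_one
  have : (2 * r)⁻¹ ≤ (1 / 2)⁻¹ := inv_anti₀ (by norm_num) (by linarith)
  norm_num at this ⊢
  linarith

theorem damp_eq_zero_iff (h0 : 1 / 4 ≤ r) : damp r = 0 ↔ r = 1 / 4 := by
  constructor
  · intro h
    rcases le_total r (1 / 2) with h1 | h1
    · have := mul_damp h0 h1
      rw [h] at this
      linarith
    · rw [damp_eq_one h1] at h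
      norm_num at h
  · rintro rfl
    rw [damp_eq_of_le le_rfl (by norm_num)]
    norm_num

/-- The distance from the corner before the contraction, as a function of the distance after it. -/
def undamp (r : ℝ) : ℝ := max r (r / 2 + 1 / 4)

theorem undamp_of_le (h : r ≤ 1 / 2) : undamp r = r / 2 + 1 / 4 := max_eq_right (by linarith)

theorem undamp_of_ge (h : 1 / 2 ≤ r) : undamp r = r := max_eq_left (by linarith)

theorem undamp_ge (h : 0 ≤ r) : 1 / 4 ≤ undamp r := le_max_of_le_right (by linarith)

theorem undamp_mul_damp (h : 0 ≤ r) : undamp r * damp (undamp r) = r := by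
  rcases le_total r (1 / 2) with h1 | h1
  · rw [undamp_of_le h1, mul_damp (by linarith) (by linarith)]
    ring
  · rw [undamp_of_ge h1, damp_eq_one h1, mul_one]

/-- The first coordinate of the point near a corner that is contracted to the point with
coordinates `S`, `T`; if this is the corner itself, then `w` is the direction of approach. -/
def uncorner (S T w : ℝ) : ℝ := (if S + T = 0 then w else S / (S + T)) * undamp (S + T)

variable {S T w : ℝ}

theorem uncorner_of_ge (h : 1 / 2 ≤ S + T) : uncorner S T w = S := by
  have h0 : S + T ≠ 0 := by linarith
  rw [uncorner, if_neg h0, undamp_of_ge h, div_mul_cancel₀ _ h0]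

/-- The two coordinates are in the proportion `S : T`, or `w : 1 - w` at the corner itself, and
share the total distance `undamp (S + T)`. -/
theorem uncorner_add (S T w : ℝ) :
    uncorner S T w + uncorner T S (1 - w) = undamp (S + T) := by
  unfold uncorner
  rw [add_comm T S, ← add_mul]
  split_ifs with h
  · ring
  · rw [← add_div, div_self h, one_mul]

theorem uncorner_mul_damp (hS : 0 ≤ S) (hT : 0 ≤ T) :
    uncorner S T w * damp (undamp (S + T)) = S := by
  rw [uncorner, mul_assoc, undamp_mul_damp (add_nonneg hS hT)]
  split_ifs with h
  · rw [h]; linarith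
  · exact div_mul_cancel₀ _ h

theorem uncorner_nonneg (hS : 0 ≤ S) (hT : 0 ≤ T) (hw : 0 ≤ w) : 0 ≤ uncorner S T w := by
  refine mul_nonneg ?_ (le_trans (by norm_num) (undamp_ge (add_nonneg hS hT)))
  split_ifs
  · exact hw
  · positivity

theorem uncorner_le (hS : 0 ≤ S) (hT : 0 ≤ T) (hw : w ≤ 1) (hS2 : S ≤ 1 / 2) :
    uncorner S T w ≤ 1 / 2 := by
  rcases le_total (1 / 2) (S + T) with h | h
  · rwa [uncorner_of_ge h]
  · have h1 := uncorner_add S T w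
    have h2 := uncorner_nonneg hT hS (sub_nonneg.2 hw)
    rw [undamp_of_le h] at h1
    linarith

end Damp

/-! ### The contraction of the polytope onto the cube. -/

section Shrink

variable {n : ℕ} {x y : Fin n → ℝ} {i j : Fin n}

/-- The normalized distance from the facet `x_i = 1` of the cube. -/
def distR (x : Fin n → ℝ) (i : Fin n) : ℝ := (1 - x i) / 2

/-- The normalized distance from the facet `x_i = -1` of the cube. -/
def distL (x : Fin n → ℝ) (i : Fin n) : ℝ := (1 + x i) / 2

/-- The contraction factor for the corner `x_i = 1`, `x_{i+1} = -1`. -/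
def dampR (x : Fin n → ℝ) (i : Fin n) : ℝ := damp (distR x i + distL x (nxt i))

/-- The contraction factor for the corner `x_{i-1} = 1`, `x_i = -1`. -/
def dampL (x : Fin n → ℝ) (i : Fin n) : ℝ := damp (distR x (prv i) + distL x i)

/-- The cofactor of `dampR` in `shrinkR`. On the polytope it is `distR x i` in the half next to `x i
= 1`. In the other half `dampR` is `1`, and the value is the complement of the contracted distance
from `x i = -1`. One formula thus covers both corners that involve `x i`. -/
def slopeR (x : Fin n → ℝ) (i : Fin n) : ℝ := 1 - distL x i * dampL x i

def slopeL (x : Fin n → ℝ) (i : Fin n) : ℝ := 1 - distR x i * dampR x i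

/-- The contraction of the polytope onto the unit cube: the normalized distance of the image from
the facet `x_i = 1`. -/
def shrinkR (x : Fin n → ℝ) (i : Fin n) : ℝ := slopeR x i * dampR x i

/-- The normalized distance of the image under the contraction from the facet `x_i = -1`. -/
def shrinkL (x : Fin n → ℝ) (i : Fin n) : ℝ := slopeL x i * dampL x i

theorem distR_add_distL (x : Fin n → ℝ) (i : Fin n) : distR x i + distL x i = 1 := by
  unfold distR distL; ring

theorem dampL_eq_dampR (hij : (i : ℕ) + 1 = j) : dampL x j = dampR x i := by
  rw [dampL, dampR, nxt_eq hij, prv_eq hij]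

theorem distR_nonneg (hx : x ∈ polytope n) (i : Fin n) : 0 ≤ distR x i := by
  have := hx.1 i
  unfold distR; linarith

theorem distL_nonneg (hx : x ∈ polytope n) (i : Fin n) : 0 ≤ distL x i := by
  have := hx.1 i
  unfold distL; linarith

/-- The cut inequality in normalized distances. At the last index, where `nxt i = i`, the sum is
`1`, beyond the reach of the contraction. -/
theorem distR_add_distL_nxt (hx : x ∈ polytope n) (i : Fin n) :
    1 / 4 ≤ distR x i + distL x (nxt i) := by
  rcases nxt_eq_self_or i with h | h
  · rw [h, distR_add_distL]; norm_num
  · have := hx.2 _ _ h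
    unfold distR distL; linarith

theorem distR_prv_add_distL (hx : x ∈ polytope n) (i : Fin n) :
    1 / 4 ≤ distR x (prv i) + distL x i := by
  rcases prv_eq_self_or i with h | h
  · rw [h, distR_add_distL]; norm_num
  · have := hx.2 _ _ h
    unfold distR distL; linarith

theorem dampR_nonneg (hx : x ∈ polytope n) (i : Fin n) : 0 ≤ dampR x i :=
  damp_nonneg (distR_add_distL_nxt hx i)

theorem dampL_nonneg (hx : x ∈ polytope n) (i : Fin n) : 0 ≤ dampL x i :=
  damp_nonneg (distR_prv_add_distL hx i)

theorem dampR_eq_zero_iff (hx : x ∈ polytope n) (hij : (i : ℕ) + 1 = j) :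
    dampR x i = 0 ↔ x i - x j = 3 / 2 := by
  rw [dampR, damp_eq_zero_iff (distR_add_distL_nxt hx i), nxt_eq hij]
  unfold distR distL
  constructor <;> intro h <;> linarith

/-- A corner contraction only acts at distances below `1/2`, so in the half next to `x i = 1` the
contraction that belongs to `x i = -1` is idle. -/
theorem dampL_eq_one (hx : x ∈ polytope n) (h : distR x i ≤ 1 / 2) : dampL x i = 1 := by
  refine damp_eq_one ?_
  have := distR_nonneg hx (prv i)
  have := distR_add_distL x i
  linarith

theorem dampR_eq_one (hx : x ∈ polytope n) (h : distL x i ≤ 1 / 2) : dampR x i = 1 := by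
  refine damp_eq_one ?_
  have := distL_nonneg hx (nxt i)
  have := distR_add_distL x i
  linarith

theorem slopeR_eq (hx : x ∈ polytope n) (h : distR x i ≤ 1 / 2) : slopeR x i = distR x i := by
  rw [slopeR, dampL_eq_one hx h]
  linear_combination -distR_add_distL x i

theorem slopeL_eq (hx : x ∈ polytope n) (h : distL x i ≤ 1 / 2) : slopeL x i = distL x i := by
  rw [slopeL, dampR_eq_one hx h]
  linear_combination -distR_add_distL x i

theorem distR_le_slopeR (hx : x ∈ polytope n) (i : Fin n) : distR x i ≤ slopeR x i := by
  have h1 : dampL x i ≤ 1 := damp_le_one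
  have h2 := distL_nonneg hx i
  have := distR_add_distL x i
  unfold slopeR
  nlinarith

theorem distL_le_slopeL (hx : x ∈ polytope n) (i : Fin n) : distL x i ≤ slopeL x i := by
  have h1 : dampR x i ≤ 1 := damp_le_one
  have h2 := distR_nonneg hx i
  have := distR_add_distL x i
  unfold slopeL
  nlinarith

theorem slopeR_nonneg (hx : x ∈ polytope n) (i : Fin n) : 0 ≤ slopeR x i :=
  (distR_nonneg hx i).trans (distR_le_slopeR hx i)

theorem slopeL_nonneg (hx : x ∈ polytope n) (i : Fin n) : 0 ≤ slopeL x i :=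
  (distL_nonneg hx i).trans (distL_le_slopeL hx i)

theorem slopeR_eq_zero_iff (hx : x ∈ polytope n) : slopeR x i = 0 ↔ x i = 1 := by
  constructor
  · intro h
    have h1 := distR_le_slopeR hx i
    have h2 := distR_nonneg hx i
    rw [h] at h1
    unfold distR at h1 h2
    linarith
  · intro h
    have h0 : distR x i = 0 := by rw [distR, h]; norm_num
    rw [slopeR_eq hx (by rw [h0]; norm_num), h0]

theorem slopeL_eq_zero_iff (hx : x ∈ polytope n) : slopeL x i = 0 ↔ x i = -1 := by
  constructor
  · intro h
    have h1 := distL_le_slopeL hx i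
    have h2 := distL_nonneg hx i
    rw [h] at h1
    unfold distL at h1 h2
    linarith
  · intro h
    have h0 : distL x i = 0 := by rw [distL, h]; norm_num
    rw [slopeL_eq hx (by rw [h0]; norm_num), h0]

theorem slopeR_add_slopeL_pos (hx : x ∈ polytope n) (hij : (i : ℕ) + 1 = j) :
    0 < slopeR x i + slopeL x j := by
  have h1 := distR_le_slopeR hx i
  have h2 := distL_le_slopeL hx j
  have h3 := distR_add_distL_nxt hx i
  rw [nxt_eq hij] at h3
  linarith

theorem shrinkR_nonneg (hx : x ∈ polytope n) (i : Fin n) : 0 ≤ shrinkR x i :=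
  mul_nonneg (slopeR_nonneg hx i) (dampR_nonneg hx i)

theorem shrinkL_nonneg (hx : x ∈ polytope n) (i : Fin n) : 0 ≤ shrinkL x i :=
  mul_nonneg (slopeL_nonneg hx i) (dampL_nonneg hx i)

/-- In either half one of the two corner factors is `1`, and the slope next to it is by definition
the complement of the other contracted distance. -/
theorem shrinkR_add_shrinkL (hx : x ∈ polytope n) (i : Fin n) : shrinkR x i + shrinkL x i = 1 := by
  have h := distR_add_distL x i
  unfold shrinkR shrinkL
  rcases le_total (distR x i) (1 / 2) with h1 | h1
  · rw [slopeR_eq hx h1, dampL_eq_one hx h1, slopeL]; ring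
  · have h2 : distL x i ≤ 1 / 2 := by linarith
    rw [slopeL_eq hx h2, dampR_eq_one hx h2, slopeR]; ring

theorem shrinkR_of_le (hx : x ∈ polytope n) (h : distR x i ≤ 1 / 2) :
    shrinkR x i = distR x i * dampR x i := by
  rw [shrinkR, slopeR_eq hx h]

theorem shrinkL_of_le (hx : x ∈ polytope n) (h : distL x i ≤ 1 / 2) :
    shrinkL x i = distL x i * dampL x i := by
  rw [shrinkL, slopeL_eq hx h]

theorem shrinkR_le_half_of_le (hx : x ∈ polytope n) (h : distR x i ≤ 1 / 2) :
    shrinkR x i ≤ 1 / 2 := by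
  rw [shrinkR_of_le hx h]
  exact (mul_le_of_le_one_right (distR_nonneg hx i) damp_le_one).trans h

theorem shrinkL_le_half_of_le (hx : x ∈ polytope n) (h : distL x i ≤ 1 / 2) :
    shrinkL x i ≤ 1 / 2 := by
  rw [shrinkL_of_le hx h]
  exact (mul_le_of_le_one_right (distL_nonneg hx i) damp_le_one).trans h

/-- The contraction can only shorten the distance from the nearer facet, so a point strictly in the
other half stays strictly there. -/
theorem distR_le_half_of_shrinkR_eq (hx : x ∈ polytope n) (hy : y ∈ polytope n)
    (h : shrinkR x i = shrinkR y i) (hxi : distR x i ≤ 1 / 2) : distR y i ≤ 1 / 2 := by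
  by_contra! hyi
  have h1 := distR_add_distL y i
  have h2 : distL y i ≤ 1 / 2 := by linarith
  have h3 := shrinkR_add_shrinkL hy i
  have h4 := shrinkR_le_half_of_le hx hxi
  have h5 : shrinkL y i ≤ distL y i := by
    rw [shrinkL_of_le hy h2]
    exact mul_le_of_le_one_right (distL_nonneg hy i) damp_le_one
  linarith

theorem shrinkL_eq_of_shrinkR_eq (hx : x ∈ polytope n) (hy : y ∈ polytope n)
    (h : shrinkR x i = shrinkR y i) : shrinkL x i = shrinkL y i := by
  have h1 := shrinkR_add_shrinkL hx i
  have h2 := shrinkR_add_shrinkL hy i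
  linarith

theorem distL_le_half_of_shrinkR_eq (hx : x ∈ polytope n) (hy : y ∈ polytope n)
    (h : shrinkR x i = shrinkR y i) (hxi : distL x i ≤ 1 / 2) : distL y i ≤ 1 / 2 := by
  by_contra! hyi
  have h1 := distR_add_distL y i
  have h2 : distR y i ≤ 1 / 2 := by linarith
  have h3 := shrinkR_add_shrinkL hy i
  have h4 := shrinkL_le_half_of_le hx hxi
  have h5 : shrinkR y i ≤ distR y i := by
    rw [shrinkR_of_le hy h2]
    exact mul_le_of_le_one_right (distR_nonneg hy i) damp_le_one
  have h6 := shrinkL_eq_of_shrinkR_eq hx hy h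
  linarith

theorem add_eq_of_mul_damp_eq {r r' : ℝ} (hr : 1 / 4 ≤ r) (hr' : 1 / 4 ≤ r')
    (h : r * damp r = r' * damp r') : r = r' := by
  rcases le_total r (1 / 2) with h1 | h1 <;> rcases le_total r' (1 / 2) with h2 | h2
  · rw [mul_damp hr h1, mul_damp hr' h2] at h; linarith
  · rw [mul_damp hr h1, damp_eq_one h2] at h; linarith
  · rw [mul_damp hr' h2, damp_eq_one h1] at h; linarith
  · rwa [damp_eq_one h1, damp_eq_one h2, mul_one, mul_one] at h

/-- Near a corner, the contraction determines the point up to the direction of approach. -/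
theorem corner_eq_of_shrinkR_eq (hx : x ∈ polytope n) (hy : y ∈ polytope n)
    (hij : (i : ℕ) + 1 = j) (hi : shrinkR x i = shrinkR y i) (hj : shrinkR x j = shrinkR y j)
    (hcut : dampR x i = 0 → dampR y i = 0 → x i = y i)
    (hxi : distR x i ≤ 1 / 2) (hxj : distL x j ≤ 1 / 2) : x i = y i ∧ x j = y j := by
  have hyi := distR_le_half_of_shrinkR_eq hx hy hi hxi
  have hyj := distL_le_half_of_shrinkR_eq hx hy hj hxj
  have hj' := shrinkL_eq_of_shrinkR_eq hx hy hj
  rw [shrinkR_of_le hx hxi, shrinkR_of_le hy hyi] at hi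
  rw [shrinkL_of_le hx hxj, shrinkL_of_le hy hyj, dampL_eq_dampR hij, dampL_eq_dampR hij] at hj'
  have hx4 := distR_add_distL_nxt hx i
  have hy4 := distR_add_distL_nxt hy i
  have hr : distR x i + distL x (nxt i) = distR y i + distL y (nxt i) := by
    refine add_eq_of_mul_damp_eq hx4 hy4 ?_
    change _ * dampR x i = _ * dampR y i
    rw [add_mul, add_mul, hi, nxt_eq hij, hj']
  have hd : dampR x i = dampR y i := by rw [dampR, dampR, hr]
  rw [nxt_eq hij] at hr
  have hxy : x i = y i := by
    by_cases h0 : dampR x i = 0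
    · exact hcut h0 (hd ▸ h0)
    · rw [hd] at hi h0
      have := mul_right_cancel₀ h0 hi
      unfold distR at this
      linarith
  refine ⟨hxy, ?_⟩
  unfold distR distL at hr
  linarith

/-- In each coordinate either the contraction is idle or `corner_eq_of_shrinkR_eq` applies at the
corner on the nearer side. The position along the segment of a cut facet is forgotten by the
contraction, and `hcut` supplies it. -/
theorem eq_of_shrinkR_eq (hx : x ∈ polytope n) (hy : y ∈ polytope n)
    (h : ∀ i, shrinkR x i = shrinkR y i)
    (hcut : ∀ i j : Fin n, (i : ℕ) + 1 = j → dampR x i = 0 → dampR y i = 0 → x i = y i) :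
    x = y := by
  ext i
  rcases le_total (distR x i) (1 / 2) with h1 | h1
  · have h1' := distR_le_half_of_shrinkR_eq hx hy (h i) h1
    have key : dampR x i = 1 → dampR y i = 1 → x i = y i := by
      intro e1 e2
      have := h i
      rw [shrinkR_of_le hx h1, shrinkR_of_le hy h1', e1, e2] at this
      unfold distR at this
      linarith
    rcases nxt_eq_self_or i with hn | hn
    · refine key ?_ ?_ <;>
      · rw [dampR, hn, distR_add_distL]
        exact damp_eq_one (by norm_num)
    · rcases le_total (distL x (nxt i)) (1 / 2) with h2 | h2
      · exact (corner_eq_of_shrinkR_eq hx hy hn (h _) (h _) (hcut _ _ hn) h1 h2).1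
      · have e3 := distR_add_distL x (nxt i)
        have e4 := distR_le_half_of_shrinkR_eq hx hy (h (nxt i)) (by linarith)
        have e5 := distR_add_distL y (nxt i)
        have e6 := distR_nonneg hx i
        have e7 := distR_nonneg hy i
        exact key (damp_eq_one (by linarith)) (damp_eq_one (by linarith))
  · have h0 := distR_add_distL x i
    have h1 : distL x i ≤ 1 / 2 := by linarith
    have h1' := distL_le_half_of_shrinkR_eq hx hy (h i) h1
    have key : dampL x i = 1 → dampL y i = 1 → x i = y i := by
      intro e1 e2
      have := shrinkL_eq_of_shrinkR_eq hx hy (h i)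
      rw [shrinkL_of_le hx h1, shrinkL_of_le hy h1', e1, e2] at this
      unfold distL at this
      linarith
    rcases prv_eq_self_or i with hn | hn
    · refine key ?_ ?_ <;>
      · rw [dampL, hn, distR_add_distL]
        exact damp_eq_one (by norm_num)
    · rcases le_total (distR x (prv i)) (1 / 2) with h2 | h2
      · exact (corner_eq_of_shrinkR_eq hx hy hn (h _) (h _) (hcut _ _ hn) h2 h1).2
      · have e3 := distR_add_distL x (prv i)
        have e4 := distL_le_half_of_shrinkR_eq hx hy (h (prv i)) (by linarith)
        have e5 := distR_add_distL y (prv i)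
        have e6 := distL_nonneg hx i
        have e7 := distL_nonneg hy i
        exact key (damp_eq_one (by linarith)) (damp_eq_one (by linarith))

/-- The contraction is onto, and every direction of approach to a corner occurs. -/
theorem exists_shrinkR_eq {S w : Fin n → ℝ} (hS : ∀ i, S i ∈ Set.Icc 0 1)
    (hw : ∀ i, w i ∈ Set.Icc 0 1) :
    ∃ x ∈ polytope n, (∀ i, shrinkR x i = S i) ∧
      ∀ i j : Fin n, (i : ℕ) + 1 = j → S i = 0 → S j = 1 → distR x i = w i / 4 := by
  -- Each coordinate is recovered from its nearer facet by undoing the contraction at the corner on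
  -- that side. `w i` is the share of coordinate `i` at its corner, so the following coordinate
  -- receives `1 - w i`.
  set s : Fin n → ℝ := fun i => if S i ≤ 1 / 2 then uncorner (S i) (1 - S (nxt i)) (w i)
    else 1 - uncorner (1 - S i) (S (prv i)) (1 - w (prv i)) with hs
  have hS0 := fun i => (hS i).1
  have hS1 := fun i => sub_nonneg.2 (hS i).2
  have hw0 := fun i => (hw i).1
  have hw1 := fun i => sub_nonneg.2 (hw i).2
  have hsmall : ∀ i, S i ≤ 1 / 2 → s i = uncorner (S i) (1 - S (nxt i)) (w i) ∧
      0 ≤ s i ∧ s i ≤ 1 / 2 := by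
    intro i hi
    have : s i = uncorner (S i) (1 - S (nxt i)) (w i) := if_pos hi
    refine ⟨this, ?_, ?_⟩ <;> rw [this]
    · exact uncorner_nonneg (hS0 i) (hS1 _) (hw0 i)
    · exact uncorner_le (hS0 i) (hS1 _) (hw i).2 hi
  have hlarge : ∀ i, 1 / 2 < S i → 1 - s i = uncorner (1 - S i) (S (prv i)) (1 - w (prv i)) ∧
      0 ≤ 1 - s i ∧ 1 - s i ≤ 1 / 2 := by
    intro i hi
    have : 1 - s i = uncorner (1 - S i) (S (prv i)) (1 - w (prv i)) := by
      rw [hs]; simp only [if_neg hi.not_ge]; ring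
    refine ⟨this, ?_, ?_⟩ <;> rw [this]
    · exact uncorner_nonneg (hS1 i) (hS0 _) (hw1 _)
    · exact uncorner_le (hS1 i) (hS0 _) (by linarith [hw0 (prv i)]) (by linarith)
  have hcorner : ∀ i j : Fin n, (i : ℕ) + 1 = j →
      (S i ≤ 1 / 2 → 1 / 2 < S j → s i + (1 - s j) = undamp (S i + (1 - S j))) := by
    intro i j hij hi hj
    rw [(hsmall i hi).1, (hlarge j hj).1, nxt_eq hij, prv_eq hij, uncorner_add]
  have hs01 : ∀ i, 0 ≤ s i ∧ s i ≤ 1 := by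
    intro i
    rcases le_or_gt (S i) (1 / 2) with h | h
    · have := hsmall i h; constructor <;> linarith
    · have := hlarge i h; constructor <;> linarith
  set x : Fin n → ℝ := fun i => 1 - 2 * s i with hxdef
  have hR : ∀ i, distR x i = s i := fun i => by simp only [distR, hxdef]; ring
  have hL : ∀ i, distL x i = 1 - s i := fun i => by simp only [distL, hxdef]; ring
  have hx : x ∈ polytope n := by
    refine ⟨fun i => ?_, fun i j hij => ?_⟩
    · have := hs01 i
      simp only [hxdef]
      constructor <;> linarith
    · suffices 1 / 4 ≤ s i + (1 - s j) by simp only [hxdef]; linarith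
      rcases le_or_gt (S i) (1 / 2) with hi | hi
      · rcases le_or_gt (S j) (1 / 2) with hj | hj
        · linarith [(hsmall i hi).2, (hsmall j hj).2]
        · rw [hcorner i j hij hi hj]
          exact undamp_ge (add_nonneg (hS0 i) (hS1 j))
      · linarith [(hlarge i hi).2, hs01 j]
  have hcornerR : ∀ i, S i ≤ 1 / 2 → s i * dampR x i = S i := by
    intro i hi
    rw [dampR, hR, hL]
    rcases nxt_eq_self_or i with hn | hn
    · rw [hn, add_sub_cancel, damp_eq_one (by norm_num), mul_one, (hsmall i hi).1, hn,
        uncorner_of_ge (by linarith)]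
    · rcases le_or_gt (S (nxt i)) (1 / 2) with hj | hj
      · have h1 := hsmall _ hj
        rw [damp_eq_one (by linarith [(hsmall i hi).2]), mul_one, (hsmall i hi).1,
          uncorner_of_ge (by linarith [hS0 i])]
      · rw [hcorner i _ hn hi hj, (hsmall i hi).1, uncorner_mul_damp (hS0 i) (hS1 _)]
  have hcornerL : ∀ i, 1 / 2 < S i → (1 - s i) * dampL x i = 1 - S i := by
    intro i hi
    rw [dampL, hR, hL]
    rcases prv_eq_self_or i with hn | hn
    · rw [hn, add_sub_cancel, damp_eq_one (by norm_num), mul_one, (hlarge i hi).1, hn,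
        uncorner_of_ge (by linarith)]
    · rcases le_or_gt (S (prv i)) (1 / 2) with hj | hj
      · rw [hcorner _ i hn hj hi, (hlarge i hi).1, add_comm (S (prv i)), uncorner_mul_damp (hS1 i) (hS0 _)]
      · have h1 := hlarge _ hj
        rw [damp_eq_one (by linarith [(hlarge i hi).2]), mul_one, (hlarge i hi).1,
          uncorner_of_ge (by linarith [hS1 i])]
  refine ⟨x, hx, fun i => ?_, fun i j hij hi hj => ?_⟩
  · rcases le_or_gt (S i) (1 / 2) with hi | hi
    · rw [shrinkR_of_le hx (by rw [hR]; exact (hsmall i hi).2.2), hR, hcornerR i hi]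
    · have h1 := shrinkR_add_shrinkL hx i
      rw [shrinkL_of_le hx (by rw [hL]; exact (hlarge i hi).2.2), hL, hcornerL i hi] at h1
      linarith
  -- At the corner itself the total distance is `undamp 0 = 1/4`.
  · rw [hR, (hsmall i (by rw [hi]; norm_num)).1, nxt_eq hij, hi, hj, uncorner, undamp]
    norm_num
    ring

theorem continuousOn_damp : ContinuousOn damp {r | r ≠ 0} := by
  unfold damp
  refine ContinuousOn.inf (continuousOn_const.sub (ContinuousOn.inv₀ (by fun_prop) ?_)) continuousOn_const
  intro r hr
  exact mul_ne_zero two_ne_zero hr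

theorem continuous_distR (i : Fin n) : Continuous fun x : polytope n => distR x.1 i :=
  (continuous_const.sub ((continuous_apply i).comp continuous_subtype_val)).div_const 2

theorem continuous_distL (i : Fin n) : Continuous fun x : polytope n => distL x.1 i :=
  (continuous_const.add ((continuous_apply i).comp continuous_subtype_val)).div_const 2

theorem continuous_dampR (i : Fin n) : Continuous fun x : polytope n => dampR x.1 i :=
  continuousOn_damp.comp_continuous ((continuous_distR i).add (continuous_distL (nxt i)))
    fun x => (lt_of_lt_of_le (by norm_num) (distR_add_distL_nxt x.2 i)).ne'

theorem continuous_dampL (i : Fin n) : Continuous fun x : polytope n => dampL x.1 i :=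
  continuousOn_damp.comp_continuous ((continuous_distR (prv i)).add (continuous_distL i))
    fun x => (lt_of_lt_of_le (by norm_num) (distR_prv_add_distL x.2 i)).ne'

theorem continuous_slopeR (i : Fin n) : Continuous fun x : polytope n => slopeR x.1 i :=
  continuous_const.sub ((continuous_distL i).mul (continuous_dampL i))

theorem continuous_slopeL (i : Fin n) : Continuous fun x : polytope n => slopeL x.1 i :=
  continuous_const.sub ((continuous_distR i).mul (continuous_dampR i))

theorem continuous_shrinkR (i : Fin n) : Continuous fun x : polytope n => shrinkR x.1 i :=
  (continuous_slopeR i).mul (continuous_dampR i)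

theorem continuous_shrinkL (i : Fin n) : Continuous fun x : polytope n => shrinkL x.1 i :=
  (continuous_slopeL i).mul (continuous_dampL i)

end Shrink

end

end ArrowMatrix

namespace ArrowMatrix

noncomputable section

/-! ### Cubic reparametrization of a spectral gap. -/

section Profile

variable {n : ℕ} {lam : Fin (n + 1) → ℝ} {c : ℝ} {s t : ℝ} {i j : Fin n}

/-- The slope of the cubic reparametrization of the `i`-th spectral gap, which is `c` at both
ends of the gap. -/
def profile (lam : Fin (n + 1) → ℝ) (c : ℝ) (i : Fin n) (s : ℝ) : ℝ :=
  c + (lam i.succ - lam i.castSucc - c) * (3 * s - 2 * s ^ 2)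

theorem profile_zero : profile lam c i 0 = c := by simp [profile]

theorem profile_pos (hc : 0 < c) (hci : c ≤ lam i.succ - lam i.castSucc) (h0 : 0 ≤ s) (h1 : s ≤ 1) :
    0 < profile lam c i s := by
  have h2 : 0 ≤ 3 * s - 2 * s ^ 2 := by nlinarith
  have := mul_nonneg (sub_nonneg.2 hci) h2
  unfold profile
  linarith

/-- The cubic `3 s ^ 2 - 2 s ^ 3` turns into its complement to `1` under `s ↦ 1 - s`, so the
distances from the two ends of the gap have the same form. -/
theorem mul_profile_add (h : s + t = 1) :
    s * profile lam c i s + t * profile lam c i t = lam i.succ - lam i.castSucc := by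
  obtain rfl : t = 1 - s := by linarith
  unfold profile
  ring

theorem mul_profile_strictMonoOn (hc : 0 < c) (hci : c ≤ lam i.succ - lam i.castSucc) :
    StrictMonoOn (fun s => s * profile lam c i s) (Set.Icc 0 1) := by
  rintro s ⟨hs0, hs1⟩ t ⟨ht0, ht1⟩ hst
  -- The divided difference of `3 s ^ 2 - 2 s ^ 3` between `s` and `t`.
  have h1 : 0 ≤ 3 * (s + t) - 2 * (s ^ 2 + s * t + t ^ 2) := by
    nlinarith [mul_nonneg hs0 (sub_nonneg.2 ht1), mul_nonneg ht0 (sub_nonneg.2 hs1),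
      mul_nonneg hs0 (sub_nonneg.2 hs1), mul_nonneg ht0 (sub_nonneg.2 ht1)]
  have h2 := mul_nonneg (sub_nonneg.2 hci) h1
  have h3 : 0 < (t - s) * (c + (lam i.succ - lam i.castSucc - c) *
      (3 * (s + t) - 2 * (s ^ 2 + s * t + t ^ 2))) :=
    mul_pos (sub_pos.2 hst) (by linarith)
  simp only [profile]
  linarith

theorem exists_mul_profile_eq (v : ℝ) (hv : v ∈ Set.Icc 0 (lam i.succ - lam i.castSucc)) :
    ∃ s ∈ Set.Icc (0 : ℝ) 1, s * profile lam c i s = v := by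
  have hcont : ContinuousOn (fun s => s * profile lam c i s) (Set.Icc 0 1) := by
    unfold profile; fun_prop
  have h := intermediate_value_Icc zero_le_one hcont
  have h1 : (1 : ℝ) * profile lam c i 1 = lam i.succ - lam i.castSucc := by unfold profile; ring
  simp only [zero_mul, h1] at h
  exact h hv

end Profile

/-! ### The diagonal entries as functions on the polytope. -/

section Diagonal

variable {n : ℕ} {lam : Fin (n + 1) → ℝ} {c : ℝ} {x y : Fin n → ℝ} {i j : Fin n}

/-- A lower bound for the spectral gaps. -/
def IsGapBound (lam : Fin (n + 1) → ℝ) (c : ℝ) : Prop :=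
  0 < c ∧ ∀ i : Fin n, c ≤ lam i.succ - lam i.castSucc

theorem exists_isGapBound (hlam : StrictMono lam) : ∃ c, IsGapBound lam c := by
  rcases isEmpty_or_nonempty (Fin n) with h | h
  · exact ⟨1, one_pos, fun i => h.elim i⟩
  · obtain ⟨i, hi⟩ := Finite.exists_min fun i : Fin n => lam i.succ - lam i.castSucc
    exact ⟨_, sub_pos.2 (hlam i.castSucc_lt_succ), hi⟩

theorem IsGapBound.strictMono (h : IsGapBound lam c) : StrictMono lam :=
  Fin.strictMono_iff_lt_succ.2 fun i => sub_pos.1 (h.1.trans_le (h.2 i))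

theorem castSucc_eq_succ (hij : (i : ℕ) + 1 = j) : j.castSucc = i.succ :=
  Fin.ext (by simp [← hij])

/-- The diagonal entry in the `i`-th spectral gap. -/
def alpha (lam : Fin (n + 1) → ℝ) (c : ℝ) (x : Fin n → ℝ) (i : Fin n) : ℝ :=
  lam i.succ - shrinkR x i * profile lam c i (shrinkR x i)

/-- The distance of `alpha` from the upper end of the gap, stripped of the factor `dampR`; it still
carries information on the cut facet, where `dampR` vanishes. -/
def gapR (lam : Fin (n + 1) → ℝ) (c : ℝ) (x : Fin n → ℝ) (i : Fin n) : ℝ :=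
  slopeR x i * profile lam c i (shrinkR x i)

def gapL (lam : Fin (n + 1) → ℝ) (c : ℝ) (x : Fin n → ℝ) (i : Fin n) : ℝ :=
  slopeL x i * profile lam c i (shrinkL x i)

theorem alpha_eq_sub (lam : Fin (n + 1) → ℝ) (c : ℝ) (x : Fin n → ℝ) (i : Fin n) :
    alpha lam c x i = lam i.succ - gapR lam c x i * dampR x i := by
  unfold alpha gapR
  rw [shrinkR]
  ring

theorem alpha_eq_add (lam : Fin (n + 1) → ℝ) (c : ℝ) (hx : x ∈ polytope n) (i : Fin n) :
    alpha lam c x i = lam i.castSucc + gapL lam c x i * dampL x i := by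
  have h := mul_profile_add (lam := lam) (c := c) (i := i) (shrinkR_add_shrinkL hx i)
  have e : gapL lam c x i * dampL x i = shrinkL x i * profile lam c i (shrinkL x i) := by
    unfold gapL
    rw [shrinkL]
    ring
  rw [e, alpha]
  linarith

theorem profile_shrinkR_pos (hc : IsGapBound lam c) (hx : x ∈ polytope n) (i : Fin n) :
    0 < profile lam c i (shrinkR x i) := by
  refine profile_pos hc.1 (hc.2 i) (shrinkR_nonneg hx i) ?_
  linarith [shrinkR_add_shrinkL hx i, shrinkL_nonneg hx i]

theorem profile_shrinkL_pos (hc : IsGapBound lam c) (hx : x ∈ polytope n) (i : Fin n) :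
    0 < profile lam c i (shrinkL x i) := by
  refine profile_pos hc.1 (hc.2 i) (shrinkL_nonneg hx i) ?_
  linarith [shrinkR_add_shrinkL hx i, shrinkR_nonneg hx i]

theorem gapR_nonneg (hc : IsGapBound lam c) (hx : x ∈ polytope n) (i : Fin n) :
    0 ≤ gapR lam c x i :=
  mul_nonneg (slopeR_nonneg hx i) (profile_shrinkR_pos hc hx i).le

theorem gapL_nonneg (hc : IsGapBound lam c) (hx : x ∈ polytope n) (i : Fin n) :
    0 ≤ gapL lam c x i :=
  mul_nonneg (slopeL_nonneg hx i) (profile_shrinkL_pos hc hx i).le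

theorem gapR_eq_zero_iff (hc : IsGapBound lam c) (hx : x ∈ polytope n) :
    gapR lam c x i = 0 ↔ x i = 1 := by
  rw [gapR, mul_eq_zero, or_iff_left (profile_shrinkR_pos hc hx i).ne', slopeR_eq_zero_iff hx]

theorem gapL_eq_zero_iff (hc : IsGapBound lam c) (hx : x ∈ polytope n) :
    gapL lam c x i = 0 ↔ x i = -1 := by
  rw [gapL, mul_eq_zero, or_iff_left (profile_shrinkL_pos hc hx i).ne', slopeL_eq_zero_iff hx]

/-- The cut keeps the point away from the corner, so the stripped distances do not vanish together,
even where both entries sit at the common end. This makes `ratio` continuous for neighbours. -/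
theorem gapR_add_gapL_pos (hc : IsGapBound lam c) (hx : x ∈ polytope n) (hij : (i : ℕ) + 1 = j) :
    0 < gapR lam c x i + gapL lam c x j := by
  have h := slopeR_add_slopeL_pos hx hij
  have h1 := gapR_nonneg hc hx i
  have h2 := gapL_nonneg hc hx j
  rcases (slopeR_nonneg hx i).eq_or_lt with h0 | h0
  · have : 0 < gapL lam c x j := mul_pos (by linarith) (profile_shrinkL_pos hc hx j)
    linarith
  · have : 0 < gapR lam c x i := mul_pos h0 (profile_shrinkR_pos hc hx i)
    linarith

theorem alpha_le (hc : IsGapBound lam c) (hx : x ∈ polytope n) (i : Fin n) :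
    alpha lam c x i ≤ lam i.succ := by
  rw [alpha_eq_sub]
  exact sub_le_self _ (mul_nonneg (gapR_nonneg hc hx i) (dampR_nonneg hx i))

theorem le_alpha (hc : IsGapBound lam c) (hx : x ∈ polytope n) (i : Fin n) :
    lam i.castSucc ≤ alpha lam c x i := by
  rw [alpha_eq_add lam c hx]
  exact le_add_of_nonneg_right (mul_nonneg (gapL_nonneg hc hx i) (dampL_nonneg hx i))

/-- Both entries approach the common end of their gaps with the same factor, since `dampL x j =
dampR x i`. -/
theorem alpha_sub_alpha (hx : x ∈ polytope n) (hij : (i : ℕ) + 1 = j) :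
    alpha lam c x j - alpha lam c x i = (gapR lam c x i + gapL lam c x j) * dampR x i := by
  rw [alpha_eq_add lam c hx, alpha_eq_sub, castSucc_eq_succ hij, dampL_eq_dampR hij]
  ring

theorem alpha_eq_alpha_iff (hc : IsGapBound lam c) (hx : x ∈ polytope n) (hij : (i : ℕ) + 1 = j) :
    alpha lam c x i = alpha lam c x j ↔ dampR x i = 0 := by
  rw [eq_comm, ← sub_eq_zero, alpha_sub_alpha hx hij, mul_eq_zero,
    or_iff_right (gapR_add_gapL_pos hc hx hij).ne']

theorem alpha_eq_alpha_iff_mem_cutFacet (hc : IsGapBound lam c) (hx : x ∈ polytope n)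
    (hij : (i : ℕ) + 1 = j) :
    alpha lam c x i = alpha lam c x j ↔ x ∈ cutFacet i j := by
  rw [alpha_eq_alpha_iff hc hx hij, dampR_eq_zero_iff hx hij]
  exact ⟨fun h => ⟨hx, h⟩, fun h => h.2⟩

theorem alpha_of_dampR_eq_zero (h : dampR x i = 0) : alpha lam c x i = lam i.succ := by
  rw [alpha_eq_sub, h, mul_zero, sub_zero]

/-- Diagonal entries in different spectral gaps are ordered. -/
theorem alpha_le_alpha (hc : IsGapBound lam c) (hx : x ∈ polytope n) (hij : i < j) :
    alpha lam c x i ≤ alpha lam c x j :=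
  ((alpha_le hc hx i).trans (hc.strictMono.monotone (Fin.succ_le_castSucc_iff.2 hij))).trans
    (le_alpha hc hx j)

theorem succ_eq_of_alpha_eq (hc : IsGapBound lam c) (hx : x ∈ polytope n) (hij : i < j)
    (h : alpha lam c x i = alpha lam c x j) : (i : ℕ) + 1 = j := by
  by_contra hne
  have hlt : i.succ < j.castSucc := by
    rw [Fin.lt_def] at hij ⊢
    simp only [Fin.val_succ, Fin.val_castSucc]
    omega
  have := hc.strictMono hlt
  linarith [alpha_le hc hx i, le_alpha hc hx j]

theorem shrinkR_eq_of_alpha_eq (hc : IsGapBound lam c) (hx : x ∈ polytope n) (hy : y ∈ polytope n)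
    (h : alpha lam c x i = alpha lam c y i) : shrinkR x i = shrinkR y i := by
  have h1 : ∀ {x}, x ∈ polytope n → shrinkR x i ∈ Set.Icc (0 : ℝ) 1 := fun hx =>
    ⟨shrinkR_nonneg hx i, by linarith [shrinkR_add_shrinkL hx i, shrinkL_nonneg hx i]⟩
  refine (mul_profile_strictMonoOn hc.1 (hc.2 i)).injOn (h1 hx) (h1 hy) ?_
  unfold alpha at h
  simpa using h

theorem alpha_of_eq_one (hc : IsGapBound lam c) (hx : x ∈ polytope n) (h : x i = 1) :
    alpha lam c x i = lam i.succ := by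
  rw [alpha_eq_sub, (gapR_eq_zero_iff hc hx).2 h, zero_mul, sub_zero]

theorem alpha_of_eq_neg_one (hc : IsGapBound lam c) (hx : x ∈ polytope n) (h : x i = -1) :
    alpha lam c x i = lam i.castSucc := by
  rw [alpha_eq_add lam c hx, (gapL_eq_zero_iff hc hx).2 h, zero_mul, add_zero]

end Diagonal

/-! ### Squares of the off-diagonal entries, extended over the cut facets. -/

section Weight

variable {n : ℕ} {lam : Fin (n + 1) → ℝ} {c : ℝ} {x y : Fin n → ℝ} {i j m : Fin n}

/-- A factor of the square of an off-diagonal entry. It extends the quotient of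
`lam j.castSucc - alpha i` and `alpha j - alpha i` for `i < j`, and of `alpha i - lam j.succ` and
`alpha i - alpha j` for `j < i`, over the cut facets. -/
def ratio (lam : Fin (n + 1) → ℝ) (c : ℝ) (x : Fin n → ℝ) (i j : Fin n) : ℝ :=
  if (i : ℕ) + 1 = j then gapR lam c x i / (gapR lam c x i + gapL lam c x j)
  else if (j : ℕ) + 1 = i then gapL lam c x i / (gapR lam c x j + gapL lam c x i)
  else if i < j then (lam j.castSucc - alpha lam c x i) / (alpha lam c x j - alpha lam c x i)
  else (alpha lam c x i - lam j.succ) / (alpha lam c x i - alpha lam c x j)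

theorem ratio_succ (hij : (i : ℕ) + 1 = j) :
    ratio lam c x i j = gapR lam c x i / (gapR lam c x i + gapL lam c x j) := if_pos hij

theorem ratio_pred (hij : (i : ℕ) + 1 = j) :
    ratio lam c x j i = gapL lam c x j / (gapR lam c x i + gapL lam c x j) := by
  rw [ratio, if_neg (by omega), if_pos hij]

theorem ratio_add_ratio (hc : IsGapBound lam c) (hx : x ∈ polytope n) (hij : (i : ℕ) + 1 = j) :
    ratio lam c x i j + ratio lam c x j i = 1 := by
  rw [ratio_succ hij, ratio_pred hij, ← add_div, div_self (gapR_add_gapL_pos hc hx hij).ne']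

/-- For neighbours, numerator and denominator both contain `dampR x i`, which is nonzero here and
cancels. -/
theorem ratio_eq_of_lt (hx : x ∈ polytope n) (hij : i < j)
    (h : alpha lam c x i ≠ alpha lam c x j) :
    ratio lam c x i j =
      (lam j.castSucc - alpha lam c x i) / (alpha lam c x j - alpha lam c x i) := by
  by_cases hs : (i : ℕ) + 1 = j
  · have h0 : dampR x i ≠ 0 := by
      intro h0
      have := alpha_sub_alpha (lam := lam) (c := c) hx hs
      rw [h0, mul_zero, sub_eq_zero] at this
      exact h this.symm
    rw [ratio_succ hs, alpha_sub_alpha hx hs, castSucc_eq_succ hs, alpha_eq_sub, sub_sub_cancel,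
      mul_div_mul_right _ _ h0]
  · rw [Fin.lt_def] at hij
    rw [ratio, if_neg hs, if_neg (by omega), if_pos (Fin.lt_def.2 hij)]

theorem ratio_eq_of_gt (hx : x ∈ polytope n) (hij : j < i)
    (h : alpha lam c x i ≠ alpha lam c x j) :
    ratio lam c x i j =
      (alpha lam c x i - lam j.succ) / (alpha lam c x i - alpha lam c x j) := by
  by_cases hs : (j : ℕ) + 1 = i
  · have h0 : dampR x j ≠ 0 := by
      intro h0
      have := alpha_sub_alpha (lam := lam) (c := c) hx hs
      rw [h0, mul_zero, sub_eq_zero] at this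
      exact h this
    rw [ratio_pred hs, alpha_sub_alpha hx hs, ← castSucc_eq_succ hs, alpha_eq_add lam c hx,
      add_sub_cancel_left, dampL_eq_dampR hs, mul_div_mul_right _ _ h0]
  · rw [Fin.lt_def] at hij
    rw [ratio, if_neg (by omega), if_neg hs, if_neg (by rw [Fin.lt_def]; omega)]

theorem ratio_nonneg (hc : IsGapBound lam c) (hx : x ∈ polytope n) (hij : i ≠ j) :
    0 ≤ ratio lam c x i j := by
  rcases hij.lt_or_gt with h | h
  · have h1 := hc.strictMono.monotone (Fin.succ_le_castSucc_iff.2 h)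
    by_cases hs : (i : ℕ) + 1 = j
    · rw [ratio_succ hs]
      exact div_nonneg (gapR_nonneg hc hx i) (gapR_add_gapL_pos hc hx hs).le
    · rw [ratio_eq_of_lt hx h (fun e => hs (succ_eq_of_alpha_eq hc hx h e))]
      exact div_nonneg (by linarith [alpha_le hc hx i]) (by linarith [alpha_le_alpha hc hx h])
  · have h1 := hc.strictMono.monotone (Fin.succ_le_castSucc_iff.2 h)
    by_cases hs : (j : ℕ) + 1 = i
    · rw [ratio_pred hs]
      exact div_nonneg (gapL_nonneg hc hx i) (gapR_add_gapL_pos hc hx hs).le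
    · rw [ratio_eq_of_gt hx h (fun e => hs (succ_eq_of_alpha_eq hc hx h e.symm))]
      exact div_nonneg (by linarith [le_alpha hc hx i]) (by linarith [alpha_le_alpha hc hx h])

theorem ratio_pos_of_lt (hc : IsGapBound lam c) (hx : x ∈ polytope n) (hij : i < j)
    (h : alpha lam c x i ≠ alpha lam c x j) (h' : alpha lam c x i ≠ lam j.castSucc) :
    0 < ratio lam c x i j := by
  have h1 := hc.strictMono.monotone (Fin.succ_le_castSucc_iff.2 hij)
  rw [ratio_eq_of_lt hx hij h]
  refine div_pos (sub_pos.2 (lt_of_le_of_ne ?_ h')) (sub_pos.2 (lt_of_le_of_ne ?_ h))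
  · linarith [alpha_le hc hx i]
  · exact alpha_le_alpha hc hx hij

theorem ratio_pos_of_gt (hc : IsGapBound lam c) (hx : x ∈ polytope n) (hij : j < i)
    (h : alpha lam c x i ≠ alpha lam c x j) (h' : alpha lam c x i ≠ lam j.succ) :
    0 < ratio lam c x i j := by
  have h1 := hc.strictMono.monotone (Fin.succ_le_castSucc_iff.2 hij)
  rw [ratio_eq_of_gt hx hij h]
  refine div_pos (sub_pos.2 (lt_of_le_of_ne ?_ h'.symm)) (sub_pos.2 (lt_of_le_of_ne ?_ h.symm))
  · linarith [le_alpha hc hx i]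
  · exact alpha_le_alpha hc hx hij

theorem ratio_ne_zero (hc : IsGapBound lam c) (hx : x ∈ polytope n) (hij : i ≠ j)
    (h1 : x i ≠ 1) (h2 : x i ≠ -1) : ratio lam c x i j ≠ 0 := by
  rcases hij.lt_or_gt with h | h
  · by_cases hs : (i : ℕ) + 1 = j
    · rw [ratio_succ hs]
      exact div_ne_zero (mt (gapR_eq_zero_iff hc hx).1 h1) (gapR_add_gapL_pos hc hx hs).ne'
    · refine (ratio_pos_of_lt hc hx h (fun e => hs (succ_eq_of_alpha_eq hc hx h e)) ?_).ne'
      refine ((alpha_le hc hx i).trans_lt (hc.strictMono ?_)).ne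
      rw [Fin.lt_def] at h ⊢
      simp only [Fin.val_succ, Fin.val_castSucc]
      omega
  · by_cases hs : (j : ℕ) + 1 = i
    · rw [ratio_pred hs]
      exact div_ne_zero (mt (gapL_eq_zero_iff hc hx).1 h2) (gapR_add_gapL_pos hc hx hs).ne'
    · refine (ratio_pos_of_gt hc hx h (fun e => hs (succ_eq_of_alpha_eq hc hx h e.symm)) ?_).ne'
      refine ((hc.strictMono ?_).trans_le (le_alpha hc hx i)).ne'
      rw [Fin.lt_def] at h ⊢
      simp only [Fin.val_succ, Fin.val_castSucc]
      omega

/-- The square of the off-diagonal entry that belongs to `alpha i`. -/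
def weight (lam : Fin (n + 1) → ℝ) (c : ℝ) (x : Fin n → ℝ) (i : Fin n) : ℝ :=
  (alpha lam c x i - lam 0) * (lam (Fin.last n) - alpha lam c x i) *
    ∏ j ∈ Finset.univ.erase i, ratio lam c x i j

theorem weight_nonneg (hc : IsGapBound lam c) (hx : x ∈ polytope n) (i : Fin n) :
    0 ≤ weight lam c x i := by
  refine mul_nonneg (mul_nonneg ?_ ?_) (Finset.prod_nonneg fun j hj =>
    ratio_nonneg hc hx (Finset.ne_of_mem_erase hj).symm)
  · exact sub_nonneg.2 ((hc.strictMono.monotone (Fin.zero_le _)).trans (le_alpha hc hx i))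
  · exact sub_nonneg.2 ((alpha_le hc hx i).trans (hc.strictMono.monotone (Fin.le_last _)))

/-- If `x i ≠ ±1`, no factor vanishes: an extreme eigenvalue can only be reached in an extreme gap,
on whose outer side there is no corner. Conversely, `x i = ±1` kills the ratio with the neighbour on
that side, or the outer factor if there is no neighbour. -/
theorem weight_eq_zero_iff (hc : IsGapBound lam c) (hx : x ∈ polytope n) :
    weight lam c x i = 0 ↔ x i = 1 ∨ x i = -1 := by
  constructor
  · intro h
    by_contra! hne
    rw [weight, mul_eq_zero, mul_eq_zero, sub_eq_zero, sub_eq_zero, Finset.prod_eq_zero_iff] at h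
    rcases h with (h | h) | ⟨j, hj, h⟩
    · have h1 := le_alpha hc hx i
      rw [h] at h1
      have h2 : i.castSucc = 0 := Fin.le_zero_iff.1 (hc.strictMono.le_iff_le.1 h1)
      have h3 : prv i = i := by
        rcases prv_eq_self_or i with h3 | h3
        · exact h3
        · have := congrArg Fin.val h2
          simp at this
          omega
      rw [alpha_eq_add lam c hx, h2, add_eq_left, dampL, h3, distR_add_distL,
        damp_eq_one (by norm_num), mul_one, gapL_eq_zero_iff hc hx] at h
      exact hne.2 h
    · have h1 := alpha_le hc hx i
      rw [← h] at h1
      have h2 : i.succ = Fin.last n := Fin.last_le_iff.1 (hc.strictMono.le_iff_le.1 h1)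
      have h3 : nxt i = i := by
        rcases nxt_eq_self_or i with h3 | h3
        · exact h3
        · have := congrArg Fin.val h2
          simp at this
          omega
      rw [alpha_eq_sub, h2, eq_comm, sub_eq_self, dampR, h3, distR_add_distL,
        damp_eq_one (by norm_num), mul_one, gapR_eq_zero_iff hc hx] at h
      exact hne.1 h
    · exact ratio_ne_zero hc hx (Finset.ne_of_mem_erase hj).symm hne.1 hne.2 h
  · rintro (h | h)
    · rcases nxt_eq_self_or i with hn | hn
      · have hl : i.succ = Fin.last n := by
          by_contra hne
          have hlt : (i : ℕ) + 1 < n := by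
            have := i.2
            have h4 : (i : ℕ) + 1 ≠ n := fun e => hne (Fin.ext (by simp [e]))
            omega
          have := congrArg Fin.val hn
          simp [nxt, hlt] at this
        rw [weight, alpha_of_eq_one hc hx h, hl, sub_self, mul_zero, zero_mul]
      · rw [weight, Finset.prod_eq_zero (i := nxt i), mul_zero]
        · exact Finset.mem_erase.2 ⟨fun e => by rw [e] at hn; omega, Finset.mem_univ _⟩
        · rw [ratio_succ hn, (gapR_eq_zero_iff hc hx).2 h, zero_div]
    · rcases prv_eq_self_or i with hn | hn
      · have hl : i.castSucc = 0 := by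
          have := congrArg Fin.val hn
          simp only [prv] at this
          exact Fin.ext (by simp only [Fin.val_castSucc, Fin.val_zero]; omega)
        rw [weight, alpha_of_eq_neg_one hc hx h, hl, sub_self, zero_mul, zero_mul]
      · rw [weight, Finset.prod_eq_zero (i := prv i), mul_zero]
        · exact Finset.mem_erase.2 ⟨fun e => by rw [e] at hn; omega, Finset.mem_univ _⟩
        · rw [ratio_pred hn, (gapL_eq_zero_iff hc hx).2 h, zero_div]

/-- Every `j ≠ i` is paired with the end of gap `j` that faces gap `i`; only the two extreme
eigenvalues are left over. -/
theorem prod_split (f : Fin (n + 1) → ℝ) (i : Fin n) :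
    f 0 * (f (Fin.last n) * ∏ j ∈ Finset.univ.erase i, if i < j then f j.castSucc else f j.succ) =
      ∏ m, f m := by
  have hi := i.2
  rw [← Finset.mul_prod_erase Finset.univ f (Finset.mem_univ 0),
    ← Finset.mul_prod_erase (Finset.univ.erase 0) f (a := Fin.last n)
      (Finset.mem_erase.2 ⟨fun h => by have := congrArg Fin.val h; simp at this; omega,
        Finset.mem_univ _⟩)]
  congr 2
  refine Finset.prod_bij (fun j _ => if i < j then j.castSucc else j.succ) ?_ ?_ ?_ ?_
  · intro j hj
    have hj' := Finset.ne_of_mem_erase hj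
    simp only [Finset.mem_erase, Finset.mem_univ, and_true, ne_eq, Fin.ext_iff] at hj' ⊢
    split_ifs with h <;> rw [Fin.lt_def] at h <;> simp <;> omega
  · intro j hj k hk h
    have hj' := Finset.ne_of_mem_erase hj
    have hk' := Finset.ne_of_mem_erase hk
    rw [Fin.ext_iff] at h ⊢
    simp only [ne_eq, Fin.ext_iff] at hj' hk'
    split_ifs at h with h1 h2 h2 <;> rw [Fin.lt_def] at h1 h2 <;> simp at h <;> omega
  · intro m hm
    simp only [Finset.mem_erase, Finset.mem_univ, and_true, ne_eq, Fin.ext_iff, Fin.val_zero,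
      Fin.val_last] at hm
    have hm2 := m.2
    by_cases h : (m : ℕ) ≤ i
    · refine ⟨⟨m - 1, by omega⟩, ?_, ?_⟩
      · simp [Fin.ext_iff]; omega
      · rw [if_neg (by rw [Fin.lt_def]; simp; omega)]
        exact Fin.ext (by simp; omega)
    · refine ⟨⟨m, by omega⟩, ?_, ?_⟩
      · simp [Fin.ext_iff]; omega
      · rw [if_pos (by rw [Fin.lt_def]; simp; omega)]
        exact Fin.ext (by simp)
  · intro j _
    split_ifs <;> rfl

/-- The partial fraction formula, for distinct diagonal entries. -/
theorem weight_mul_prod (hx : x ∈ polytope n)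
    (h : ∀ j, j ≠ i → alpha lam c x i ≠ alpha lam c x j) :
    weight lam c x i * ∏ j ∈ Finset.univ.erase i, (alpha lam c x i - alpha lam c x j) =
      -∏ m, (alpha lam c x i - lam m) := by
  rw [weight, mul_assoc, ← Finset.prod_mul_distrib, ← prod_split _ i]
  have : ∀ j ∈ Finset.univ.erase i, ratio lam c x i j * (alpha lam c x i - alpha lam c x j) =
      if i < j then alpha lam c x i - lam j.castSucc else alpha lam c x i - lam j.succ := by
    intro j hj
    have hji := Finset.ne_of_mem_erase hj
    have hne := h j hji
    split_ifs with hlt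
    · rw [ratio_eq_of_lt hx hlt hne, div_mul_eq_mul_div, div_eq_iff (sub_ne_zero.2 hne.symm)]
      ring
    · rw [ratio_eq_of_gt hx (lt_of_le_of_ne (not_lt.1 hlt) hji) hne, div_mul_cancel₀ _ (sub_ne_zero.2 hne)]
  rw [Finset.prod_congr rfl this]
  ring

/-- Over a cut facet, the two weights are fractions of a common positive mass. -/
theorem exists_weight_eq_ratio_mul (hc : IsGapBound lam c) (hx : x ∈ polytope n)
    (hij : (i : ℕ) + 1 = j) (h : alpha lam c x i = alpha lam c x j) :
    ∃ M, 0 < M ∧ weight lam c x i = ratio lam c x i j * M ∧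
      weight lam c x j = ratio lam c x j i * M := by
  have hd := (alpha_eq_alpha_iff hc hx hij).1 h
  have hi := alpha_of_dampR_eq_zero (lam := lam) (c := c) hd
  have hlt : i < j := by rw [Fin.lt_def]; omega
  have hne : ∀ m, m ≠ i → m ≠ j → alpha lam c x i ≠ alpha lam c x m := by
    intro m hmi hmj e
    rw [ne_eq, Fin.ext_iff] at hmi hmj
    rcases lt_trichotomy m i with hm | hm | hm
    · have := succ_eq_of_alpha_eq hc hx (hm.trans hlt) (e.symm.trans h)
      rw [Fin.lt_def] at hm
      omega
    · exact hmi (congrArg _ hm)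
    · have := succ_eq_of_alpha_eq hc hx hm e
      omega
  -- The weight of `i` without the factor that belongs to `j`.
  refine ⟨(alpha lam c x i - lam 0) * (lam (Fin.last n) - alpha lam c x i) *
    ∏ m ∈ (Finset.univ.erase i).erase j, ratio lam c x i m, ?_, ?_, ?_⟩
  · refine mul_pos (mul_pos ?_ ?_) (Finset.prod_pos fun m hm => ?_)
    · rw [hi]; exact sub_pos.2 (hc.strictMono (Fin.succ_pos i))
    · rw [hi, ← castSucc_eq_succ hij]; exact sub_pos.2 (hc.strictMono (Fin.castSucc_lt_last j))
    · have hmj := Finset.ne_of_mem_erase hm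
      have hmi := Finset.ne_of_mem_erase (Finset.mem_of_mem_erase hm)
      rcases hmi.lt_or_gt with hlt' | hlt'
      · refine ratio_pos_of_gt hc hx hlt' (hne m hmi hmj) ?_
        rw [hi]
        exact (hc.strictMono (Fin.succ_lt_succ_iff.2 hlt')).ne'
      · refine ratio_pos_of_lt hc hx hlt' (hne m hmi hmj) ?_
        rw [hi, ← castSucc_eq_succ hij]
        refine (hc.strictMono ?_).ne
        rw [ne_eq, Fin.ext_iff] at hmj
        rw [Fin.lt_def] at hlt' ⊢
        simp only [Fin.val_castSucc]
        omega
  · rw [weight, ← Finset.mul_prod_erase (Finset.univ.erase i) _ (a := j)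
      (Finset.mem_erase.2 ⟨hlt.ne', Finset.mem_univ _⟩)]
    ring
  · rw [weight, ← Finset.mul_prod_erase (Finset.univ.erase j) _ (a := i)
      (Finset.mem_erase.2 ⟨hlt.ne, Finset.mem_univ _⟩), Finset.erase_right_comm, ← h]
    rw [Finset.prod_congr rfl (g := fun m => ratio lam c x i m)]
    · ring
    intro m hm
    have hmi := Finset.ne_of_mem_erase (Finset.mem_of_mem_erase hm)
    have hmj := Finset.ne_of_mem_erase hm
    have hne' := hne m hmi hmj
    -- `m` is on the same side of `i` and of `j`, so the two ratios have the same form with equal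
    -- entries.
    have hjm : j < m ∨ m < i := by
      rw [ne_eq, Fin.ext_iff] at hmi hmj
      rw [Fin.lt_def, Fin.lt_def]
      omega
    rcases hjm with hm' | hm'
    · rw [ratio_eq_of_lt hx hm' (h ▸ hne'), ratio_eq_of_lt hx (hlt.trans hm') hne', h]
    · rw [ratio_eq_of_gt hx (hm'.trans hlt) (h ▸ hne'), ratio_eq_of_gt hx hm' hne', h]

theorem weight_add_weight_pos (hc : IsGapBound lam c) (hx : x ∈ polytope n)
    (hij : (i : ℕ) + 1 = j) (h : alpha lam c x i = alpha lam c x j) :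
    0 < weight lam c x i + weight lam c x j := by
  obtain ⟨M, hM, h1, h2⟩ := exists_weight_eq_ratio_mul hc hx hij h
  rwa [h1, h2, ← add_mul, ratio_add_ratio hc hx hij, one_mul]

theorem weight_eq_ratio_mul (hc : IsGapBound lam c) (hx : x ∈ polytope n)
    (hij : (i : ℕ) + 1 = j) (h : alpha lam c x i = alpha lam c x j) :
    weight lam c x i = ratio lam c x i j * (weight lam c x i + weight lam c x j) := by
  obtain ⟨M, hM, h1, h2⟩ := exists_weight_eq_ratio_mul hc hx hij h
  rw [h1, h2, ← add_mul, ratio_add_ratio hc hx hij, one_mul]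

/-- On the cut facet both profiles are evaluated at `0`, where they equal the common slope `c`. It
cancels, and the share of `distR x i` in the total distance `1/4` remains. For this reason all gaps
use the same `c`. -/
theorem ratio_of_mem_cutFacet (hc : IsGapBound lam c) (hij : (i : ℕ) + 1 = j)
    (hx : x ∈ cutFacet i j) : ratio lam c x i j = 4 * distR x i := by
  obtain ⟨hx, hcut⟩ := hx
  have hd := (dampR_eq_zero_iff hx hij).2 hcut
  have hi := hx.1 i
  have hj := hx.1 j
  have h1 : gapR lam c x i = distR x i * c := by
    rw [gapR, shrinkR, hd, mul_zero, profile_zero, slopeR_eq hx]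
    unfold distR; linarith
  have h2 : gapL lam c x j = distL x j * c := by
    rw [gapL, shrinkL, dampL_eq_dampR hij, hd, mul_zero, profile_zero, slopeL_eq hx]
    unfold distL; linarith
  have h3 : distR x i + distL x j = 1 / 4 := by unfold distR distL; linarith
  rw [ratio_succ hij, h1, h2, ← add_mul, h3, mul_div_mul_right _ _ hc.1.ne']
  ring

theorem continuous_profile (i : Fin n) : Continuous (profile lam c i) := by
  unfold profile; fun_prop

theorem continuous_alpha (i : Fin n) : Continuous fun x : polytope n => alpha lam c x.1 i :=
  continuous_const.sub ((continuous_shrinkR i).mul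
    ((continuous_profile i).comp (continuous_shrinkR i)))

theorem continuous_gapR (i : Fin n) : Continuous fun x : polytope n => gapR lam c x.1 i :=
  (continuous_slopeR i).mul ((continuous_profile i).comp (continuous_shrinkR i))

theorem continuous_gapL (i : Fin n) : Continuous fun x : polytope n => gapL lam c x.1 i :=
  (continuous_slopeL i).mul ((continuous_profile i).comp (continuous_shrinkL i))

theorem continuous_ratio (hc : IsGapBound lam c) (hij : i ≠ j) :
    Continuous fun x : polytope n => ratio lam c x.1 i j := by
  unfold ratio
  split_ifs with h1 h2 h3
  · exact (continuous_gapR i).div ((continuous_gapR i).add (continuous_gapL j))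
      fun x => (gapR_add_gapL_pos hc x.2 h1).ne'
  · exact (continuous_gapL i).div ((continuous_gapR j).add (continuous_gapL i))
      fun x => (gapR_add_gapL_pos hc x.2 h2).ne'
  · exact (continuous_const.sub (continuous_alpha i)).div
      ((continuous_alpha j).sub (continuous_alpha i))
      fun x h => h1 (succ_eq_of_alpha_eq hc x.2 h3 (sub_eq_zero.1 h).symm)
  · exact ((continuous_alpha i).sub continuous_const).div
      ((continuous_alpha i).sub (continuous_alpha j))
      fun x h => h2 (succ_eq_of_alpha_eq hc x.2 (lt_of_le_of_ne (not_lt.1 h3) hij.symm)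
        (sub_eq_zero.1 h).symm)

theorem continuous_weight (hc : IsGapBound lam c) (i : Fin n) :
    Continuous fun x : polytope n => weight lam c x.1 i := by
  unfold weight
  refine Continuous.mul (((continuous_alpha i).sub continuous_const).mul
    (continuous_const.sub (continuous_alpha i))) ?_
  exact continuous_finsetProd _ fun j hj => continuous_ratio hc (Finset.ne_of_mem_erase hj).symm

end Weight

end

end ArrowMatrix

namespace ArrowMatrix

noncomputable section

/-! ### Each piece parametrizes its chamber. -/

section Cell

variable {n : ℕ} {lam : Fin (n + 1) → ℝ} {c : ℝ}

theorem sign_mul_self (u : ℤˣ) : ((u : ℤ) : ℝ) * ((u : ℤ) : ℝ) = 1 := by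
  rcases Int.units_eq_one_or u with rfl | rfl <;> norm_num

theorem sign_eq_one_or (u : ℤˣ) : ((u : ℤ) : ℝ) = 1 ∨ ((u : ℤ) : ℝ) = -1 := by
  rcases Int.units_eq_one_or u with rfl | rfl <;> norm_num

/-- The matrix that corresponds to the point `x` of the copy of the polytope with indices `σ`
and `ε`. -/
def cellMatrix (lam : Fin (n + 1) → ℝ) (c : ℝ) (σ : Equiv.Perm (Fin n)) (ε : Fin n → ℤˣ)
    (x : Fin n → ℝ) : Matrix (Fin (n + 1)) (Fin (n + 1)) ℝ :=
  arrow (∑ m, lam m - ∑ k, alpha lam c x (σ k)) (fun k => alpha lam c x (σ k))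
    fun k => ((ε k : ℤ) : ℝ) * √(weight lam c x (σ k))

theorem continuous_cellMatrix (hc : IsGapBound lam c) (σ : Equiv.Perm (Fin n)) (ε : Fin n → ℤˣ) :
    Continuous fun x : polytope n => cellMatrix lam c σ ε x.1 := by
  refine continuous_matrix fun i j => ?_
  unfold cellMatrix
  refine Fin.cases ?_ (fun i => ?_) i <;> refine Fin.cases ?_ (fun j => ?_) j
  · exact continuous_const.sub (continuous_finsetSum _ fun k _ => continuous_alpha _)
  · exact continuous_const.mul (continuous_weight hc _).sqrt
  · exact continuous_const.mul (continuous_weight hc _).sqrt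
  · simp only [arrow_succ_succ]
    rcases eq_or_ne j i with rfl | h
    · simpa using continuous_alpha _
    · simpa [Pi.single_eq_of_ne h] using continuous_const

theorem alpha_injective (hc : IsGapBound lam c) {x : Fin n → ℝ} (hx : x ∈ polytope n)
    (h : ∀ i j : Fin n, (i : ℕ) + 1 = j → x i - x j ≠ 3 / 2) :
    Function.Injective (alpha lam c x) := by
  have key : ∀ i j, i < j → alpha lam c x i ≠ alpha lam c x j := by
    intro i j hij e
    have hs := succ_eq_of_alpha_eq hc hx hij e
    exact h i j hs ((alpha_eq_alpha_iff_mem_cutFacet hc hx hs).1 e).2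
  intro i j e
  by_contra hne
  rcases lt_or_gt_of_ne hne with hlt | hlt
  · exact key i j hlt e
  · exact key j i hlt e.symm

theorem cellMatrix_mem_of_injective (hc : IsGapBound lam c) (σ : Equiv.Perm (Fin n))
    (ε : Fin n → ℤˣ) {x : Fin n → ℝ} (hx : x ∈ polytope n)
    (h : Function.Injective (alpha lam c x)) : cellMatrix lam c σ ε x ∈ isospectral lam := by
  refine ⟨arrow_isSymm, arrow_apply_eq_zero, charpoly_arrow_eq_prod (h.comp σ.injective) rfl ?_⟩
  intro k
  rw [mul_pow, sq, sign_mul_self, one_mul, Real.sq_sqrt (weight_nonneg hc hx _),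
    ← weight_mul_prod hx fun j hj e => hj (h e).symm]
  congr 1
  refine Finset.prod_equiv σ (fun j => ?_) fun j _ => rfl
  simp

/-- The residue formula needs distinct diagonal entries. Multiples of `x` by factors below `1` avoid
the cut facets and tend to `x`, and the spectral condition is closed. -/
theorem cellMatrix_mem (hc : IsGapBound lam c) (σ : Equiv.Perm (Fin n)) (ε : Fin n → ℤˣ)
    (x : polytope n) : cellMatrix lam c σ ε x.1 ∈ isospectral lam := by
  have ht : ∀ m : ℕ, (0 : ℝ) < 1 / ((m : ℝ) + 1) ∧ 1 / ((m : ℝ) + 1) ≤ 1 := fun m =>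
    ⟨Nat.one_div_pos_of_nat, (div_le_one (by positivity)).2 (by linarith [m.cast_nonneg (α := ℝ)])⟩
  have hmem : ∀ m : ℕ, (1 - 1 / ((m : ℝ) + 1)) • x.1 ∈ polytope n ∧
      ∀ i j : Fin n, (i : ℕ) + 1 = j →
        ((1 - 1 / ((m : ℝ) + 1)) • x.1) i - ((1 - 1 / ((m : ℝ) + 1)) • x.1) j < 3 / 2 := by
    intro m
    have h := ht m
    have h2 : ∀ i j : Fin n, (i : ℕ) + 1 = j →
        ((1 - 1 / ((m : ℝ) + 1)) • x.1) i - ((1 - 1 / ((m : ℝ) + 1)) • x.1) j < 3 / 2 := by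
      intro i j hij
      have := x.2.2 i j hij
      simp only [Pi.smul_apply, smul_eq_mul]
      nlinarith
    refine ⟨⟨fun k => ?_, fun i j hij => (h2 i j hij).le⟩, h2⟩
    have := x.2.1 k
    simp only [Pi.smul_apply, smul_eq_mul]
    constructor <;> nlinarith
  have hlim : Filter.Tendsto (fun m : ℕ => (⟨_, (hmem m).1⟩ : polytope n)) Filter.atTop (𝓝 x) := by
    rw [tendsto_subtype_rng]
    have h := (tendsto_const_nhds (x := (1 : ℝ))).sub (tendsto_one_div_add_atTop_nhds_zero_nat (𝕜 := ℝ))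
    rw [sub_zero] at h
    simpa using h.smul_const x.1
  refine isClosed_isospectral.mem_of_tendsto
    (((continuous_cellMatrix hc σ ε).tendsto x).comp hlim) (Filter.Eventually.of_forall fun m => ?_)
  exact cellMatrix_mem_of_injective hc σ ε (hmem m).1
    (alpha_injective hc (hmem m).1 fun i j hij => ((hmem m).2 i j hij).ne)

/-- The parametrization of a chamber by the polytope. -/
def cell (hc : IsGapBound lam c) (σ : Equiv.Perm (Fin n)) (ε : Fin n → ℤˣ) (x : polytope n) :
    isospectral lam :=
  ⟨cellMatrix lam c σ ε x.1, cellMatrix_mem hc σ ε x⟩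

variable {hc : IsGapBound lam c} {σ τ : Equiv.Perm (Fin n)} {ε : Fin n → ℤˣ} {x y : polytope n}
  {i j k : Fin n}

theorem cell_diag : (cell hc σ ε x).1 k.succ k.succ = alpha lam c x.1 (σ k) := arrow_succ_self k

theorem cell_off : (cell hc σ ε x).1 0 k.succ = ((ε k : ℤ) : ℝ) * √(weight lam c x.1 (σ k)) := rfl

theorem cell_off_sq : (cell hc σ ε x).1 0 k.succ ^ 2 = weight lam c x.1 (σ k) := by
  rw [cell_off, mul_pow, sq, sign_mul_self, one_mul, Real.sq_sqrt (weight_nonneg hc x.2 _)]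

theorem cell_off_eq_zero_iff :
    (cell hc σ ε x).1 0 k.succ = 0 ↔ x.1 (σ k) = 1 ∨ x.1 (σ k) = -1 := by
  rw [← weight_eq_zero_iff hc x.2, ← cell_off_sq, sq_eq_zero_iff]

theorem continuous_cell : Continuous (cell hc σ ε) :=
  (continuous_cellMatrix hc σ ε).subtype_mk _

theorem cell_mem_chamber : cell hc σ ε x ∈ chamber lam σ ε := by
  intro k
  rw [cell_diag, cell_off, ← mul_assoc, sign_mul_self, one_mul]
  exact ⟨⟨le_alpha hc x.2 _, alpha_le hc x.2 _⟩, Real.sqrt_nonneg _⟩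

theorem mem_cubeFacet_one_iff : x.1 ∈ cubeFacet (σ k) 1 ↔
    (cell hc σ ε x).1 0 k.succ = 0 ∧ (cell hc σ ε x).1 k.succ k.succ = lam (σ k).succ := by
  rw [cell_off_eq_zero_iff, cell_diag]
  have hlt := hc.strictMono (σ k).castSucc_lt_succ
  constructor
  · rintro ⟨-, h⟩
    have h : x.1 (σ k) = 1 := by simpa using h
    exact ⟨Or.inl h, alpha_of_eq_one hc x.2 h⟩
  · rintro ⟨h | h, ha⟩
    · exact ⟨x.2, by simpa using h⟩
    · rw [alpha_of_eq_neg_one hc x.2 h] at ha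
      exact absurd ha hlt.ne

theorem mem_cubeFacet_neg_one_iff : x.1 ∈ cubeFacet (σ k) (-1) ↔
    (cell hc σ ε x).1 0 k.succ = 0 ∧ (cell hc σ ε x).1 k.succ k.succ = lam (σ k).castSucc := by
  rw [cell_off_eq_zero_iff, cell_diag]
  have hlt := hc.strictMono (σ k).castSucc_lt_succ
  constructor
  · rintro ⟨-, h⟩
    have h : x.1 (σ k) = -1 := by simpa using h
    exact ⟨Or.inr h, alpha_of_eq_neg_one hc x.2 h⟩
  · rintro ⟨h | h, ha⟩
    · rw [alpha_of_eq_one hc x.2 h] at ha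
      exact absurd ha hlt.ne'
    · exact ⟨x.2, by simpa using h⟩

/-- If no other diagonal entry equals the `k`-th one, then the diagonal determines the square of
the `k`-th off-diagonal entry. -/
theorem sq_eq_of_diag_eq {A B : isospectral lam}
    (h : ∀ k : Fin n, A.1 k.succ k.succ = B.1 k.succ k.succ)
    (hk : ∀ m, m ≠ k → A.1 m.succ m.succ ≠ A.1 k.succ k.succ) :
    A.1 0 k.succ ^ 2 = B.1 0 k.succ ^ 2 := by
  have := isospectral_sum_sq_eq h (A.1 k.succ k.succ)
  have hf : (Finset.univ.filter fun m : Fin n => A.1 m.succ m.succ = A.1 k.succ k.succ) = {k} := by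
    ext m
    simp only [Finset.mem_filter, Finset.mem_univ, true_and, Finset.mem_singleton]
    exact ⟨fun e => by_contra fun hm => hk m hm e, fun e => by rw [e]⟩
  rwa [hf, Finset.sum_singleton, Finset.sum_singleton] at this

theorem sq_add_sq_eq_of_diag_eq {A B : isospectral lam} {l : Fin n}
    (h : ∀ k : Fin n, A.1 k.succ k.succ = B.1 k.succ k.succ) (hkl : k ≠ l)
    (hkl' : A.1 k.succ k.succ = A.1 l.succ l.succ)
    (hk : ∀ m, m ≠ k → m ≠ l → A.1 m.succ m.succ ≠ A.1 k.succ k.succ) :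
    A.1 0 k.succ ^ 2 + A.1 0 l.succ ^ 2 = B.1 0 k.succ ^ 2 + B.1 0 l.succ ^ 2 := by
  have := isospectral_sum_sq_eq h (A.1 k.succ k.succ)
  have hf : (Finset.univ.filter fun m : Fin n => A.1 m.succ m.succ = A.1 k.succ k.succ) = {k, l} := by
    ext m
    simp only [Finset.mem_filter, Finset.mem_univ, true_and, Finset.mem_insert,
      Finset.mem_singleton]
    constructor
    · intro e
      by_contra! hm
      exact hk m hm.1 hm.2 e
    · rintro (rfl | rfl)
      · rfl
      · exact hkl'.symm
  rwa [hf, Finset.sum_pair hkl, Finset.sum_pair hkl] at this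

/-- At most two diagonal entries coincide. -/
theorem alpha_ne_of_alpha_eq (hc : IsGapBound lam c) {x : Fin n → ℝ} (hx : x ∈ polytope n)
    (hij : (i : ℕ) + 1 = j) (h : alpha lam c x i = alpha lam c x j) {m : Fin n} (hi : m ≠ i)
    (hj : m ≠ j) : alpha lam c x m ≠ alpha lam c x i := by
  have hlt : i < j := by rw [Fin.lt_def]; omega
  intro e
  rcases lt_or_gt_of_ne hi with hm | hm
  · have h1 := succ_eq_of_alpha_eq hc hx (hm.trans hlt) (e.trans h)
    rw [Fin.lt_def] at hm
    omega
  · have h1 := succ_eq_of_alpha_eq hc hx hm e.symm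
    exact hj (Fin.ext (by omega))

/-- The diagonal determines the contracted point. The position along the segment of a cut facet is
the share of one weight in the positive sum of the two. -/
theorem cell_injective : Function.Injective (cell hc σ ε) := by
  intro x y h
  have ha : ∀ i, alpha lam c x.1 i = alpha lam c y.1 i := by
    intro i
    have := congrArg (fun A => A.1 (σ.symm i).succ (σ.symm i).succ) h
    simp only [cell_diag, Equiv.apply_symm_apply] at this
    exact this
  have hw : ∀ i, weight lam c x.1 i = weight lam c y.1 i := by
    intro i
    have := congrArg (fun A => A.1 0 (σ.symm i).succ ^ 2) h
    simp only [cell_off_sq, Equiv.apply_symm_apply] at this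
    exact this
  refine Subtype.ext (eq_of_shrinkR_eq x.2 y.2
    (fun i => shrinkR_eq_of_alpha_eq hc x.2 y.2 (ha i)) fun i j hij hx hy => ?_)
  have hxa := (alpha_eq_alpha_iff hc x.2 hij).2 hx
  have hya := (alpha_eq_alpha_iff hc y.2 hij).2 hy
  have h1 := weight_eq_ratio_mul hc x.2 hij hxa
  have h2 := weight_eq_ratio_mul hc y.2 hij hya
  rw [ratio_of_mem_cutFacet hc hij ((alpha_eq_alpha_iff_mem_cutFacet hc x.2 hij).1 hxa)] at h1
  rw [ratio_of_mem_cutFacet hc hij ((alpha_eq_alpha_iff_mem_cutFacet hc y.2 hij).1 hya), ← hw,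
    ← hw] at h2
  have := mul_right_cancel₀ (weight_add_weight_pos hc x.2 hij hxa).ne' (h1.symm.trans h2)
  unfold distR at this
  linarith

/-- The diagonal of `A` prescribes the contracted point, the off-diagonal squares its position on
the cut facets. The squares then agree: for an isolated diagonal entry the diagonal determines the
square, and for a coincident pair it determines the sum while the share was prescribed. -/
theorem exists_cell_eq {A : isospectral lam} (hA : A ∈ chamber lam σ ε) :
    ∃ x, cell hc σ ε x = A := by
  have hS : ∀ i, ∃ s ∈ Set.Icc (0 : ℝ) 1,
      s * profile lam c i s = lam i.succ - A.1 (σ.symm i).succ (σ.symm i).succ := by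
    intro i
    have := (hA (σ.symm i)).1
    rw [Equiv.apply_symm_apply] at this
    exact exists_mul_profile_eq _ ⟨by linarith [this.2], by linarith [this.1]⟩
  choose S hS1 hS2 using hS
  have hdiag : ∀ x : polytope n, (∀ i, shrinkR x.1 i = S i) →
      ∀ k : Fin n, A.1 k.succ k.succ = (cell hc σ ε x).1 k.succ k.succ := by
    intro x hx k
    rw [cell_diag, alpha, hx, hS2, Equiv.symm_apply_apply]
    ring
  let b : Fin n → ℝ := fun i => A.1 0 (σ.symm i).succ ^ 2
  have hb : ∀ i, 0 ≤ b i := fun i => sq_nonneg _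
  -- Only the shares of coincident pairs matter. Elsewhere the quotient may be `0 / 0 = 0`, which is
  -- still in `[0, 1]`.
  obtain ⟨x, hx, hxS, hxw⟩ := exists_shrinkR_eq (S := S) (w := fun i => b i / (b i + b (nxt i))) hS1
    fun i => ⟨div_nonneg (hb i) (add_nonneg (hb i) (hb _)),
      div_le_one_of_le₀ (by linarith [hb (nxt i)]) (add_nonneg (hb i) (hb _))⟩
  have hd := hdiag ⟨x, hx⟩ hxS
  have hpair : ∀ i j : Fin n, (i : ℕ) + 1 = j → alpha lam c x i = alpha lam c x j →
      b i = weight lam c x i ∧ b j = weight lam c x j := by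
    intro i j hij he
    have hsum : b i + b j = weight lam c x i + weight lam c x j := by
      have := sq_add_sq_eq_of_diag_eq (k := σ.symm i) (l := σ.symm j) hd ?_ ?_ ?_
      · simpa only [cell_off_sq, Equiv.apply_symm_apply] using this
      · intro h
        rw [σ.symm.injective h] at hij
        omega
      · simpa only [hd, cell_diag, Equiv.apply_symm_apply] using he
      · intro m hmi hmj
        simp only [hd, cell_diag, Equiv.apply_symm_apply]
        exact alpha_ne_of_alpha_eq hc hx hij he (fun h => hmi (by rw [← h, Equiv.symm_apply_apply]))
          (fun h => hmj (by rw [← h, Equiv.symm_apply_apply]))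
    have hcut := (alpha_eq_alpha_iff_mem_cutFacet hc hx hij).1 he
    have h0 := (alpha_eq_alpha_iff hc hx hij).1 he
    have hSi : S i = 0 := by rw [← hxS, shrinkR, h0, mul_zero]
    have hSj : S j = 1 := by
      have := shrinkR_add_shrinkL hx j
      rwa [shrinkL, dampL_eq_dampR hij, h0, mul_zero, add_zero, hxS] at this
    have hr := hxw i j hij hSi hSj
    rw [nxt_eq hij, hsum] at hr
    have hpos := weight_add_weight_pos hc hx hij he
    have hwi := weight_eq_ratio_mul hc hx hij he
    rw [ratio_of_mem_cutFacet hc hij hcut, hr, mul_div_cancel₀ _ four_ne_zero,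
      div_mul_cancel₀ _ hpos.ne'] at hwi
    exact ⟨hwi.symm, by linarith⟩
  have hb' : ∀ i, b i = weight lam c x i := by
    intro i
    by_cases hex : ∃ j, j ≠ i ∧ alpha lam c x j = alpha lam c x i
    · obtain ⟨j, hj, he⟩ := hex
      rcases lt_or_gt_of_ne hj with hlt | hlt
      · exact (hpair j i (succ_eq_of_alpha_eq hc hx hlt he) he).2
      · exact (hpair i j (succ_eq_of_alpha_eq hc hx hlt he.symm) he.symm).1
    · push Not at hex
      have := sq_eq_of_diag_eq (k := σ.symm i) hd ?_
      · simpa only [cell_off_sq, Equiv.apply_symm_apply] using this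
      · intro m hm
        simp only [hd, cell_diag, Equiv.apply_symm_apply]
        exact hex _ fun h => hm (by rw [← h, Equiv.symm_apply_apply])
  refine ⟨⟨x, hx⟩, isospectral_ext (fun k => (hd k).symm) fun k => ?_⟩
  have h1 := hb' (σ k)
  have h2 := (hA k).2
  simp only [b, Equiv.symm_apply_apply] at h1
  rw [cell_off, ← h1]
  have h3 : A.1 0 k.succ ^ 2 = (((ε k : ℤ) : ℝ) * A.1 0 k.succ) ^ 2 := by
    rw [mul_pow, sq ((ε k : ℤ) : ℝ), sign_mul_self, one_mul]
  rw [h3, Real.sqrt_sq h2, ← mul_assoc, sign_mul_self, one_mul]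

theorem range_cell : Set.range (cell hc σ ε) = chamber lam σ ε :=
  Set.Subset.antisymm (Set.range_subset_iff.2 fun _ => cell_mem_chamber) fun _ h => exists_cell_eq h

theorem exists_mem_chamber (hlam : StrictMono lam) (A : isospectral lam) :
    ∃ σ ε, A ∈ chamber lam σ ε := by
  obtain ⟨σ, hσ⟩ := exists_perm_mem_Icc hlam A
  refine ⟨σ, fun k => if 0 ≤ A.1 0 k.succ then 1 else -1, fun k => ⟨hσ k, ?_⟩⟩
  beta_reduce
  split_ifs with h
  · simpa using h
  · simpa using (not_le.1 h).le

end Cell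

end

end ArrowMatrix

namespace ArrowMatrix

noncomputable section

/-! ### Compatibility with the gluing, and the homeomorphism. -/

section Gluing

variable {n : ℕ} {lam : Fin (n + 1) → ℝ} {c : ℝ}

/-- Before and after, coordinates `i` and `j` are contracted to the corner. Other coordinates could
notice the change only through the corners shared with `i` or `j`, but `x i ≥ 1/2` and `x j ≤ -1/2`
on the facet, so those contractions are idle. -/
theorem shrinkR_antipode {x : Fin n → ℝ} {i j : Fin n} (hij : (i : ℕ) + 1 = j)
    (hx : x ∈ cutFacet i j) (m : Fin n) : shrinkR (antipode i j x) m = shrinkR x m := by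
  have hy := antipode_mem_cutFacet hij hx
  have hne : j ≠ i := by rintro rfl; omega
  have hyi : antipode i j x i = -x j := by simp [antipode]
  have hyj : antipode i j x j = -x i := by simp [antipode, hne]
  have hym : ∀ m, m ≠ i → m ≠ j → antipode i j x m = x m := by
    intro m h1 h2; simp [antipode, h1, h2]
  have hc := hx.2
  have hi := hx.1.1 i
  have hj := hx.1.1 j
  have hd := (dampR_eq_zero_iff hx.1 hij).2 hx.2
  have hd' := (dampR_eq_zero_iff hy.1 hij).2 hy.2
  by_cases hmi : m = i
  · rw [hmi, shrinkR, shrinkR, hd, hd', mul_zero, mul_zero]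
  by_cases hmj : m = j
  · have h1 := shrinkR_add_shrinkL hx.1 j
    have h2 := shrinkR_add_shrinkL hy.1 j
    rw [shrinkL, dampL_eq_dampR hij, hd, mul_zero, add_zero] at h1
    rw [shrinkL, dampL_eq_dampR hij, hd', mul_zero, add_zero] at h2
    rw [hmj, h1, h2]
  · have hR : distR (antipode i j x) m = distR x m := by rw [distR, distR, hym m hmi hmj]
    have hL : distL (antipode i j x) m = distL x m := by rw [distL, distL, hym m hmi hmj]
    have hdR : dampR (antipode i j x) m = dampR x m := by
      have h0 := distR_nonneg hx.1 m
      by_cases h : nxt m = i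
      · rw [dampR, dampR, h, hR, damp_eq_one, damp_eq_one]
        · unfold distL; linarith
        · unfold distL; rw [hyi]; linarith
      · have h' : nxt m ≠ j := by
          rcases nxt_eq_self_or m with e | e
          · rwa [e]
          · intro e'
            rw [e'] at e
            exact hmi (Fin.ext (by omega))
        rw [dampR, dampR, hR, distL, distL, hym _ h h']
    have hdL : dampL (antipode i j x) m = dampL x m := by
      have h0 := distL_nonneg hx.1 m
      by_cases h : prv m = j
      · rw [dampL, dampL, h, hL, damp_eq_one, damp_eq_one]
        · unfold distR; linarith
        · unfold distR; rw [hyj]; linarith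
      · have h' : prv m ≠ i := by
          rcases prv_eq_self_or m with e | e
          · rwa [e]
          · intro e'
            rw [e'] at e
            exact hmj (Fin.ext (by omega))
        rw [dampL, dampL, hL, distR, distR, hym _ h' h]
    rw [shrinkR, shrinkR, slopeR, slopeR, hdR, hdL, hL]

theorem alpha_antipode {x : Fin n → ℝ} {i j : Fin n} (hij : (i : ℕ) + 1 = j)
    (hx : x ∈ cutFacet i j) (m : Fin n) :
    alpha lam c (antipode i j x) m = alpha lam c x m := by
  rw [alpha, alpha, shrinkR_antipode hij hx]

theorem alpha_swap (hc : IsGapBound lam c) {x : Fin n → ℝ} {i j : Fin n} (hij : (i : ℕ) + 1 = j)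
    (hx : x ∈ cutFacet i j) (m : Fin n) :
    alpha lam c x (Equiv.swap i j m) = alpha lam c x m := by
  have h := (alpha_eq_alpha_iff_mem_cutFacet hc hx.1 hij).2 hx
  rw [Equiv.swap_apply_def]
  split_ifs with h1 h2
  · rw [h1, h]
  · rw [h2, h]
  · rfl

/-- The antipodal gluing is compatible with the parametrizations of the chambers. -/
theorem cell_antipode (hc : IsGapBound lam c) {σ τ : Equiv.Perm (Fin n)} (ε : Fin n → ℤˣ)
    {i j : Fin n} (hij : (i : ℕ) + 1 = j) (hστ : σ = Equiv.swap i j * τ) {x y : polytope n}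
    (hx : x.1 ∈ cutFacet i j) (hy : y.1 = antipode i j x.1) :
    cell hc σ ε x = cell hc τ ε y := by
  have hne : i ≠ j := by rintro rfl; omega
  have ha := (alpha_eq_alpha_iff_mem_cutFacet hc hx.1 hij).2 hx
  have hτ : ∀ m, τ m = Equiv.swap i j (σ m) := by
    intro m; rw [hστ, Equiv.Perm.mul_apply, Equiv.swap_apply_self]
  have hdiag : ∀ k : Fin n, (cell hc σ ε x).1 k.succ k.succ = (cell hc τ ε y).1 k.succ k.succ := by
    intro k
    rw [cell_diag, cell_diag, hy, alpha_antipode hij hx, hτ, alpha_swap hc hij hx]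
  have hy' : y.1 ∈ cutFacet i j := hy ▸ antipode_mem_cutFacet hij hx
  have hay := (alpha_eq_alpha_iff_mem_cutFacet hc hy'.1 hij).2 hy'
  have hpair : ∀ p q : Fin n, (p : ℕ) + 1 = q → alpha lam c x.1 p = alpha lam c x.1 q →
      weight lam c x.1 p + weight lam c x.1 q =
        weight lam c y.1 (Equiv.swap i j p) + weight lam c y.1 (Equiv.swap i j q) := by
    intro p q hpq he
    have := sq_add_sq_eq_of_diag_eq (k := σ.symm p) (l := σ.symm q) hdiag ?_ ?_ ?_
    · simpa only [cell_off_sq, Equiv.apply_symm_apply, hτ] using this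
    · intro h
      rw [σ.symm.injective h] at hpq
      omega
    · simpa only [cell_diag, Equiv.apply_symm_apply] using he
    · intro m hmp hmq
      simp only [cell_diag, Equiv.apply_symm_apply]
      exact alpha_ne_of_alpha_eq hc hx.1 hpq he
        (fun h => hmp (by rw [← h, Equiv.symm_apply_apply]))
        (fun h => hmq (by rw [← h, Equiv.symm_apply_apply]))
  have hsum := hpair i j hij ha
  rw [Equiv.swap_apply_left, Equiv.swap_apply_right, add_comm (weight lam c y.1 j)] at hsum
  have hi : weight lam c x.1 i = weight lam c y.1 j := by
    have h1 := weight_eq_ratio_mul hc hx.1 hij ha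
    have h2 := weight_eq_ratio_mul hc hy'.1 hij hay
    rw [ratio_of_mem_cutFacet hc hij hx] at h1
    rw [ratio_of_mem_cutFacet hc hij hy', ← hsum] at h2
    -- Reversing the segment exchanges the shares `4 * distR` and `1 - 4 * distR`.
    have h3 : distR y.1 i = 1 / 4 - distR x.1 i := by
      have h4 := hx.2
      rw [hy]
      simp only [distR, antipode, if_true]
      linarith
    rw [h3] at h2
    linear_combination h1 + h2 + hsum
  -- A coincident pair away from `i, j` keeps its coordinates and hence its shares, and the diagonal
  -- fixes its total weight.
  have hother : ∀ p q : Fin n, (p : ℕ) + 1 = q → alpha lam c x.1 p = alpha lam c x.1 q →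
      p ≠ i → p ≠ j → q ≠ i → q ≠ j →
      weight lam c x.1 p = weight lam c y.1 p ∧ weight lam c x.1 q = weight lam c y.1 q := by
    intro p q hpq he hpi hpj hqi hqj
    have hs := hpair p q hpq he
    rw [Equiv.swap_apply_of_ne_of_ne hpi hpj, Equiv.swap_apply_of_ne_of_ne hqi hqj] at hs
    have he' : alpha lam c y.1 p = alpha lam c y.1 q := by
      rw [hy, alpha_antipode hij hx, alpha_antipode hij hx, he]
    have h1 := weight_eq_ratio_mul hc hx.1 hpq he
    have h2 := weight_eq_ratio_mul hc hy'.1 hpq he'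
    rw [ratio_of_mem_cutFacet hc hpq ((alpha_eq_alpha_iff_mem_cutFacet hc hx.1 hpq).1 he)] at h1
    rw [ratio_of_mem_cutFacet hc hpq ((alpha_eq_alpha_iff_mem_cutFacet hc hy'.1 hpq).1 he'),
      ← hs] at h2
    have h3 : distR y.1 p = distR x.1 p := by
      rw [hy]; simp only [distR, antipode, if_neg hpi, if_neg hpj]
    rw [h3] at h2
    have h4 := h1.trans h2.symm
    exact ⟨h4, by linarith⟩
  have hw : ∀ m, weight lam c x.1 (σ m) = weight lam c y.1 (τ m) := by
    intro m
    by_cases hmi : σ m = i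
    · rw [hτ, hmi, Equiv.swap_apply_left, hi]
    by_cases hmj : σ m = j
    · rw [hτ, hmj, Equiv.swap_apply_right]
      linarith
    by_cases hex : ∃ l, l ≠ σ m ∧ alpha lam c x.1 l = alpha lam c x.1 (σ m)
    · obtain ⟨l, hl, e⟩ := hex
      have hli : l ≠ i := by
        rintro rfl
        exact alpha_ne_of_alpha_eq hc hx.1 hij ha hmi hmj e.symm
      have hlj : l ≠ j := by
        rintro rfl
        exact alpha_ne_of_alpha_eq hc hx.1 hij ha hmi hmj (e.symm.trans ha.symm)
      rw [hτ, Equiv.swap_apply_of_ne_of_ne hmi hmj]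
      rcases lt_or_gt_of_ne hl with hlt | hlt
      · exact (hother _ _ (succ_eq_of_alpha_eq hc hx.1 hlt e) e hli hlj hmi hmj).2
      · exact (hother _ _ (succ_eq_of_alpha_eq hc hx.1 hlt e.symm) e.symm hmi hmj hli hlj).1
    · push Not at hex
      have := sq_eq_of_diag_eq (k := m) hdiag ?_
      · simpa only [cell_off_sq] using this
      · intro l hl
        simp only [cell_diag]
        exact hex _ fun h => hl (σ.injective h)
  refine isospectral_ext hdiag fun k => ?_
  rw [cell_off, cell_off, hw]

theorem cell_eq_of_glue (hc : IsGapBound lam c) {p q : Pieces n} (h : Glue p q) :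
    cell hc p.1.1 p.1.2 p.2 = cell hc q.1.1 q.1.2 q.2 := by
  cases h with
  | cut σ τ ε i j hij hστ x y hx hy =>
    exact cell_antipode hc ε hij (by rw [← hστ, inv_mul_cancel_right]) hx hy
  | cube σ ε₁ ε₂ k δ hε x hx =>
    refine isospectral_ext (fun m => rfl) fun m => ?_
    change ((ε₁ m : ℤ) : ℝ) * √(weight lam c x.1 (σ m)) = ((ε₂ m : ℤ) : ℝ) * √(weight lam c x.1 (σ m))
    rcases eq_or_ne m k with rfl | hm
    · have : weight lam c x.1 (σ m) = 0 := by
        rw [weight_eq_zero_iff hc x.2, hx.2]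
        exact sign_eq_one_or δ
      rw [this, Real.sqrt_zero, mul_zero, mul_zero]
    · have := congrFun hε m
      rw [Pi.mulSingle_eq_of_ne hm, Pi.mul_apply, Pi.inv_apply, mul_inv_eq_one] at this
      rw [this]

/-- A permutation that moves every index by at most one and moves an index up exchanges it with
its successor. -/
theorem apply_eq_of_displacement {π : Equiv.Perm (Fin n)}
    (h : ∀ i, (π i : ℕ) ≤ i + 1 ∧ (i : ℕ) ≤ π i + 1) {i j : Fin n} (hij : (i : ℕ) + 1 = j)
    (hi : π i = j) : π j = i := by
  obtain ⟨N, hN⟩ : ∃ N : ℕ, (i : ℕ) = N := ⟨_, rfl⟩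
  induction N using Nat.strong_induction_on generalizing i j with
  | _ N ih =>
    -- The preimage of `i` is `i - 1` or `j`, because it is not `i`. In the first case induction
    -- would force `π i = i - 1`.
    have h1 := h (π.symm i)
    rw [Equiv.apply_symm_apply] at h1
    have h2 : π.symm i ≠ i := fun e => by
      have := congrArg π e
      rw [Equiv.apply_symm_apply, hi] at this
      rw [← this] at hij
      omega
    rw [ne_eq, Fin.ext_iff] at h2
    by_cases h3 : (π.symm i : ℕ) + 1 = i
    · have h4 := ih _ (by omega) h3 (Equiv.apply_symm_apply _ _) rfl
      rw [hi] at h4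
      rw [← h4] at h3
      omega
    · rw [show j = π.symm i from Fin.ext (by omega), Equiv.apply_symm_apply]

theorem apply_eq_of_displacement' {π : Equiv.Perm (Fin n)}
    (h : ∀ i, (π i : ℕ) ≤ i + 1 ∧ (i : ℕ) ≤ π i + 1) {i j : Fin n} (hij : (i : ℕ) + 1 = j)
    (hj : π j = i) : π i = j := by
  have h' : ∀ i, (π.symm i : ℕ) ≤ i + 1 ∧ (i : ℕ) ≤ π.symm i + 1 := fun i => by
    have := h (π.symm i)
    rw [Equiv.apply_symm_apply] at this
    exact this.symm
  have := apply_eq_of_displacement h' hij (by rw [← hj, Equiv.symm_apply_apply])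
  rw [← this, Equiv.apply_symm_apply]

/-- A permutation that moves every index by at most one exchanges two neighbours, unless it is
trivial. -/
theorem exists_swap_of_displacement {π : Equiv.Perm (Fin n)}
    (h : ∀ i, (π i : ℕ) ≤ i + 1 ∧ (i : ℕ) ≤ π i + 1) (hπ : π ≠ 1) :
    ∃ i j : Fin n, (i : ℕ) + 1 = j ∧ π i = j ∧ π j = i := by
  obtain ⟨i, hi⟩ : ∃ i, π i ≠ i := by
    by_contra! hall
    exact hπ (Equiv.ext hall)
  rw [ne_eq, Fin.ext_iff] at hi
  have h1 := h i
  by_cases h2 : (i : ℕ) + 1 = π i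
  · exact ⟨i, π i, h2, rfl, apply_eq_of_displacement h h2 rfl⟩
  · have h3 : (π i : ℕ) + 1 = i := by omega
    exact ⟨π i, i, h3, apply_eq_of_displacement' h h3 rfl, rfl⟩

/-- If a point lies in two spectral gaps, then these are neighbours and the point is between
them. -/
theorem eq_or_of_mem_Icc (hlam : StrictMono lam) {i j : Fin n} {v : ℝ}
    (hi : v ∈ Set.Icc (lam i.castSucc) (lam i.succ)) (hj : v ∈ Set.Icc (lam j.castSucc) (lam j.succ)) :
    i = j ∨ ((i : ℕ) + 1 = j ∧ v = lam i.succ) ∨ ((j : ℕ) + 1 = i ∧ v = lam j.succ) := by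
  have h1 := hlam.le_iff_le.1 (hi.1.trans hj.2)
  have h2 := hlam.le_iff_le.1 (hj.1.trans hi.2)
  rw [Fin.le_def] at h1 h2
  simp only [Fin.val_succ, Fin.val_castSucc] at h1 h2
  by_cases h3 : (i : ℕ) = j
  · exact Or.inl (Fin.ext h3)
  by_cases h4 : (i : ℕ) + 1 = j
  · refine Or.inr (Or.inl ⟨h4, le_antisymm hi.2 ?_⟩)
    rw [← castSucc_eq_succ h4]
    exact hj.1
  · have h5 : (j : ℕ) + 1 = i := by omega
    refine Or.inr (Or.inr ⟨h5, le_antisymm hj.2 ?_⟩)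
    rw [← castSucc_eq_succ h5]
    exact hi.1

/-- Where the signs disagree, the off-diagonal entry vanishes, so `x` is on a cube facet and a
gluing flips the sign. Induction on the number of disagreements ends with `cell_injective`. -/
theorem mk_eq_of_cell_eq_of_perm_eq (hc : IsGapBound lam c) {σ : Equiv.Perm (Fin n)}
    {ε ε' : Fin n → ℤˣ} {x y : polytope n} (h : cell hc σ ε x = cell hc σ ε' y) :
    (Quot.mk Glue ⟨(σ, ε), x⟩ : Glued n) = Quot.mk Glue ⟨(σ, ε'), y⟩ := by
  classical
  obtain ⟨N, hN⟩ : ∃ N, (Finset.univ.filter fun k => ε k ≠ ε' k).card = N := ⟨_, rfl⟩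
  induction N using Nat.strong_induction_on generalizing ε with
  | _ N ih =>
    by_cases hε : ε = ε'
    · subst hε
      rw [cell_injective h]
    · obtain ⟨k, hk⟩ : ∃ k, ε k ≠ ε' k := by
        by_contra! hall
        exact hε (funext hall)
      have hw : cell hc σ ε x ∈ chamber lam σ ε ∧ cell hc σ ε x ∈ chamber lam σ ε' :=
        ⟨cell_mem_chamber, h ▸ cell_mem_chamber⟩
      have h0 : (cell hc σ ε x).1 0 k.succ = 0 := by
        have h1 := (hw.1 k).2
        have h2 := (hw.2 k).2
        rcases Int.units_eq_one_or (ε k) with e | e <;> rcases Int.units_eq_one_or (ε' k) with e' | e'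
        · exact absurd (e.trans e'.symm) hk
        · rw [e] at h1; rw [e'] at h2; norm_num at h1 h2; linarith
        · rw [e] at h1; rw [e'] at h2; norm_num at h1 h2; linarith
        · exact absurd (e.trans e'.symm) hk
      have hkε : ε k * (ε' k)⁻¹ = -1 := by
        rcases Int.units_eq_one_or (ε k) with e | e <;> rcases Int.units_eq_one_or (ε' k) with e' | e'
        · exact absurd (e.trans e'.symm) hk
        · rw [e, e']; rfl
        · rw [e, e']; rfl
        · exact absurd (e.trans e'.symm) hk
      obtain ⟨δ, hδ⟩ : ∃ δ : ℤˣ, x.1 ∈ cubeFacet (σ k) δ := by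
        rcases cell_off_eq_zero_iff.1 h0 with h1 | h1
        · exact ⟨1, x.2, by simpa using h1⟩
        · exact ⟨-1, x.2, by simpa using h1⟩
      have hglue : Glue ⟨(σ, ε), x⟩ ⟨(σ, Function.update ε k (ε' k)), x⟩ := by
        refine Glue.cube σ ε _ k δ ?_ x hδ
        funext m
        rcases eq_or_ne m k with rfl | hm
        · simpa using hkε
        · simp [hm]
      rw [Quot.sound hglue]
      refine ih _ ?_ ((cell_eq_of_glue hc hglue).symm.trans h) rfl
      rw [← hN]
      refine Finset.card_lt_card (Finset.ssubset_iff_of_subset ?_ |>.2 ⟨k, by simpa using hk, by simp⟩)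
      intro m hm
      simp only [Finset.mem_filter, Finset.mem_univ, true_and] at hm ⊢
      rcases eq_or_ne m k with rfl | hmk
      · exact hk
      · rwa [Function.update_of_ne hmk] at hm

/-- Every diagonal entry lies in the gaps assigned to it by both permutations, so `τ * σ⁻¹` moves
each index by at most one and, unless trivial, exchanges two neighbours. A cut gluing performs this
exchange, after which the permutations disagree in fewer places. -/
theorem mk_eq_of_cell_eq (hc : IsGapBound lam c) {σ τ : Equiv.Perm (Fin n)}
    {ε ε' : Fin n → ℤˣ} {x y : polytope n} (h : cell hc σ ε x = cell hc τ ε' y) :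
    (Quot.mk Glue ⟨(σ, ε), x⟩ : Glued n) = Quot.mk Glue ⟨(τ, ε'), y⟩ := by
  classical
  obtain ⟨N, hN⟩ : ∃ N, (Finset.univ.filter fun k => σ k ≠ τ k).card = N := ⟨_, rfl⟩
  induction N using Nat.strong_induction_on generalizing σ x with
  | _ N ih =>
    by_cases hσ : σ = τ
    · subst hσ
      exact mk_eq_of_cell_eq_of_perm_eq hc h
    · have hmem : ∀ k, alpha lam c x.1 (σ k) ∈ Set.Icc (lam (τ k).castSucc) (lam (τ k).succ) := by
        intro k
        have := (cell_mem_chamber (hc := hc) (σ := τ) (ε := ε') (x := y) k).1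
        rwa [← h, cell_diag] at this
      have hmem' : ∀ i, alpha lam c x.1 i ∈ Set.Icc (lam i.castSucc) (lam i.succ) :=
        fun i => ⟨le_alpha hc x.2 i, alpha_le hc x.2 i⟩
      obtain ⟨i, j, hij, hi, hj⟩ := exists_swap_of_displacement (π := τ * σ⁻¹) (fun i => by
        have := eq_or_of_mem_Icc hc.strictMono (hmem' i)
          (by simpa using hmem (σ⁻¹ i) : alpha lam c x.1 i ∈ Set.Icc (lam ((τ * σ⁻¹) i).castSucc) _)
        rcases this with e | ⟨e, -⟩ | ⟨e, -⟩
        · rw [← e]; omega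
        · omega
        · omega) fun e => hσ (mul_inv_eq_one.1 e).symm
      have hτi : ∀ k, τ k = (τ * σ⁻¹) (σ k) := fun k => by simp
      have hne : i ≠ j := by rintro rfl; omega
      -- Both entries lie in both gaps, hence at their only common point.
      have hcut : x.1 ∈ cutFacet i j := by
        rw [← alpha_eq_alpha_iff_mem_cutFacet hc x.2 hij]
        have h1 := hmem (σ.symm i)
        have h2 := hmem (σ.symm j)
        rw [hτi, Equiv.apply_symm_apply, hi] at h1
        rw [hτi, Equiv.apply_symm_apply, hj] at h2
        have h3 := hmem' i
        have h4 := hmem' j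
        rw [castSucc_eq_succ hij] at h1 h4
        linarith [h1.1, h2.2, h3.2, h4.1]
      have hglue : Glue ⟨(σ, ε), x⟩
          ⟨(Equiv.swap i j * σ, ε), ⟨antipode i j x.1, (antipode_mem_cutFacet hij hcut).1⟩⟩ := by
        refine Glue.cut σ _ ε i j hij ?_ x _ hcut rfl
        rw [mul_inv_rev, mul_inv_cancel_left, Equiv.swap_inv]
      rw [Quot.sound hglue]
      refine ih _ ?_ ((cell_eq_of_glue hc hglue).symm.trans h) rfl
      rw [← hN]
      have hk : τ (σ.symm i) = j := by rw [hτi, Equiv.apply_symm_apply, hi]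
      refine Finset.card_lt_card (Finset.ssubset_iff_of_subset ?_ |>.2 ⟨σ.symm i, ?_, ?_⟩)
      · intro m hm
        refine Finset.mem_filter.2 ⟨Finset.mem_univ _, fun e => (Finset.mem_filter.1 hm).2 ?_⟩
        rw [Equiv.Perm.mul_apply]
        have hm' := hτi m
        rw [Equiv.swap_apply_of_ne_of_ne, e]
        · intro e'
          rw [e', hi] at hm'
          exact hne (e'.symm.trans (e.trans hm'))
        · intro e'
          rw [e', hj] at hm'
          exact hne (hm'.symm.trans (e.symm.trans e'))
      · simp [hk, hne]
      · exact fun hm => (Finset.mem_filter.1 hm).2 (by simp [hk])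

instance : CompactSpace (polytope n) := by
  rw [← isCompact_iff_compactSpace]
  refine (isCompact_Icc (a := fun _ : Fin n => (-1 : ℝ)) (b := fun _ => 1)).of_isClosed_subset ?_
    fun x hx => ⟨fun k => (hx.1 k).1, fun k => (hx.1 k).2⟩
  have : polytope n = (⋂ k, {x | -1 ≤ x k ∧ x k ≤ 1}) ∩
      ⋂ i : Fin n, ⋂ j : Fin n, ⋂ _ : (i : ℕ) + 1 = j, {x | x i - x j ≤ 3 / 2} := by
    ext x
    simp [polytope]
  rw [this]
  refine IsClosed.inter (isClosed_iInter fun k => ?_) (isClosed_iInter fun i =>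
    isClosed_iInter fun j => isClosed_iInter fun _ => ?_)
  · exact (isClosed_le continuous_const (continuous_apply k)).inter
      (isClosed_le (continuous_apply k) continuous_const)
  · exact isClosed_le ((continuous_apply i).sub (continuous_apply j)) continuous_const

/-- The homeomorphism of the glued space with the isospectral space. -/
theorem exists_homeomorph (hc : IsGapBound lam c) :
    ∃ Φ : Glued n ≃ₜ isospectral lam, ∀ σ ε, cellMap Φ σ ε = cell hc σ ε := by
  let f : Glued n → isospectral lam :=
    Quot.lift (fun p => cell hc p.1.1 p.1.2 p.2) fun _ _ h => cell_eq_of_glue hc h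
  have hf : Continuous f := by
    have h : Continuous fun p : Pieces n => cell hc p.1.1 p.1.2 p.2 :=
      continuous_sigma fun p => continuous_cell (hc := hc) (σ := p.1) (ε := p.2)
    exact continuous_coinduced_dom.2 h
  have hbij : Function.Bijective f := by
    constructor
    · rintro ⟨⟨σ, ε⟩, x⟩ ⟨⟨τ, ε'⟩, y⟩ h
      exact mk_eq_of_cell_eq hc h
    · intro A
      obtain ⟨σ, ε, hA⟩ := exists_mem_chamber hc.strictMono A
      obtain ⟨x, hx⟩ := exists_cell_eq (hc := hc) hA
      exact ⟨Quot.mk _ ⟨(σ, ε), x⟩, hx⟩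
  have hf' : Continuous (Equiv.ofBijective f hbij) := hf
  exact ⟨hf'.homeoOfEquivCompactToT2, fun σ ε => rfl⟩

end Gluing

end

end ArrowMatrix

namespace ArrowMatrix

noncomputable section

/-! ### The facets of the polytope and its simplicity. -/

section Faces

variable {n : ℕ}

/-- The facets of the polytope. -/
abbrev FacetIndex (n : ℕ) : Type :=
  (Fin n × ℤˣ) ⊕ {p : Fin n × Fin n // (p.1 : ℕ) + 1 = p.2}

/-- The linear form that is maximal on a facet. -/
def facetForm : FacetIndex n → StrongDual ℝ (Fin n → ℝ)
  | Sum.inl (k, δ) => ((δ : ℤ) : ℝ) • ContinuousLinearMap.proj k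
  | Sum.inr p => (ContinuousLinearMap.proj p.1.1 : StrongDual ℝ (Fin n → ℝ)) -
      (ContinuousLinearMap.proj p.1.2 : StrongDual ℝ (Fin n → ℝ))

/-- The value of the linear form on the facet. -/
def facetValue : FacetIndex n → ℝ
  | Sum.inl _ => 1
  | Sum.inr _ => 3 / 2

@[simp] theorem facetForm_inl (k : Fin n) (δ : ℤˣ) (x : Fin n → ℝ) :
    facetForm (Sum.inl (k, δ)) x = ((δ : ℤ) : ℝ) * x k := rfl

@[simp] theorem facetForm_inr (p : {p : Fin n × Fin n // (p.1 : ℕ) + 1 = p.2}) (x : Fin n → ℝ) :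
    facetForm (Sum.inr p) x = x p.1.1 - x p.1.2 := rfl

theorem polytope_eq_polyhedron : polytope n = polyhedron facetForm facetValue := by
  ext x
  constructor
  · rintro ⟨h1, h2⟩ (⟨k, δ⟩ | p)
    · have := h1 k
      rw [facetForm_inl]
      rcases sign_eq_one_or δ with e | e <;> rw [e] <;> simp only [facetValue] <;> linarith
    · exact h2 _ _ p.2
  · intro h
    refine ⟨fun k => ?_, fun i j hij => h (Sum.inr ⟨(i, j), hij⟩)⟩
    have h1 := h (Sum.inl (k, 1))
    have h2 := h (Sum.inl (k, -1))
    simp [facetValue] at h1 h2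
    constructor <;> linarith

/-- The facets that contain a point. -/
abbrev facetsAt (x : Fin n → ℝ) : Set (FacetIndex n) := active facetForm facetValue x

theorem inl_mem_facetsAt {k : Fin n} {δ : ℤˣ} {x : Fin n → ℝ} :
    Sum.inl (k, δ) ∈ facetsAt x ↔ x k = ((δ : ℤ) : ℝ) := by
  change ((δ : ℤ) : ℝ) * x k = 1 ↔ _
  rcases sign_eq_one_or δ with e | e <;> rw [e] <;> constructor <;> intro h <;> linarith

theorem inr_mem_facetsAt {p : {p : Fin n × Fin n // (p.1 : ℕ) + 1 = p.2}} {x : Fin n → ℝ} :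
    Sum.inr p ∈ facetsAt x ↔ x p.1.1 - x p.1.2 = 3 / 2 := Iff.rfl

/-- Two different cut facets that contain a common point have no index in common. -/
theorem cut_disjoint {x : Fin n → ℝ} (hx : x ∈ polytope n) {i j k l : Fin n} (h1 : x i - x j = 3 / 2)
    (h2 : x k - x l = 3 / 2) : j ≠ k := by
  rintro rfl
  have := hx.1 i
  have := hx.1 l
  linarith

/-- The polytope is simple: the facets that contain a point are independent. -/
theorem exists_dual_of_mem_facetsAt {x : Fin n → ℝ} (hx : x ∈ polytope n) {f : FacetIndex n}
    (hf : f ∈ facetsAt x) : ∃ v, facetForm f v = 1 ∧ ∀ g ∈ facetsAt x, g ≠ f → facetForm g v = 0 := by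
  classical
  rcases f with ⟨k, δ⟩ | ⟨⟨i, j⟩, hij⟩
  · have hk := inl_mem_facetsAt.1 hf
    -- To stay on a cut facet through `x`, the partner of `k` must move along with `k`. The partner
    -- is not at `±1` itself, since `x k = ±1` and the difference is `3/2`.
    refine ⟨fun m => if m = k ∨ ((m : ℕ) + 1 = k ∧ x m - x k = 3 / 2) ∨
      ((k : ℕ) + 1 = m ∧ x k - x m = 3 / 2) then ((δ : ℤ) : ℝ) else 0, ?_, ?_⟩
    · simp [sign_mul_self]
    · rintro (⟨m, δ'⟩ | ⟨⟨i, j⟩, hij⟩) hg hne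
      · have hm := inl_mem_facetsAt.1 hg
        rw [facetForm_inl, if_neg, mul_zero]
        rintro (rfl | ⟨-, h⟩ | ⟨-, h⟩)
        · apply hne
          rw [hm] at hk
          have : δ' = δ := by
            apply Units.ext
            exact_mod_cast hk
          rw [this]
        all_goals
          rw [hm, hk] at h
          rcases sign_eq_one_or δ with e | e <;> rcases sign_eq_one_or δ' with e' | e' <;>
            rw [e, e'] at h <;> norm_num at h
      · have hg' := inr_mem_facetsAt.1 hg
        simp only at hg' hij
        rw [facetForm_inr, sub_eq_zero]
        congr 1
        have key : (i = k ∨ ((i : ℕ) + 1 = k ∧ x i - x k = 3 / 2) ∨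
            ((k : ℕ) + 1 = i ∧ x k - x i = 3 / 2)) ↔ (j = k ∨ ((j : ℕ) + 1 = k ∧ x j - x k = 3 / 2) ∨
            ((k : ℕ) + 1 = j ∧ x k - x j = 3 / 2)) := by
          constructor
          · rintro (rfl | ⟨h1, h2⟩ | ⟨h1, h2⟩)
            · exact Or.inr (Or.inr ⟨hij, hg'⟩)
            · exact Or.inl (Fin.ext (by omega))
            · exact absurd rfl (cut_disjoint hx h2 hg')
          · rintro (rfl | ⟨h1, h2⟩ | ⟨h1, h2⟩)
            · exact Or.inr (Or.inl ⟨hij, hg'⟩)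
            · exact absurd rfl (cut_disjoint hx hg' h2)
            · exact Or.inl (Fin.ext (by omega))
        exact propext key
  · have hc := inr_mem_facetsAt.1 hf
    simp only at hc hij
    have hne : j ≠ i := by rintro rfl; omega
    have hi := hx.1 i
    have hj := hx.1 j
    have hother : ∀ p : {p : Fin n × Fin n // (p.1 : ℕ) + 1 = p.2}, Sum.inr p ∈ facetsAt x →
        (Sum.inr p : FacetIndex n) ≠ Sum.inr ⟨(i, j), hij⟩ →
        p.1.1 ≠ i ∧ p.1.1 ≠ j ∧ p.1.2 ≠ i ∧ p.1.2 ≠ j := by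
      rintro ⟨⟨k, l⟩, hkl⟩ hp hpne
      have hp' := inr_mem_facetsAt.1 hp
      simp only at hp' hkl ⊢
      have h1 : k ≠ i := by
        rintro rfl
        obtain rfl : j = l := Fin.ext (by omega)
        exact hpne rfl
      refine ⟨h1, ?_, ?_, ?_⟩
      · exact (cut_disjoint hx hc hp').symm
      · exact cut_disjoint hx hp' hc
      · rintro rfl
        exact h1 (Fin.ext (by omega))
    -- On the segment `x i = 1` and `x j = -1` exclude each other, so one of the two coordinates is
    -- on no cube facet and can be moved alone.
    by_cases h : x i = 1
    · refine ⟨Pi.single j (-1), by simp [hne], ?_⟩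
      rintro (⟨m, δ⟩ | p) hg hgne
      · have hm := inl_mem_facetsAt.1 hg
        have : m ≠ j := by
          rintro rfl
          rcases sign_eq_one_or δ with e | e <;> rw [e] at hm <;> linarith
        simp [this]
      · obtain ⟨-, h2, -, h4⟩ := hother p hg hgne
        simp [h2, h4]
    · refine ⟨Pi.single i 1, by simp [hne], ?_⟩
      rintro (⟨m, δ⟩ | p) hg hgne
      · have hm := inl_mem_facetsAt.1 hg
        have : m ≠ i := by
          rintro rfl
          rcases sign_eq_one_or δ with e | e <;> rw [e] at hm
          · exact h hm
          · linarith
        simp [this]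
      · obtain ⟨h1, -, h3, -⟩ := hother p hg hgne
        simp [h1, h3]

theorem finrank_face {x : Fin n → ℝ} (hx : x ∈ polytope n) :
    Module.finrank ℝ (vectorSpan ℝ (faceAt facetForm facetValue x)) + (facetsAt x).ncard = n := by
  have := finrank_vectorSpan_faceAt (polytope_eq_polyhedron ▸ hx) fun f hf =>
    exists_dual_of_mem_facetsAt hx hf
  rwa [Module.finrank_fin_fun] at this

/-- The number of facets that contain a point. -/
theorem ncard_facetsAt (x : Fin n → ℝ) : (facetsAt x).ncard =
    {k | x k = 1 ∨ x k = -1}.ncard + {i : Fin n | ∃ j : Fin n, (i : ℕ) + 1 = j ∧ x i - x j = 3 / 2}.ncard := by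
  have h : facetsAt x = Sum.inl '' (Sum.inl ⁻¹' facetsAt x) ∪ Sum.inr '' (Sum.inr ⁻¹' facetsAt x) :=
    (Set.image_preimage_inl_union_image_preimage_inr _).symm
  rw [h, Set.ncard_union_eq (Set.disjoint_left.2 (by rintro _ ⟨a, -, rfl⟩ ⟨b, -, hb⟩; cases hb)),
    Set.ncard_image_of_injective _ Sum.inl_injective,
    Set.ncard_image_of_injective _ Sum.inr_injective]
  congr 1
  · rw [← Set.InjOn.ncard_image (f := Prod.fst)]
    · congr 1
      ext k
      constructor
      · rintro ⟨⟨k, δ⟩, hk, rfl⟩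
        rw [Set.mem_ofPred_eq, inl_mem_facetsAt.1 hk]
        exact sign_eq_one_or δ
      · rintro (hk | hk)
        · exact ⟨(k, 1), inl_mem_facetsAt.2 (by simpa using hk), rfl⟩
        · exact ⟨(k, -1), inl_mem_facetsAt.2 (by simpa using hk), rfl⟩
    · rintro ⟨k, δ⟩ hk ⟨l, δ'⟩ hl (rfl : k = l)
      have h := (inl_mem_facetsAt.1 hk).symm.trans (inl_mem_facetsAt.1 hl)
      have : δ = δ' := Units.ext (by exact_mod_cast h)
      rw [this]
  · rw [← Set.ncard_image_of_injective (f := fun p => p.1.1)]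
    · congr 1
      ext i
      constructor
      · rintro ⟨⟨⟨i, j⟩, hij⟩, hp, rfl⟩
        exact ⟨j, hij, hp⟩
      · rintro ⟨j, hij, hp⟩
        exact ⟨⟨(i, j), hij⟩, hp, rfl⟩
    · rintro ⟨⟨i, j⟩, hij⟩ ⟨⟨k, l⟩, hkl⟩ (rfl : i = k)
      obtain rfl : j = l := Fin.ext (by simp only at hij hkl; omega)
      rfl

end Faces

/-! ### Counting admissible signs and permutations. -/

section Counting

variable {n : ℕ}

theorem ncard_signs (b : Fin n → ℝ) (ε₀ : Fin n → ℤˣ) (h₀ : ∀ k, 0 ≤ ((ε₀ k : ℤ) : ℝ) * b k) :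
    {ε : Fin n → ℤˣ | ∀ k, 0 ≤ ((ε k : ℤ) : ℝ) * b k}.ncard = 2 ^ {k | b k = 0}.ncard := by
  classical
  have h : {ε : Fin n → ℤˣ | ∀ k, 0 ≤ ((ε k : ℤ) : ℝ) * b k} =
      (Fintype.piFinset fun k => if b k = 0 then Finset.univ else {ε₀ k} : Finset (Fin n → ℤˣ)) := by
    ext ε
    simp only [Set.mem_ofPred_eq, Finset.mem_coe, Fintype.mem_piFinset]
    refine forall_congr' fun k => ?_
    split_ifs with hk
    · simpa [hk] using Int.units_eq_one_or (ε k)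
    · have h1 := h₀ k
      rw [Finset.mem_singleton]
      constructor
      · intro h2
        have hk' := lt_or_gt_of_ne hk
        rcases Int.units_eq_one_or (ε k) with e | e <;> rcases Int.units_eq_one_or (ε₀ k) with e' | e'
        · rw [e, e']
        · rw [e] at h2; rw [e'] at h1; norm_num at h1 h2
          rcases hk' with h | h <;> linarith
        · rw [e] at h2; rw [e'] at h1; norm_num at h1 h2
          rcases hk' with h | h <;> linarith
        · rw [e, e']
      · intro e
        rwa [e]
  rw [h, Set.ncard_coe_finset, Fintype.card_piFinset]
  have : ∀ k, (if b k = 0 then (Finset.univ : Finset ℤˣ) else {ε₀ k}).card = if b k = 0 then 2 else 1 := by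
    intro k
    split_ifs
    · rfl
    · rfl
  simp only [this]
  rw [Finset.prod_ite, Finset.prod_const, Finset.prod_const_one, mul_one, ← Set.ncard_coe_finset]
  simp

/-- The map that exchanges the elements of `U` with their successors. -/
def swapMap (U : Finset (Fin n)) (i : Fin n) : Fin n :=
  if i ∈ U then nxt i else if prv i ∈ U then prv i else i

theorem swapMap_involutive {U : Finset (Fin n)}
    (hU : ∀ i ∈ U, ∃ j : Fin n, (i : ℕ) + 1 = j ∧ j ∉ U) : Function.Involutive (swapMap U) := by
  intro i
  by_cases h1 : i ∈ U
  · obtain ⟨j, hij, hj⟩ := hU i h1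
    rw [swapMap, swapMap, if_pos h1, nxt_eq hij, if_neg hj, prv_eq hij, if_pos h1]
  · by_cases h2 : prv i ∈ U
    · have h3 : (prv i : ℕ) + 1 = i := (prv_eq_self_or i).resolve_left fun e => h1 (e ▸ h2)
      rw [swapMap, swapMap, if_neg h1, if_pos h2, if_pos h2, nxt_eq h3]
    · simp [swapMap, h1, h2]

/-- Recovers `U` from its permutation as the set of indices that move up. -/
theorem mem_iff_swapMap {U : Finset (Fin n)}
    (hU : ∀ i ∈ U, ∃ j : Fin n, (i : ℕ) + 1 = j ∧ j ∉ U) (i : Fin n) :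
    i ∈ U ↔ (i : ℕ) + 1 = swapMap U i := by
  by_cases h1 : i ∈ U
  · obtain ⟨j, hij, hj⟩ := hU i h1
    rw [swapMap, if_pos h1, nxt_eq hij]
    exact ⟨fun _ => hij, fun _ => h1⟩
  · refine ⟨fun h => absurd h h1, fun h => ?_⟩
    rw [swapMap, if_neg h1] at h
    split_ifs at h
    · simp only [prv] at h; omega
    · omega

/-- The number of permutations that exchange some elements of `Q` with their successors. -/
theorem ncard_swapPerms {Q : Finset (Fin n)}
    (hQ : ∀ i ∈ Q, ∃ j : Fin n, (i : ℕ) + 1 = j ∧ j ∉ Q) :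
    {π : Equiv.Perm (Fin n) | ∀ i, π i = i ∨ (i ∈ Q ∧ (i : ℕ) + 1 = π i) ∨
      (π i ∈ Q ∧ (π i : ℕ) + 1 = i)}.ncard = 2 ^ Q.card := by
  classical
  have hsub : ∀ U ∈ Q.powerset, ∀ i ∈ U, ∃ j : Fin n, (i : ℕ) + 1 = j ∧ j ∉ U := by
    intro U hU i hi
    obtain ⟨j, hij, hj⟩ := hQ i (Finset.mem_powerset.1 hU hi)
    exact ⟨j, hij, fun h => hj (Finset.mem_powerset.1 hU h)⟩
  rw [← Finset.card_powerset, ← Set.ncard_coe_finset]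
  symm
  refine Set.ncard_congr (fun U hU => (swapMap_involutive (hsub U hU)).toPerm) ?_ ?_ ?_
  · intro U hU i
    change swapMap U i = i ∨ (i ∈ Q ∧ (i : ℕ) + 1 = swapMap U i) ∨
      (swapMap U i ∈ Q ∧ (swapMap U i : ℕ) + 1 = i)
    have hUQ := Finset.mem_powerset.1 (Finset.mem_coe.1 hU)
    by_cases h1 : i ∈ U
    · exact Or.inr (Or.inl ⟨hUQ h1, (mem_iff_swapMap (hsub U hU) i).1 h1⟩)
    · by_cases h2 : prv i ∈ U
      · have h3 : (prv i : ℕ) + 1 = i := (prv_eq_self_or i).resolve_left fun e => h1 (e ▸ h2)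
        rw [swapMap, if_neg h1, if_pos h2]
        exact Or.inr (Or.inr ⟨hUQ h2, h3⟩)
      · rw [swapMap, if_neg h1, if_neg h2]
        exact Or.inl rfl
  · intro U V hU hV h
    ext i
    rw [mem_iff_swapMap (hsub U hU), mem_iff_swapMap (hsub V hV)]
    have : swapMap U i = swapMap V i := congrArg (fun π : Equiv.Perm (Fin n) => π i) h
    rw [this]
  · intro π hπ
    have hdisp : ∀ i, (π i : ℕ) ≤ i + 1 ∧ (i : ℕ) ≤ π i + 1 := by
      intro i
      rcases hπ i with h | ⟨-, h⟩ | ⟨-, h⟩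
      · rw [h]; omega
      · omega
      · omega
    have hU : (Q.filter fun i : Fin n => (i : ℕ) + 1 = π i) ∈ (Q.powerset : Set (Finset (Fin n))) :=
      Finset.mem_coe.2 (Finset.mem_powerset.2 (Finset.filter_subset _ _))
    refine ⟨Q.filter fun i : Fin n => (i : ℕ) + 1 = π i, hU, Equiv.ext fun i => ?_⟩
    change swapMap _ i = π i
    rcases hπ i with h | ⟨hQi, h⟩ | ⟨hQi, h⟩
    · have h1 : i ∉ Q.filter fun i : Fin n => (i : ℕ) + 1 = π i := by
        rw [Finset.mem_filter, h]
        omega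
      have h2 : prv i ∉ Q.filter fun i : Fin n => (i : ℕ) + 1 = π i := by
        intro h2
        have h3 : (prv i : ℕ) + 1 = i := (prv_eq_self_or i).resolve_left fun e => h1 (e ▸ h2)
        have h4 : π (prv i) = i := Fin.ext (by rw [← (Finset.mem_filter.1 h2).2, h3])
        have h5 := π.injective (h4.trans h.symm)
        rw [h5] at h3
        omega
      rw [swapMap, if_neg h1, if_neg h2, h]
    · rw [swapMap, if_pos (Finset.mem_filter.2 ⟨hQi, h⟩), nxt_eq h]
    · have h1 : i ∉ Q.filter fun i : Fin n => (i : ℕ) + 1 = π i := by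
        rw [Finset.mem_filter]
        omega
      have h2 := apply_eq_of_displacement' hdisp h rfl
      rw [swapMap, if_neg h1, prv_eq h, if_pos (Finset.mem_filter.2 ⟨hQi, by rw [h2]; exact h⟩)]

end Counting

end

end ArrowMatrix

namespace ArrowMatrix

noncomputable section

/-! ### Cells as strata that do not depend on the chamber. -/

section Strata

variable {n : ℕ} {lam : Fin (n + 1) → ℝ}

/-- All the facet conditions that hold for `A` also hold for `B`. -/
def Degenerates (A B : isospectral lam) : Prop :=
  (∀ k : Fin n, A.1 0 k.succ = 0 → B.1 0 k.succ = 0 ∧ B.1 k.succ k.succ = A.1 k.succ k.succ) ∧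
    ∀ k l : Fin n, A.1 k.succ k.succ = A.1 l.succ l.succ → B.1 k.succ k.succ = B.1 l.succ l.succ

theorem Degenerates.refl (A : isospectral lam) : Degenerates A A :=
  ⟨fun _ h => ⟨h, rfl⟩, fun _ _ h => h⟩

theorem Degenerates.trans {A B C : isospectral lam} (h : Degenerates A B) (h' : Degenerates B C) :
    Degenerates A C :=
  ⟨fun k hk => ⟨(h'.1 k (h.1 k hk).1).1, (h'.1 k (h.1 k hk).1).2.trans (h.1 k hk).2⟩,
    fun k l hkl => h'.2 k l (h.2 k l hkl)⟩

/-- The closed stratum of `A` in a chamber. -/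
def closedStratum (A : isospectral lam) (σ : Equiv.Perm (Fin n)) (ε : Fin n → ℤˣ) :
    Set (isospectral lam) :=
  {B ∈ chamber lam σ ε | Degenerates A B}

/-- The open stratum of `A` in a chamber. -/
def openStratum (A : isospectral lam) (σ : Equiv.Perm (Fin n)) (ε : Fin n → ℤˣ) :
    Set (isospectral lam) :=
  {B ∈ chamber lam σ ε | Degenerates A B ∧ Degenerates B A}

/-- If a diagonal entry is an eigenvalue, then it occurs twice on the diagonal or it splits off. -/
theorem off_eq_zero_or_exists (A : isospectral lam) {k : Fin n} {m : Fin (n + 1)}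
    (h : A.1 k.succ k.succ = lam m) :
    A.1 0 k.succ = 0 ∨ ∃ l, l ≠ k ∧ A.1 l.succ l.succ = A.1 k.succ k.succ := by
  have h1 := eval_charpoly_arrow_apply (a₀ := A.1 0 0) (a := fun k : Fin n => A.1 k.succ k.succ)
    (b := fun k : Fin n => A.1 0 k.succ) k
  rw [← isospectral_eq_arrow A, A.2.2.2, Polynomial.eval_prod,
    Finset.prod_eq_zero (Finset.mem_univ m) (by simp [h]), eq_comm, neg_eq_zero, mul_eq_zero] at h1
  rcases h1 with h1 | h1
  · exact Or.inl (sq_eq_zero_iff.1 h1)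
  · obtain ⟨l, hl, h2⟩ := Finset.prod_eq_zero_iff.1 h1
    exact Or.inr ⟨l, Finset.ne_of_mem_erase hl, (sub_eq_zero.1 h2).symm⟩

/-- If the two gaps assigned to `k` differ, the `k`-th entry of `A` is their common end. Then either
`b_k = 0` and `B` has the same entry, or another entry `l` coincides with it; in that case `σ l = τ
k`, and the coincidence persists in `B`. Signs can differ only where `A`, hence `B`, has a zero. -/
theorem mem_chamber_of_degenerates (hlam : StrictMono lam) {A B : isospectral lam}
    {σ τ : Equiv.Perm (Fin n)} {ε ε' : Fin n → ℤˣ} (hA : A ∈ chamber lam σ ε)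
    (hA' : A ∈ chamber lam τ ε') (hB : B ∈ chamber lam σ ε) (h : Degenerates A B) :
    B ∈ chamber lam τ ε' := by
  intro k
  constructor
  · rcases eq_or_of_mem_Icc hlam (hA k).1 (hA' k).1 with e | ⟨e, hv⟩ | ⟨e, hv⟩
    · rw [← e]
      exact (hB k).1
    · rcases off_eq_zero_or_exists A hv with h0 | ⟨l, hl, h0⟩
      · rw [(h.1 k h0).2]
        exact (hA' k).1
      · have hlσ : σ l = τ k := by
          have h1 := (hA l).1
          rw [h0, hv] at h1
          have h2 := hlam.le_iff_le.1 h1.1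
          have h3 := hlam.le_iff_le.1 h1.2
          have h4 : σ l ≠ σ k := fun h => hl (σ.injective h)
          rw [ne_eq, Fin.ext_iff] at h4
          rw [Fin.le_def] at h2 h3
          simp only [Fin.val_succ, Fin.val_castSucc] at h2 h3
          exact Fin.ext (by omega)
        rw [← h.2 _ _ h0, ← hlσ]
        exact (hB l).1
    · rcases off_eq_zero_or_exists A hv with h0 | ⟨l, hl, h0⟩
      · rw [(h.1 k h0).2]
        exact (hA' k).1
      · have hlσ : σ l = τ k := by
          have h1 := (hA l).1
          rw [h0, hv] at h1
          have h2 := hlam.le_iff_le.1 h1.1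
          have h3 := hlam.le_iff_le.1 h1.2
          have h4 : σ l ≠ σ k := fun h => hl (σ.injective h)
          rw [ne_eq, Fin.ext_iff] at h4
          rw [Fin.le_def] at h2 h3
          simp only [Fin.val_succ, Fin.val_castSucc] at h2 h3
          exact Fin.ext (by omega)
        rw [← h.2 _ _ h0, ← hlσ]
        exact (hB l).1
  · have h1 := (hA k).2
    have h2 := (hA' k).2
    have h3 := (hB k).2
    rcases Int.units_eq_one_or (ε k) with e | e <;> rcases Int.units_eq_one_or (ε' k) with e' | e' <;>
      rw [e] at h1 h3 <;> rw [e'] at h2 ⊢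
    · exact h3
    · have h0 : A.1 0 k.succ = 0 := by norm_num at h1 h2; linarith
      rw [(h.1 k h0).1, mul_zero]
    · have h0 : A.1 0 k.succ = 0 := by norm_num at h1 h2; linarith
      rw [(h.1 k h0).1, mul_zero]
    · exact h3

/-- A degeneration of `A` in one chamber containing `A` lies in all of them, so neither the chamber
nor the representative of the class matters. -/
theorem closedStratum_eq (hlam : StrictMono lam) {A B : isospectral lam}
    {σ τ : Equiv.Perm (Fin n)} {ε ε' : Fin n → ℤˣ} (hA : A ∈ chamber lam σ ε)
    (hA' : A ∈ chamber lam τ ε') (h : Degenerates A B) (h' : Degenerates B A) :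
    closedStratum A σ ε = closedStratum B τ ε' := by
  ext C
  exact ⟨fun hC => ⟨mem_chamber_of_degenerates hlam hA hA' hC.1 hC.2, h'.trans hC.2⟩,
    fun hC => ⟨mem_chamber_of_degenerates hlam hA' hA hC.1 (h.trans hC.2), h.trans hC.2⟩⟩

theorem openStratum_eq (hlam : StrictMono lam) {A B : isospectral lam}
    {σ τ : Equiv.Perm (Fin n)} {ε ε' : Fin n → ℤˣ} (hA : A ∈ chamber lam σ ε)
    (hA' : A ∈ chamber lam τ ε') (h : Degenerates A B) (h' : Degenerates B A) :
    openStratum A σ ε = openStratum B τ ε' := by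
  ext C
  exact ⟨fun hC => ⟨mem_chamber_of_degenerates hlam hA hA' hC.1 hC.2.1, h'.trans hC.2.1,
      hC.2.2.trans h⟩,
    fun hC => ⟨mem_chamber_of_degenerates hlam hA' hA hC.1 (h.trans hC.2.1), h.trans hC.2.1,
      hC.2.2.trans h'⟩⟩

variable {c : ℝ} {hc : IsGapBound lam c} {σ τ : Equiv.Perm (Fin n)} {ε ε' : Fin n → ℤˣ}

theorem mem_cutFacet_iff_cell {x : polytope n} {k l : Fin n} (hkl : (σ k : ℕ) + 1 = σ l) :
    x.1 ∈ cutFacet (σ k) (σ l) ↔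
      (cell hc σ ε x).1 k.succ k.succ = (cell hc σ ε x).1 l.succ l.succ := by
  rw [cell_diag, cell_diag, alpha_eq_alpha_iff_mem_cutFacet hc x.2 hkl]

/-- Turns inclusion of facet sets into a relation between matrices that does not mention `σ` and
`ε`, so faces of different pieces can be compared. -/
theorem facetsAt_subset_iff {x y : polytope n} :
    facetsAt x.1 ⊆ facetsAt y.1 ↔ Degenerates (cell hc σ ε x) (cell hc σ ε y) := by
  constructor
  · intro h
    refine ⟨fun k hk => ?_, fun k l hkl => ?_⟩
    · rw [cell_off_eq_zero_iff] at hk ⊢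
      rw [cell_diag, cell_diag]
      rcases hk with hk | hk
      · have hy : y.1 (σ k) = 1 := by
          have := inl_mem_facetsAt.1 (h (inl_mem_facetsAt (δ := 1).2 (by simpa using hk)))
          simpa using this
        exact ⟨Or.inl hy, by rw [alpha_of_eq_one hc x.2 hk, alpha_of_eq_one hc y.2 hy]⟩
      · have hy : y.1 (σ k) = -1 := by
          have := inl_mem_facetsAt.1 (h (inl_mem_facetsAt (δ := -1).2 (by simpa using hk)))
          simpa using this
        exact ⟨Or.inr hy, by rw [alpha_of_eq_neg_one hc x.2 hk, alpha_of_eq_neg_one hc y.2 hy]⟩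
    · rw [cell_diag, cell_diag] at hkl ⊢
      have key : ∀ i j : Fin n, i < j → alpha lam c x.1 i = alpha lam c x.1 j →
          alpha lam c y.1 i = alpha lam c y.1 j := by
        intro i j hij he
        have hs := succ_eq_of_alpha_eq hc x.2 hij he
        rw [alpha_eq_alpha_iff_mem_cutFacet hc x.2 hs] at he
        rw [alpha_eq_alpha_iff_mem_cutFacet hc y.2 hs]
        exact ⟨y.2, h (inr_mem_facetsAt (p := ⟨(i, j), hs⟩).2 he.2)⟩
      rcases lt_trichotomy (σ k) (σ l) with hlt | heq | hlt
      · exact key _ _ hlt hkl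
      · rw [heq]
      · exact (key _ _ hlt hkl.symm).symm
  · rintro ⟨h1, h2⟩ (⟨i, δ⟩ | ⟨⟨i, j⟩, hij⟩) hf
    · rw [inl_mem_facetsAt] at hf ⊢
      obtain ⟨k, rfl⟩ := σ.surjective i
      rcases Int.units_eq_one_or δ with rfl | rfl
      · have hx := (mem_cubeFacet_one_iff (hc := hc) (ε := ε)).1 ⟨x.2, hf⟩
        have hy := h1 k hx.1
        exact ((mem_cubeFacet_one_iff (hc := hc) (ε := ε)).2 ⟨hy.1, hy.2.trans hx.2⟩).2
      · have hx := (mem_cubeFacet_neg_one_iff (hc := hc) (ε := ε)).1 ⟨x.2, hf⟩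
        have hy := h1 k hx.1
        exact ((mem_cubeFacet_neg_one_iff (hc := hc) (ε := ε)).2 ⟨hy.1, hy.2.trans hx.2⟩).2
    · obtain ⟨k, rfl⟩ := σ.surjective i
      obtain ⟨l, rfl⟩ := σ.surjective j
      have hx := (mem_cutFacet_iff_cell (hc := hc) (ε := ε) hij).1 ⟨x.2, hf⟩
      exact ((mem_cutFacet_iff_cell (hc := hc) (ε := ε) hij).2 (h2 k l hx)).2

theorem image_faceAt (x : polytope n) :
    cell hc σ ε '' {y | y.1 ∈ faceAt facetForm facetValue x.1} =
      closedStratum (cell hc σ ε x) σ ε := by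
  ext B
  constructor
  · rintro ⟨y, hy, rfl⟩
    exact ⟨cell_mem_chamber, facetsAt_subset_iff.1 hy.2⟩
  · rintro ⟨hB, hd⟩
    obtain ⟨y, rfl⟩ := exists_cell_eq (hc := hc) hB
    exact ⟨y, ⟨polytope_eq_polyhedron ▸ y.2, facetsAt_subset_iff.2 hd⟩, rfl⟩

theorem image_intrinsicInterior_faceAt (x : polytope n) :
    cell hc σ ε '' {y | y.1 ∈ intrinsicInterior ℝ (faceAt facetForm facetValue x.1)} =
      openStratum (cell hc σ ε x) σ ε := by
  rw [intrinsicInterior_faceAt (polytope_eq_polyhedron ▸ x.2)]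
  ext B
  constructor
  · rintro ⟨y, hy, rfl⟩
    exact ⟨cell_mem_chamber, facetsAt_subset_iff.1 hy.2.ge, facetsAt_subset_iff.1 hy.2.le⟩
  · rintro ⟨hB, hd, hd'⟩
    obtain ⟨y, rfl⟩ := exists_cell_eq (hc := hc) hB
    exact ⟨y, ⟨polytope_eq_polyhedron ▸ y.2,
      (facetsAt_subset_iff.2 hd').antisymm (facetsAt_subset_iff.2 hd)⟩, rfl⟩

/-- The cells are the strata. -/
theorem isCellPair_iff {Φ : Glued n ≃ₜ isospectral lam} (hΦ : ∀ σ ε, cellMap Φ σ ε = cell hc σ ε)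
    {d : ℕ} {C O : Set (isospectral lam)} :
    IsCellPair Φ d C O ↔ ∃ σ ε x, d + (facetsAt x.1).ncard = n ∧
      C = closedStratum (cell hc σ ε x) σ ε ∧ O = openStratum (cell hc σ ε x) σ ε := by
  constructor
  · rintro ⟨σ, ε, F, hF, hne, rfl, rfl, rfl⟩
    rw [polytope_eq_polyhedron] at hF
    obtain ⟨x, hx, rfl⟩ := exists_eq_faceAt hF hne
    rw [← polytope_eq_polyhedron] at hx
    refine ⟨σ, ε, ⟨x, hx⟩, finrank_face hx, ?_, ?_⟩
    · rw [hΦ, ← image_faceAt]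
    · rw [hΦ, ← image_intrinsicInterior_faceAt]
  · rintro ⟨σ, ε, x, hd, rfl, rfl⟩
    have hx : x.1 ∈ polyhedron facetForm facetValue := polytope_eq_polyhedron ▸ x.2
    refine ⟨σ, ε, faceAt facetForm facetValue x.1, ?_, ⟨_, mem_faceAt_self hx⟩, ?_, ?_, ?_⟩
    · have h := isExposed_faceAt hx
      rwa [← polytope_eq_polyhedron] at h
    · have := finrank_face x.2
      omega
    · rw [hΦ, image_faceAt]
    · rw [hΦ, image_intrinsicInterior_faceAt]

/-- The number of chambers that contain a point. -/
theorem ncard_chambers (x : polytope n) :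
    {p : Equiv.Perm (Fin n) × (Fin n → ℤˣ) | cell hc σ ε x ∈ chamber lam p.1 p.2}.ncard =
      2 ^ (facetsAt x.1).ncard := by
  classical
  have hprod : {p : Equiv.Perm (Fin n) × (Fin n → ℤˣ) | cell hc σ ε x ∈ chamber lam p.1 p.2} =
      {τ : Equiv.Perm (Fin n) | ∀ k, (cell hc σ ε x).1 k.succ k.succ ∈
        Set.Icc (lam (τ k).castSucc) (lam (τ k).succ)} ×ˢ
      {ε' : Fin n → ℤˣ | ∀ k, 0 ≤ ((ε' k : ℤ) : ℝ) * (cell hc σ ε x).1 0 k.succ} := by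
    ext ⟨τ, ε'⟩
    exact forall_and
  have hsigns : {k : Fin n | (cell hc σ ε x).1 0 k.succ = 0}.ncard =
      {i | x.1 i = 1 ∨ x.1 i = -1}.ncard := by
    rw [← Set.ncard_image_of_injective _ σ.injective]
    congr 1
    ext i
    simp only [cell_off_eq_zero_iff, Set.mem_image, Set.mem_ofPred_eq]
    exact ⟨by rintro ⟨k, hk, rfl⟩; exact hk, fun h => ⟨σ.symm i, by simpa using h, by simp⟩⟩
  have hperm : {τ : Equiv.Perm (Fin n) | ∀ k, (cell hc σ ε x).1 k.succ k.succ ∈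
        Set.Icc (lam (τ k).castSucc) (lam (τ k).succ)}.ncard =
      2 ^ {i : Fin n | ∃ j : Fin n, (i : ℕ) + 1 = j ∧ x.1 i - x.1 j = 3 / 2}.ncard := by
    set Q : Finset (Fin n) := Finset.univ.filter fun i : Fin n =>
      ∃ j : Fin n, (i : ℕ) + 1 = j ∧ x.1 i - x.1 j = 3 / 2 with hQ
    have hQc : {i : Fin n | ∃ j : Fin n, (i : ℕ) + 1 = j ∧ x.1 i - x.1 j = 3 / 2}.ncard = Q.card := by
      rw [← Set.ncard_coe_finset, hQ]
      simp
    have hdisj : ∀ i ∈ Q, ∃ j : Fin n, (i : ℕ) + 1 = j ∧ j ∉ Q := by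
      intro i hi
      obtain ⟨j, hij, h⟩ := (Finset.mem_filter.1 hi).2
      refine ⟨j, hij, fun hj => ?_⟩
      obtain ⟨l, -, h'⟩ := (Finset.mem_filter.1 hj).2
      exact cut_disjoint x.2 h h' rfl
    -- Each cut facet through `x` allows its two gaps to be exchanged independently; right
    -- multiplication by `σ` turns these exchanges into the admissible permutations.
    rw [hQc, ← ncard_swapPerms hdisj]
    refine Eq.trans ?_ (Set.ncard_image_of_injective _ (mul_left_injective σ))
    congr 1
    have hmem : ∀ i, alpha lam c x.1 i ∈ Set.Icc (lam i.castSucc) (lam i.succ) :=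
      fun i => ⟨le_alpha hc x.2 i, alpha_le hc x.2 i⟩
    have hcut : ∀ i j : Fin n, (i : ℕ) + 1 = j → x.1 i - x.1 j = 3 / 2 →
        alpha lam c x.1 i = lam i.succ ∧ alpha lam c x.1 j = lam i.succ := by
      intro i j hij h
      have h1 := (alpha_eq_alpha_iff_mem_cutFacet hc x.2 hij).2 ⟨x.2, h⟩
      have h2 := alpha_of_dampR_eq_zero (lam := lam) (c := c) ((dampR_eq_zero_iff x.2 hij).2 h)
      exact ⟨h2, h1 ▸ h2⟩
    ext τ
    constructor
    · intro hτ
      have hπ : ∀ i, alpha lam c x.1 i ∈ Set.Icc (lam ((τ * σ⁻¹) i).castSucc) (lam ((τ * σ⁻¹) i).succ) := by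
        intro i
        have := hτ (σ.symm i)
        rwa [cell_diag, Equiv.apply_symm_apply] at this
      have hcase := fun i => eq_or_of_mem_Icc hc.strictMono (hmem i) (hπ i)
      have hdisp : ∀ i, ((τ * σ⁻¹) i : ℕ) ≤ i + 1 ∧ (i : ℕ) ≤ (τ * σ⁻¹) i + 1 := by
        intro i
        rcases hcase i with e | ⟨e, -⟩ | ⟨e, -⟩
        · rw [← e]; omega
        · omega
        · omega
      have hup : ∀ i j : Fin n, (i : ℕ) + 1 = j → (τ * σ⁻¹) i = j → (τ * σ⁻¹) j = i → i ∈ Q := by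
        intro i j hij hi hj
        refine Finset.mem_filter.2 ⟨Finset.mem_univ _, j, hij, ?_⟩
        refine ((alpha_eq_alpha_iff_mem_cutFacet hc x.2 hij).1 ?_).2
        have h1 := hπ i
        have h2 := hπ j
        rw [hi, castSucc_eq_succ hij] at h1
        rw [hj] at h2
        have h3 := hmem i
        have h4 := hmem j
        rw [castSucc_eq_succ hij] at h4
        linarith [h1.1, h2.2, h3.2, h4.1]
      refine ⟨τ * σ⁻¹, fun i => ?_, inv_mul_cancel_right _ _⟩
      rcases hcase i with e | ⟨e, -⟩ | ⟨e, -⟩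
      · exact Or.inl e.symm
      · exact Or.inr (Or.inl ⟨hup _ _ e rfl (apply_eq_of_displacement hdisp e rfl), e⟩)
      · exact Or.inr (Or.inr ⟨hup _ _ e (apply_eq_of_displacement' hdisp e rfl) rfl, e⟩)
    · rintro ⟨π, hπ, rfl⟩ k
      rw [cell_diag]
      change _ ∈ Set.Icc (lam (π (σ k)).castSucc) (lam (π (σ k)).succ)
      rcases hπ (σ k) with h | ⟨h, e⟩ | ⟨h, e⟩
      · rw [h]
        exact hmem _
      · obtain ⟨j, hij, hx⟩ := (Finset.mem_filter.1 h).2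
        obtain rfl : π (σ k) = j := Fin.ext (by omega)
        obtain ⟨h1, h2⟩ := hcut _ _ hij hx
        rw [h1.trans h2.symm]
        exact hmem _
      · obtain ⟨j, hij, hx⟩ := (Finset.mem_filter.1 h).2
        obtain rfl : σ k = j := Fin.ext (by omega)
        obtain ⟨h1, h2⟩ := hcut _ _ hij hx
        rw [h2.trans h1.symm]
        exact hmem _
  rw [hprod, Set.ncard_prod, hperm, ncard_signs _ ε fun k => (cell_mem_chamber k).2, hsigns,
    ncard_facetsAt, pow_add, mul_comm]

/-- The center of the polytope. -/
def center (n : ℕ) : polytope n := ⟨0, fun k => by simp, fun i j _ => by norm_num⟩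

theorem facetsAt_center : facetsAt (center n).1 = ∅ := by
  refine Set.eq_empty_of_forall_notMem ?_
  rintro (⟨k, δ⟩ | p) h
  · have := inl_mem_facetsAt.1 h
    rcases sign_eq_one_or δ with e | e <;> rw [e] at this <;> simp [center] at this
  · have := inr_mem_facetsAt.1 h
    norm_num [center] at this

/-- The center of a piece is on no facet, so its matrix lies in a single chamber. -/
theorem chamber_injective (hc : IsGapBound lam c) :
    Function.Injective fun p : Equiv.Perm (Fin n) × (Fin n → ℤˣ) => chamber lam p.1 p.2 := by
  rintro p q (h : chamber lam p.1 p.2 = chamber lam q.1 q.2)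
  have h1 := ncard_chambers (hc := hc) (σ := p.1) (ε := p.2) (center n)
  rw [facetsAt_center, Set.ncard_empty, pow_zero, Set.ncard_eq_one] at h1
  obtain ⟨r, hr⟩ := h1
  have hp : p ∈ {q : Equiv.Perm (Fin n) × (Fin n → ℤˣ) |
      cell hc p.1 p.2 (center n) ∈ chamber lam q.1 q.2} := cell_mem_chamber
  have hq : q ∈ {q : Equiv.Perm (Fin n) × (Fin n → ℤˣ) |
      cell hc p.1 p.2 (center n) ∈ chamber lam q.1 q.2} := by
    rw [Set.mem_ofPred_eq, ← h]
    exact cell_mem_chamber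
  rw [hr] at hp hq
  exact hp.trans hq.symm

theorem closedStratum_eq_chamber {x : polytope n} (h : facetsAt x.1 = ∅) :
    closedStratum (cell hc σ ε x) σ ε = chamber lam σ ε := by
  refine Set.Subset.antisymm (fun B hB => hB.1) fun B hB => ⟨hB, ?_⟩
  obtain ⟨y, rfl⟩ := exists_cell_eq (hc := hc) hB
  rw [← facetsAt_subset_iff, h]
  exact Set.empty_subset _

/-- The cells of top dimension are the chambers. -/
theorem isCell_top_iff {Φ : Glued n ≃ₜ isospectral lam} (hΦ : ∀ σ ε, cellMap Φ σ ε = cell hc σ ε)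
    {C : Set (isospectral lam)} :
    IsCell Φ n C ↔ ∃ p : Equiv.Perm (Fin n) × (Fin n → ℤˣ), chamber lam p.1 p.2 = C := by
  constructor
  · rintro ⟨O, hO⟩
    obtain ⟨σ, ε, x, hd, rfl, -⟩ := (isCellPair_iff hΦ).1 hO
    have h0 : facetsAt x.1 = ∅ := (Set.ncard_eq_zero (Set.toFinite _)).1 (by omega)
    exact ⟨(σ, ε), (closedStratum_eq_chamber h0).symm⟩
  · rintro ⟨⟨σ, ε⟩, rfl⟩
    exact ⟨_, (isCellPair_iff hΦ).2 ⟨σ, ε, center n, by rw [facetsAt_center, Set.ncard_empty, add_zero],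
      (closedStratum_eq_chamber facetsAt_center).symm, rfl⟩⟩

end Strata

end

end ArrowMatrix

/-! ### The cell structure of the isospectral space. -/

theorem mainTheorem6 (n : ℕ) (lam : Fin (n + 1) → ℝ) (hlam : StrictMono lam) :
    ∃ Φ : ArrowMatrix.Glued n ≃ₜ ArrowMatrix.isospectral lam,
      -- each piece is embedded, onto the canonical region of the isospectral space
      (∀ (σ : Equiv.Perm (Fin n)) (ε : Fin n → ℤˣ),
        IsClosedEmbedding (ArrowMatrix.cellMap Φ σ ε) ∧
        Set.range (ArrowMatrix.cellMap Φ σ ε) = ArrowMatrix.chamber lam σ ε) ∧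
      -- the facets correspond to the canonical ones
      (∀ (σ : Equiv.Perm (Fin n)) (ε : Fin n → ℤˣ) (x : ArrowMatrix.polytope n),
        (∀ k : Fin n,
          (x.1 ∈ ArrowMatrix.cubeFacet (σ k) 1 ↔
            (ArrowMatrix.cellMap Φ σ ε x).1 0 k.succ = 0 ∧
            (ArrowMatrix.cellMap Φ σ ε x).1 k.succ k.succ = lam (σ k).succ) ∧
          (x.1 ∈ ArrowMatrix.cubeFacet (σ k) (-1) ↔
            (ArrowMatrix.cellMap Φ σ ε x).1 0 k.succ = 0 ∧
            (ArrowMatrix.cellMap Φ σ ε x).1 k.succ k.succ = lam (σ k).castSucc)) ∧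
        (∀ k l : Fin n, (σ k : ℕ) + 1 = σ l →
          (x.1 ∈ ArrowMatrix.cutFacet (σ k) (σ l) ↔
            (ArrowMatrix.cellMap Φ σ ε x).1 k.succ k.succ =
              (ArrowMatrix.cellMap Φ σ ε x).1 l.succ l.succ))) ∧
      -- every point lies in the interior of exactly one cell
      (∀ A : ArrowMatrix.isospectral lam,
        ∃! q : Set (ArrowMatrix.isospectral lam) × Set (ArrowMatrix.isospectral lam),
          (∃ d, ArrowMatrix.IsCellPair Φ d q.1 q.2) ∧ A ∈ q.2) ∧
      -- the number of top-dimensional cells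
      {c | ArrowMatrix.IsCell Φ n c}.ncard = 2 ^ n * n ! ∧
      -- each cell of codimension `s` lies in exactly `2 ^ s` top-dimensional cells
      (∀ d s : ℕ, d + s = n → ∀ c, ArrowMatrix.IsCell Φ d c →
        {C | ArrowMatrix.IsCell Φ n C ∧ c ⊆ C}.ncard = 2 ^ s) := by
  open ArrowMatrix in
  obtain ⟨c, hc⟩ := exists_isGapBound hlam
  obtain ⟨Φ, hΦ⟩ := exists_homeomorph hc
  refine ⟨Φ, fun σ ε => ?_, fun σ ε x => ⟨fun k => ?_, fun k l hkl => ?_⟩, fun A => ?_, ?_, ?_⟩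
  · rw [hΦ]
    exact ⟨continuous_cell.isClosedEmbedding cell_injective, range_cell⟩
  · rw [hΦ]
    exact ⟨mem_cubeFacet_one_iff, mem_cubeFacet_neg_one_iff⟩
  · rw [hΦ]
    exact mem_cutFacet_iff_cell hkl
  · obtain ⟨σ, ε, hA⟩ := exists_mem_chamber hlam A
    obtain ⟨x, rfl⟩ := exists_cell_eq (hc := hc) hA
    refine ⟨(closedStratum (cell hc σ ε x) σ ε, openStratum (cell hc σ ε x) σ ε),
      ⟨⟨_, (isCellPair_iff hΦ).2 ⟨σ, ε, x, finrank_face x.2, rfl, rfl⟩⟩,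
        hA, Degenerates.refl _, Degenerates.refl _⟩, ?_⟩
    -- Points of an open stratum degenerate to its defining matrix and conversely, so any such cell
    -- is the stratum of an equivalent matrix.
    rintro ⟨C, O⟩ ⟨⟨d, hd⟩, hmem⟩
    obtain ⟨τ, ε', y, -, rfl, rfl⟩ := (isCellPair_iff hΦ).1 hd
    obtain ⟨h1, h2, h3⟩ := hmem
    exact Prod.ext (closedStratum_eq hlam hA h1 h3 h2).symm (openStratum_eq hlam hA h1 h3 h2).symm
  · have : {C | IsCell Φ n C} =
        (fun p : Equiv.Perm (Fin n) × (Fin n → ℤˣ) => chamber lam p.1 p.2) '' Set.univ := by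
      ext C
      rw [Set.image_univ]
      exact isCell_top_iff hΦ
    rw [this, Set.ncard_image_of_injective _ (chamber_injective hc), Set.ncard_univ,
      Nat.card_eq_fintype_card, Fintype.card_prod, Fintype.card_perm, Fintype.card_fin,
      Fintype.card_fun, Fintype.card_fin, Fintype.card_units_int, mul_comm]
  · rintro d s hds C ⟨O, hO⟩
    obtain ⟨σ, ε, x, hd, rfl, -⟩ := (isCellPair_iff hΦ).1 hO
    -- The codimension is the number of facets through `x`, and a chamber contains the stratum
    -- exactly when it contains `cell hc σ ε x`.
    obtain rfl : s = (facetsAt x.1).ncard := by omega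
    rw [← ncard_chambers (hc := hc) (σ := σ) (ε := ε) x,
      ← Set.ncard_image_of_injective _ (chamber_injective hc)]
    congr 1
    ext C
    constructor
    · rintro ⟨hC, hsub⟩
      obtain ⟨p, rfl⟩ := (isCell_top_iff hΦ).1 hC
      exact ⟨p, hsub ⟨cell_mem_chamber, Degenerates.refl _⟩, rfl⟩
    · rintro ⟨p, hp, rfl⟩
      exact ⟨(isCell_top_iff hΦ).2 ⟨p, rfl⟩, fun B hB =>
        mem_chamber_of_degenerates hlam cell_mem_chamber hp hB.1 hB.2⟩
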